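/- Let $G$ be a finite, connected multigraph without loops (parallel edges are allowed). For each edge $e$ of $G$ with a chosen orientation, let $-e$ denote the same edge with the opposite orientation. For an integer $r \ge 1$ and a labeling $\sigma$ of the oriented edges of $G$ by permutations in $S_r$ with $\sigma_{-e} = \sigma_e^{-1}$, let $H_\sigma$ be the $r$-covering ($r$-lift) of $G$ with vertex set $V(G) \times \{1,\dots,r\}$ which has, for every edge of $G$, oriented as $e\colon x \to y$, the $r$ edges joining $(x,i)$ to $(y,\sigma_e(i))$, $1 \le i \le r$. Every eigenvalue of the adjacency matrix $A_G$ is an eigenvalue of $A_{H_\sigma}$, with at least the same multiplicity; the new eigenvalues of $H_\sigma$ are the $(r-1)\,|V(G)|$ eigenvalues that remain when the multiset of eigenvalues of $A_G$ is removed from the multiset of eigenvalues of $A_{H_\sigma}$. Let $T$ be the universal covering tree of $G$ and let $\rho(G)$ be its spectral radius, that is, the spectral radius of the adjacency operator $(A_T f)(v) = \sum_{u \sim v} f(u)$ on $\ell^2(V(T))$. Theorem. For every finite, connected, loopless multigraph $G$ and every integer $r \ge 1$ there is a labeling $\sigma$ such that all the new eigenvalues of the $r$-covering $H_\sigma$ of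 $G$ are at most $\rho(G)$. -/

import Mathlib

open scoped Graph ENNReal

noncomputable section

/-! ## The adjacency operator of an infinite graph of bounded degree -/

namespace SimpleGraph

variable {W : Type*}

/-- All vertex degrees are finite and bounded by a common constant. -/
def HasBoundedDegree (T : SimpleGraph W) : Prop :=
  ∃ D : ℕ, ∀ v, (T.neighborSet v).Finite ∧ (T.neighborSet v).ncard ≤ D

/-- `(A f)(v) = ∑_{u ∼ v} f u`. -/
def adjSum (T : SimpleGraph W) (f : W → ℂ) (v : W) : ℂ :=
  ∑ᶠ u ∈ T.neighborSet v, f u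

theorem sum_norm_adjSum_sq_le (T : SimpleGraph W) {D : ℕ}
    (hD : ∀ v, (T.neighborSet v).Finite ∧ (T.neighborSet v).ncard ≤ D)
    (f : lp (fun _ : W => ℂ) 2) (s : Finset W) :
    ∑ v ∈ s, ‖T.adjSum f v‖ ^ (2 : ℝ≥0∞).toReal ≤
      ((D : ℝ) * ‖f‖) ^ (2 : ℝ≥0∞).toReal := by
  classical
  have h2 : (2 : ℝ≥0∞).toReal = ((2 : ℕ) : ℝ) := by simp
  simp only [h2, Real.rpow_natCast]
  let N : W → Finset W := fun v => (hD v).1.toFinset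
  have hN : ∀ v u, u ∈ N v ↔ T.Adj v u := by intro v u; simp [N]
  have hcard : ∀ v, (N v).card ≤ D := fun v => by
    simpa [N, Set.ncard_eq_toFinset_card _ (hD v).1] using (hD v).2
  have h1 : ∀ v, ‖T.adjSum f v‖ ^ 2 ≤ D * ∑ u ∈ N v, ‖f u‖ ^ 2 := by
    intro v
    have e : T.adjSum f v = ∑ u ∈ N v, f u :=
      finsum_mem_eq_finite_toFinset_sum _ (hD v).1
    rw [e]
    calc ‖∑ u ∈ N v, f u‖ ^ 2 ≤ (∑ u ∈ N v, ‖f u‖) ^ 2 := by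
          gcongr; exact norm_sum_le _ _
      _ ≤ (N v).card * ∑ u ∈ N v, ‖f u‖ ^ 2 := sq_sum_le_card_mul_sum_sq
      _ ≤ D * ∑ u ∈ N v, ‖f u‖ ^ 2 := by
          gcongr; exact_mod_cast hcard v
  have h3 : ∑ v ∈ s, ∑ u ∈ N v, ‖f u‖ ^ 2 ≤ D * ‖f‖ ^ 2 := by
    have hsw : ∑ v ∈ s, ∑ u ∈ N v, ‖f u‖ ^ 2
        = ∑ u ∈ s.biUnion N, ∑ _v ∈ s.filter (fun v => u ∈ N v), ‖f u‖ ^ 2 := by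
      refine Finset.sum_comm' ?_
      intro v u
      simp only [Finset.mem_biUnion, Finset.mem_filter]
      constructor
      · rintro ⟨hv, hu⟩; exact ⟨⟨hv, hu⟩, v, hv, hu⟩
      · rintro ⟨⟨hv, hu⟩, _⟩; exact ⟨hv, hu⟩
    rw [hsw]
    calc _ ≤ ∑ u ∈ s.biUnion N, (D : ℝ) * ‖f u‖ ^ 2 := by
          refine Finset.sum_le_sum fun u _ => ?_
          rw [Finset.sum_const, nsmul_eq_mul]
          gcongr
          refine le_trans (Finset.card_le_card ?_) (hcard u)
          intro v hv
          rw [Finset.mem_filter] at hv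
          exact (hN _ _).2 ((hN _ _).1 hv.2).symm
      _ = D * ∑ u ∈ s.biUnion N, ‖f u‖ ^ 2 := by rw [Finset.mul_sum]
      _ ≤ D * ‖f‖ ^ 2 := by
          gcongr
          have := lp.sum_rpow_le_norm_rpow (p := 2) (by simp) f (s.biUnion N)
          simpa only [h2, Real.rpow_natCast] using this
  calc ∑ v ∈ s, ‖T.adjSum f v‖ ^ 2 ≤ ∑ v ∈ s, D * ∑ u ∈ N v, ‖f u‖ ^ 2 :=
        Finset.sum_le_sum fun v _ => h1 v
    _ = D * ∑ v ∈ s, ∑ u ∈ N v, ‖f u‖ ^ 2 := by rw [Finset.mul_sum]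
    _ ≤ D * (D * ‖f‖ ^ 2) := by gcongr
    _ = (D * ‖f‖) ^ 2 := by ring

/-- The adjacency operator of a graph of bounded degree, acting on `ℓ²` of its vertices by
`(A f)(v) = ∑_{u ∼ v} f u`. -/
def adjOperator (T : SimpleGraph W) (hT : T.HasBoundedDegree) :
    lp (fun _ : W => ℂ) 2 →L[ℂ] lp (fun _ : W => ℂ) 2 :=
  LinearMap.mkContinuousOfExistsBound
    { toFun := fun f => ⟨T.adjSum f, memℓp_gen' (T.sum_norm_adjSum_sq_le hT.choose_spec f)⟩
      map_add' := fun f g => by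
        ext v
        exact finsum_mem_add_distrib (hT.choose_spec v).1
      map_smul' := fun c f => by
        ext v
        change T.adjSum (fun u => c • f u) v = c • T.adjSum f v
        simp only [adjSum, finsum_mem_eq_finite_toFinset_sum _ (hT.choose_spec v).1,
          Finset.smul_sum] }
    ⟨hT.choose, fun f => lp.norm_le_of_forall_sum_le (by simp) (by positivity)
      (T.sum_norm_adjSum_sq_le hT.choose_spec f)⟩

/-- The spectral radius of a graph of bounded degree: that of its adjacency operator on `ℓ²`. -/
def adjSpectralRadius (T : SimpleGraph W) (hT : T.HasBoundedDegree) : ℝ :=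
  (spectralRadius ℂ (T.adjOperator hT)).toReal

end SimpleGraph

/-! ## Finite multigraphs, their coverings and their universal covering trees

Multigraphs are Mathlib's `Graph α β` (vertices in `α`, edges in `β`, parallel edges allowed).
The notions below are the usual ones for graphs without loops: a loop would have
to be counted with both of its orientations. -/

namespace Graph

variable {α β : Type*}

/-- Connectedness: there is a vertex, and any two vertices are joined by a walk. -/
def IsConnected (G : Graph α β) : Prop :=
  V(G).Nonempty ∧ ∀ x ∈ V(G), ∀ y ∈ V(G), Relation.ReflTransGen G.Adj x y

/-- The adjacency matrix: the entry at `(x, y)` is the number of edges joining `x` and `y`. -/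
def adjMatrix (G : Graph α β) : Matrix V(G) V(G) ℝ :=
  Matrix.of fun x y => ({e | G.IsLink e x y}.ncard : ℝ)

open Classical in
/-- The eigenvalues of the adjacency matrix of a finite graph, with multiplicity. -/
def eigenvalues (G : Graph α β) [Finite V(G)] : Multiset ℝ :=
  letI := Fintype.ofFinite V(G)
  G.adjMatrix.charpoly.roots

/-- Oriented edges: `edge` traversed from `fst` to `snd`. -/
@[ext]
structure OrientedEdge (G : Graph α β) where
  edge : β
  fst : α
  snd : α
  isLink : G.IsLink edge fst snd

/-- The same edge with the opposite orientation. -/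
def OrientedEdge.reverse {G : Graph α β} (d : G.OrientedEdge) : G.OrientedEdge :=
  ⟨d.edge, d.snd, d.fst, d.isLink.symm⟩

instance (G : Graph α β) [Finite V(G)] [Finite E(G)] : Finite G.OrientedEdge :=
  Finite.of_injective
    (fun d : G.OrientedEdge =>
      ((⟨d.edge, d.isLink.edge_mem⟩, ⟨d.fst, d.isLink.left_mem⟩, ⟨d.snd, d.isLink.right_mem⟩) :
        E(G) × V(G) × V(G)))
    (fun d d' h => by
      simp only [Prod.mk.injEq, Subtype.mk.injEq] at h
      exact OrientedEdge.ext h.1 h.2.1 h.2.2)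

/-- Labelings `σ` of the oriented edges by permutations in `S_r`, with `σ (-e) = (σ e)⁻¹`. -/
structure PermLabeling (G : Graph α β) (r : ℕ) where
  perm : G.OrientedEdge → Equiv.Perm (Fin r)
  perm_reverse : ∀ d, perm d.reverse = (perm d)⁻¹

/-- The `r`-covering of `G` defined by `σ`. Its vertices are the pairs `(x, i)` with `x` a vertex
of `G` and `i : Fin r`. Over an edge `e` of `G`, oriented from `x` to `y`, it has
the `r` edges joining `(x, i)` to `(y, σ e i)`. The one at `i` is named by `e` and by the unordered
pair of its ends, so that it has the same name for both orientations of `e`. -/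
def covering (G : Graph α β) {r : ℕ} (σ : G.PermLabeling r) :
    Graph (α × Fin r) (β × Sym2 (α × Fin r)) where
  vertexSet := {p | p.1 ∈ V(G)}
  IsLink a p q := a.2 = s(p, q) ∧
    ∃ h : G.IsLink a.1 p.1 q.1, σ.perm ⟨a.1, p.1, q.1, h⟩ p.2 = q.2
  isLink_symm a _ := ⟨fun p q h => by
    obtain ⟨h1, h2, h3⟩ := h
    refine ⟨h1.trans Sym2.eq_swap, h2.symm, ?_⟩
    have := σ.perm_reverse ⟨a.1, p.1, q.1, h2⟩
    change σ.perm ⟨a.1, q.1, p.1, h2.symm⟩ = _ at this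
    rw [this, ← h3]; exact Equiv.symm_apply_apply _ _⟩
  eq_or_eq_of_isLink_of_isLink a p q p' q' h h' := by
    have := h.1.symm.trans h'.1
    rw [Sym2.eq_iff] at this
    tauto
  left_mem_of_isLink a p q h := h.2.1.left_mem

instance (G : Graph α β) [Finite V(G)] {r : ℕ} (σ : G.PermLabeling r) :
    Finite V(G.covering σ) :=
  Finite.of_injective
    (fun p : V(G.covering σ) => ((⟨p.1.1, p.2⟩, p.1.2) : V(G) × Fin r))
    (fun p q h => by
      simp only [Prod.mk.injEq] at h
      exact Subtype.ext (Prod.ext (congrArg Subtype.val h.1) h.2))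

/-- The new eigenvalues of the covering: all its eigenvalues except for
those of `G`, as multisets. -/
def newEigenvalues (G : Graph α β) [Finite V(G)] {r : ℕ} (σ : G.PermLabeling r) : Multiset ℝ :=
  (G.covering σ).eigenvalues - G.eigenvalues

/-- A list of oriented edges that is a non-backtracking walk in `G` starting at `v₀`. -/
def IsNonBacktrackingFrom (G : Graph α β) (v₀ : α) (w : List G.OrientedEdge) : Prop :=
  (∀ d ∈ w.head?, d.fst = v₀) ∧ w.IsChain (fun d d' => d.snd = d'.fst ∧ d' ≠ d.reverse)

/-- The universal covering tree of a connected graph `G` with base point `v₀`. Its vertices are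
the non-backtracking walks in `G` starting at `v₀`; two walks are adjacent if one extends the other
by a single step. Up to isomorphism it does not depend on `v₀`. -/
def universalCover (G : Graph α β) (v₀ : V(G)) :
    SimpleGraph {w : List G.OrientedEdge // G.IsNonBacktrackingFrom v₀ w} where
  Adj w w' := ∃ d, w'.1 = w.1 ++ [d] ∨ w.1 = w'.1 ++ [d]
  symm := ⟨fun _ _ ⟨d, h⟩ => ⟨d, h.symm⟩⟩
  loopless := ⟨fun w ⟨d, h⟩ => by simp at h⟩

theorem universalCover_hasBoundedDegree (G : Graph α β) [Finite V(G)] [Finite E(G)] (v₀ : V(G)) :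
    (G.universalCover v₀).HasBoundedDegree := by
  classical
  have := Fintype.ofFinite G.OrientedEdge
  refine ⟨Fintype.card G.OrientedEdge + 1, fun w => ?_⟩
  let F : Finset (List G.OrientedEdge) :=
    insert w.1.dropLast (Finset.univ.image fun d => w.1 ++ [d])
  have hsub : Subtype.val '' (G.universalCover v₀).neighborSet w ⊆ (F : Set _) := by
    rintro _ ⟨w', ⟨d, h | h⟩, rfl⟩
    · simp [F, h]
    · simp [F, h]
  have hfin := (F.finite_toSet.subset hsub)
  refine ⟨hfin.of_finite_image Subtype.val_injective.injOn, ?_⟩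
  rw [← Set.ncard_image_of_injective _ Subtype.val_injective]
  refine (Set.ncard_le_ncard hsub F.finite_toSet).trans ?_
  rw [Set.ncard_coe_finset]
  exact (Finset.card_insert_le _ _).trans (Nat.succ_le_succ Finset.card_image_le)

/-- `ρ(G)`: the spectral radius of the universal covering tree of `G`. -/
def coverSpectralRadius (G : Graph α β) [Finite V(G)] [Finite E(G)] (v₀ : V(G)) : ℝ :=
  (G.universalCover v₀).adjSpectralRadius (G.universalCover_hasBoundedDegree v₀)

/-- The covering defined by `σ` is one-sided Ramanujan: all its new eigenvalues
are at most `ρ(G)`. -/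
def IsOneSidedRamanujan (G : Graph α β) [Finite V(G)] [Finite E(G)] (v₀ : V(G)) {r : ℕ}
    (σ : G.PermLabeling r) : Prop :=
  ∀ μ ∈ G.newEigenvalues σ, μ ≤ G.coverSpectralRadius v₀

end Graph

end

/-! ### Sums of alternating forms over the symmetric group -/

section PermSums

open Finset Function Equiv

/-! Label the edges by independent uniform permutations of `r = d + 1` letters. The adjacency matrix
of a covering splits into that of `G`, acting on functions constant on fibres, and a new part of
size `d |V|`, acting on functions with sum zero on each fibre. The new eigenvalues are the roots of
the characteristic polynomial of the new part. Two facts suffice: the expectation of this polynomial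
is positive beyond `ρ(G)`, and this positivity passes from the expectation to some outcome.

Positivity. The label of one edge enters the determinant through the rows over its two ends, by
vectors that sum to zero over the `d + 1` letters. For such alternating expressions the average over
`S_{d+1}` reduces to permutations of `d` letters that match the chosen rows
(`sum_perm_eq_card_mul`), and random signs on `d` letters produce exactly the same reduction
(`average_alternating_fiber`). Hence the expected polynomial is an average over `d`-coverings of
sign-averaged characteristic polynomials, which are matching polynomials. The vertex-deletion
recursion of the latter (`signedDetSum_eq`) gives positivity at `x` as soon as there are positive
weights on the oriented edges with the inequalities of `signedDetSum_pos_and_le`. For `x > ρ(G)`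
such weights come from a positive superharmonic function on the universal covering tree, as infima
over all lifts of an oriented edge (`Graph.exists_edge_weights`); they pull back to every covering.

Choice of an outcome. The largest root of an average is not controlled by those of its terms in
general. But the uniform distribution on permutations is a product of independent coins, each
choosing between the identity and a transposition (`groupAverage_perm_succ`). For every product of
coins the averaged polynomial has no zeros in the upper half-plane (`expectedDet_ne_zero`), so it is
real-rooted. On a segment of monic real-rooted polynomials of equal degree, positivity beyond `ρ` at
one point forces it at an end point (`eval_pos_or_eval_pos_of_convex_combination`). Deciding the
coins one by one leaves a single labeling. -/

/-- `φ` is multilinear and alternating in the entries of `x` indexed by `J`, and does not depend on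
the other entries. -/
structure AlternatingOn {κ M : Type*} [DecidableEq κ] [AddCommGroup M] [Module ℝ M]
    (J : Finset κ) (φ : (κ → M) → ℝ) : Prop where
  congr : ∀ x y, (∀ j ∈ J, x j = y j) → φ x = φ y
  lin : ∀ x, ∀ j ∈ J, IsLinearMap ℝ fun z => φ (update x j z)
  alt : ∀ x, ∀ j ∈ J, ∀ j' ∈ J, j ≠ j' → x j = x j' → φ x = 0

variable {κ M M' : Type*} [DecidableEq κ] [AddCommGroup M] [Module ℝ M]
  [AddCommGroup M'] [Module ℝ M']

theorem AlternatingOn.map_swap {J : Finset κ} {φ : (κ → M) → ℝ} (h : AlternatingOn J φ)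
    (x : κ → M) {j j' : κ} (hj : j ∈ J) (hj' : j' ∈ J) (hne : j ≠ j') :
    φ (x ∘ swap j j') = - φ x := by
  have key : ∀ u v, φ (update (update x j u) j' v) + φ (update (update x j v) j' u) = 0 := by
    intro u v
    have e : ∀ u v w, φ (update (update x j (u + v)) j' w)
        = φ (update (update x j u) j' w) + φ (update (update x j v) j' w) := by
      intro u v w
      simp only [update_comm hne]
      exact (h.lin _ j hj).map_add u v
    have z : ∀ w, φ (update (update x j w) j' w) = 0 := by
      intro w
      refine h.alt _ j hj j' hj' hne ?_
      simp [hne]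
    have := z (u + v)
    rw [(h.lin _ j' hj').map_add, e, e, z, z] at this
    linarith
  have h1 : x ∘ swap j j' = update (update x j (x j')) j' (x j) := by
    funext i
    by_cases h1 : i = j'
    · subst h1; simp
    · by_cases h2 : i = j
      · subst h2; simp [h1]
      · simp [h1, h2, swap_apply_of_ne_of_ne]
  have h2 : x = update (update x j (x j)) j' (x j') := by simp
  have := key (x j) (x j')
  rw [← h1, ← h2] at this
  linarith

/-- The elements of `J` that `σ` does not send into `L`. -/
def unmatched (J L : Finset κ) (σ : Perm κ) : Finset κ := J.filter fun j => σ j ∉ L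

theorem mem_unmatched {J L : Finset κ} {σ : Perm κ} {j : κ} :
    j ∈ unmatched J L σ ↔ j ∈ J ∧ σ j ∉ L := by
  simp [unmatched]

theorem card_unmatched (J L : Finset κ) (σ : Perm κ) :
    (unmatched J L σ).card + L.card = (unmatched L J σ⁻¹).card + J.card := by
  have h1 := J.card_filter_add_card_filter_not (fun j => σ j ∉ L)
  have h2 := L.card_filter_add_card_filter_not (fun l => σ⁻¹ l ∉ J)
  have h3 : (J.filter fun j => ¬ σ j ∉ L).card = (L.filter fun l => ¬ σ⁻¹ l ∉ J).card := by
    refine Finset.card_bij' (fun j _ => σ j) (fun l _ => σ⁻¹ l) ?_ ?_ ?_ ?_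
    · intro j; simp; tauto
    · intro j; simp; tauto
    · intro j; simp
    · intro j; simp
  unfold unmatched
  omega

theorem unmatched_mul_swap {J L : Finset κ} {σ : Perm κ} {j j' : κ}
    (hj : j ∈ unmatched J L σ) (hj' : j' ∈ unmatched J L σ) :
    unmatched J L (σ * swap j j') = unmatched J L σ := by
  rw [mem_unmatched] at hj hj'
  ext i
  rw [mem_unmatched, mem_unmatched]
  rcases eq_or_ne i j with rfl | h1
  · simp [hj, hj']
  · rcases eq_or_ne i j' with rfl | h2
    · simp [hj, hj']
    · simp [swap_apply_of_ne_of_ne h1 h2]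

variable [Fintype κ]

/-- Exchanging two unmatched elements of `J` changes the sign of the form in its first variable. The
second variable is not affected, since the values of `σ⁻¹` on `L` avoid unmatched elements. So the
terms cancel in pairs. -/
theorem sum_perm_two_unmatched {J L : Finset κ} {φ : (κ → M) → (κ → M') → ℝ}
    (hJ : ∀ y, AlternatingOn J fun x => φ x y) (hL : ∀ x, AlternatingOn L (φ x))
    (a : κ → M) (b : κ → M') :
    ∑ σ : Perm κ with 1 < (unmatched J L σ).card, φ (a ∘ σ) (b ∘ ⇑σ⁻¹) = 0 := by
  -- The transposition is chosen from the unmatched set alone, and it preserves this set; so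
  -- multiplication by it is an involution.
  have hc : ∀ P : Finset κ, ∃ c : Perm κ, 1 < P.card →
      ∃ j ∈ P, ∃ j' ∈ P, j ≠ j' ∧ c = swap j j' := by
    intro P
    by_cases h : 1 < P.card
    · obtain ⟨u, hu, v, hv, huv⟩ := Finset.one_lt_card.1 h
      exact ⟨swap u v, fun _ => ⟨u, hu, v, hv, huv, rfl⟩⟩
    · exact ⟨1, fun h' => absurd h' h⟩
  choose c hc using hc
  have hm : ∀ σ, 1 < (unmatched J L σ).card →
      unmatched J L (σ * c (unmatched J L σ)) = unmatched J L σ := by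
    intro σ hσ
    obtain ⟨j, h1, j', h2, -, h4⟩ := hc _ hσ
    rw [h4, unmatched_mul_swap h1 h2]
  refine Finset.sum_involution (fun σ _ => σ * c (unmatched J L σ)) ?_ ?_ ?_ ?_
  · intro σ hσ
    obtain ⟨j, h1, j', h2, h3, h4⟩ := hc _ (Finset.mem_filter.1 hσ).2
    rw [mem_unmatched] at h1 h2
    simp only [h4]
    have e1 := (hJ (b ∘ ⇑σ⁻¹)).map_swap (a ∘ σ) h1.1 h2.1 h3
    have e2 : φ (a ∘ ⇑(σ * swap j j')) (b ∘ ⇑(σ * swap j j')⁻¹)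
        = φ (a ∘ σ ∘ swap j j') (b ∘ ⇑σ⁻¹) := by
      refine (hL _).congr _ _ fun l hl => ?_
      simp only [mul_inv_rev, swap_inv, Perm.coe_mul, comp_apply]
      rw [swap_apply_of_ne_of_ne]
      · rintro h; exact h1.2 (by rw [← h]; simpa using hl)
      · rintro h; exact h2.2 (by rw [← h]; simpa using hl)
    rw [e2]
    simp only [Function.comp_assoc] at e1
    linarith
  · intro σ hσ _ h
    obtain ⟨j, h1, j', h2, h3, h4⟩ := hc _ (Finset.mem_filter.1 hσ).2
    have := mul_eq_left.1 h
    rw [h4] at this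
    exact h3 (swap_eq_one_iff.1 this)
  · intro σ hσ
    simpa [hm σ (Finset.mem_filter.1 hσ).2] using hσ
  · intro σ hσ
    obtain ⟨j, h1, j', h2, h3, h4⟩ := hc _ (Finset.mem_filter.1 hσ).2
    simp only [hm σ (Finset.mem_filter.1 hσ).2]
    simp [h4, mul_assoc]

/-- The permutations whose unmatched elements are those of `P` and `Q`. -/
def matchClass (J L P Q : Finset κ) : Finset (Perm κ) :=
  univ.filter fun σ => unmatched J L σ = P ∧ unmatched L J σ⁻¹ = Q

theorem mem_matchClass {J L P Q : Finset κ} {σ : Perm κ} :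
    σ ∈ matchClass J L P Q ↔ unmatched J L σ = P ∧ unmatched L J σ⁻¹ = Q := by
  simp [matchClass]

theorem inv_mem_matchClass {J L P Q : Finset κ} {σ : Perm κ} :
    σ⁻¹ ∈ matchClass L J Q P ↔ σ ∈ matchClass J L P Q := by
  simp [mem_matchClass, and_comm]

theorem swap_mul_mem_matchClass {J L P Q : Finset κ} {σ : Perm κ}
    (h : σ ∈ matchClass J L P Q) {i i' : κ} (hi : i ∉ L) (hi' : i' ∉ L) :
    swap i i' * σ ∈ matchClass J L P Q := by
  rw [mem_matchClass] at h ⊢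
  rw [← h.1, ← h.2]
  have hL : ∀ l, swap i i' l ∈ L ↔ l ∈ L := by
    intro l
    rcases eq_or_ne l i with rfl | h1
    · simp [hi, hi']
    · rcases eq_or_ne l i' with rfl | h2
      · simp [hi, hi']
      · simp [swap_apply_of_ne_of_ne h1 h2]
  constructor
  · ext j
    simp [mem_unmatched, hL]
  · ext l
    simp only [mem_unmatched]
    refine and_congr_right fun hl => ?_
    have h1 : l ≠ i := by rintro rfl; exact hi hl
    have h2 : l ≠ i' := by rintro rfl; exact hi' hl
    simp [swap_apply_of_ne_of_ne h1 h2]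

/-- The value of `σ` at the only unmatched element `j₀` can be moved freely outside `L`, so the
argument there may be averaged over all of `Lᶜ`. As `a` sums to zero, this is minus a sum over `L`,
in which only the unmatched elements `Q` survive: the others repeat an argument. -/
theorem card_compl_mul_sum_matchClass {J L Q : Finset κ} {j₀ : κ}
    {N : Type*} {φ : (κ → M) → N → ℝ}
    (hJ : ∀ y, AlternatingOn J fun x => φ x y) {a : κ → M} (ha : ∑ i, a i = 0)
    (Y : Perm κ → N)
    (hY : ∀ σ, ∀ i ∉ L, ∀ i' ∉ L, ∀ x, φ x (Y (swap i i' * σ)) = φ x (Y σ)) :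
    (Lᶜ.card : ℝ) * ∑ σ ∈ matchClass J L {j₀} Q, φ (a ∘ σ) (Y σ)
      = - ∑ σ ∈ matchClass J L {j₀} Q, ∑ i ∈ Q, φ (update (a ∘ σ) j₀ (a i)) (Y σ) := by
  have hj₀ : ∀ σ ∈ matchClass J L {j₀} Q, j₀ ∈ J ∧ σ j₀ ∉ L := by
    intro σ hσ
    rw [← mem_unmatched (L := L), (mem_matchClass.1 hσ).1]
    simp
  have e1 : (Lᶜ.card : ℝ) * ∑ σ ∈ matchClass J L {j₀} Q, φ (a ∘ σ) (Y σ)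
      = ∑ p ∈ matchClass J L {j₀} Q ×ˢ Lᶜ, φ (a ∘ p.1) (Y p.1) := by
    rw [Finset.sum_product]
    simp [Finset.mul_sum]
  -- The involution exchanges the value `σ j₀` with the auxiliary point `i ∉ L`.
  have e2 : ∑ p ∈ matchClass J L {j₀} Q ×ˢ Lᶜ, φ (a ∘ p.1) (Y p.1)
      = ∑ p ∈ matchClass J L {j₀} Q ×ˢ Lᶜ, φ (update (a ∘ p.1) j₀ (a p.2)) (Y p.1) := by
    refine Finset.sum_bij' (fun p _ => (swap (p.1 j₀) p.2 * p.1, p.1 j₀))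
      (fun p _ => (swap (p.1 j₀) p.2 * p.1, p.1 j₀)) ?_ ?_ ?_ ?_ ?_
    · rintro ⟨σ, i⟩ h
      simp only [mem_product, mem_compl] at h ⊢
      exact ⟨swap_mul_mem_matchClass h.1 (hj₀ _ h.1).2 h.2, (hj₀ _ h.1).2⟩
    · rintro ⟨σ, i⟩ h
      simp only [mem_product, mem_compl] at h ⊢
      exact ⟨swap_mul_mem_matchClass h.1 (hj₀ _ h.1).2 h.2, (hj₀ _ h.1).2⟩
    · rintro ⟨σ, i⟩ h
      ext1 <;> simp [swap_comm i]
    · rintro ⟨σ, i⟩ h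
      ext1 <;> simp [swap_comm i]
    · rintro ⟨σ, i⟩ h
      simp only [mem_product, mem_compl] at h
      have hσ := hj₀ σ h.1
      simp only
      rw [hY σ _ hσ.2 _ h.2]
      refine (hJ _).congr _ _ fun j hj => ?_
      rcases eq_or_ne j j₀ with rfl | hne
      · simp
      · have hm : j ∉ unmatched J L σ := by
          rw [(mem_matchClass.1 h.1).1]; simpa using hne
        have hm' : σ j ∈ L := by
          by_contra hc; exact hm (mem_unmatched.2 ⟨hj, hc⟩)
        have h1 : σ j ≠ σ j₀ := by simpa using hne
        have h2 : σ j ≠ i := by rintro rfl; exact h.2 hm'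
        simp [hne, swap_apply_of_ne_of_ne h1 h2]
  rw [e1, e2, Finset.sum_product, ← Finset.sum_neg_distrib]
  refine Finset.sum_congr rfl fun σ hσ => ?_
  have hl := (hJ (Y σ)).lin (a ∘ σ) j₀ (hj₀ σ hσ).1
  let ℓ := hl.mk'
  have hℓ : ∀ z, φ (update (a ∘ σ) j₀ z) (Y σ) = ℓ z := fun z => rfl
  have hQ : Q ⊆ L := by
    rw [← (mem_matchClass.1 hσ).2]; exact Finset.filter_subset _ _
  -- For `i ∈ L \ Q` the vector `a i` already occurs at the index `σ⁻¹ i ∈ J`.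
  have h0 : ∑ i ∈ L, ℓ (a i) = ∑ i ∈ Q, ℓ (a i) := by
    refine (Finset.sum_subset hQ fun i hi hiQ => ?_).symm
    rw [← hℓ]
    have hJi : σ⁻¹ i ∈ J := by
      by_contra hc
      apply hiQ
      rw [← (mem_matchClass.1 hσ).2]
      exact mem_unmatched.2 ⟨hi, hc⟩
    have hne : j₀ ≠ σ⁻¹ i := by
      rintro rfl
      apply (hj₀ σ hσ).2
      simpa using hi
    refine (hJ _).alt _ j₀ (hj₀ σ hσ).1 _ hJi hne ?_
    rw [update_self, update_of_ne hne.symm]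
    simp
  have h1 : ∑ i ∈ L, ℓ (a i) + ∑ i ∈ Lᶜ, ℓ (a i) = 0 := by
    rw [Finset.sum_add_sum_compl, ← map_sum, ha, map_zero]
  simp only [hℓ]
  linarith

/-- This is `card_compl_mul_sum_matchClass` applied first to `a` and then, with `σ⁻¹` for `σ`, to
`b`. The two signs cancel. -/
theorem card_compl_mul_sum_matchClass_singleton {J L : Finset κ}
    {φ : (κ → M) → (κ → M') → ℝ}
    (hJ : ∀ y, AlternatingOn J fun x => φ x y) (hL : ∀ x, AlternatingOn L (φ x))
    {a : κ → M} {b : κ → M'} (ha : ∑ i, a i = 0) (hb : ∑ i, b i = 0) (j₀ l₀ : κ) :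
    (Jᶜ.card : ℝ) * ((Lᶜ.card : ℝ) * ∑ σ ∈ matchClass J L {j₀} {l₀}, φ (a ∘ σ) (b ∘ ⇑σ⁻¹))
      = ∑ σ ∈ matchClass J L {j₀} {l₀},
          φ (update (a ∘ σ) j₀ (a l₀)) (update (b ∘ ⇑σ⁻¹) l₀ (b j₀)) := by
  have h1 := card_compl_mul_sum_matchClass (L := L) (Q := {l₀}) (j₀ := j₀) hJ ha
    (fun σ => b ∘ ⇑σ⁻¹) (by
      intro σ i hi i' hi' x
      refine (hL _).congr _ _ fun l hl => ?_
      have h1 : l ≠ i := by rintro rfl; exact hi hl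
      have h2 : l ≠ i' := by rintro rfl; exact hi' hl
      simp [swap_apply_of_ne_of_ne h1 h2])
  have h2 := card_compl_mul_sum_matchClass (J := L) (L := J) (Q := {j₀}) (j₀ := l₀)
    (φ := fun y x => φ x y) hL hb
    (fun σ => update (a ∘ ⇑σ⁻¹) j₀ (a l₀)) (by
      intro σ i hi i' hi' x
      refine (hJ _).congr _ _ fun l hl => ?_
      have h1 : l ≠ i := by rintro rfl; exact hi hl
      have h2 : l ≠ i' := by rintro rfl; exact hi' hl
      rcases eq_or_ne l j₀ with rfl | h3
      · simp
      · simp [h3, swap_apply_of_ne_of_ne h1 h2])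
  have hinv : ∀ f : Perm κ → ℝ, ∑ σ ∈ matchClass L J {l₀} {j₀}, f σ
      = ∑ σ ∈ matchClass J L {j₀} {l₀}, f σ⁻¹ := by
    intro f
    refine Finset.sum_bij' (fun σ _ => σ⁻¹) (fun σ _ => σ⁻¹) ?_ ?_ ?_ ?_ ?_ <;>
      simp [inv_mem_matchClass]
  rw [hinv, hinv] at h2
  simp only [Finset.sum_singleton, inv_inv] at h1 h2
  rw [h1, mul_neg, h2, neg_neg]

/-- After both exchanges the arguments look as if `σ` sent `j₀` to `l₀`. Redirecting `σ` accordingly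
gives a perfect matching of `J` with `L`, and the only information lost is the point `σ⁻¹ l₀ ∈ Jᶜ`;
this accounts for the factor `Jᶜ.card`, which cancels. -/
theorem sum_matchClass_singleton {J L : Finset κ}
    {φ : (κ → M) → (κ → M') → ℝ}
    (hJ : ∀ y, AlternatingOn J fun x => φ x y) (hL : ∀ x, AlternatingOn L (φ x))
    {a : κ → M} {b : κ → M'} (ha : ∑ i, a i = 0) (hb : ∑ i, b i = 0)
    {j₀ l₀ : κ} (hj₀ : j₀ ∈ J) (hl₀ : l₀ ∈ L) (hne : Jᶜ.Nonempty) :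
    (Lᶜ.card : ℝ) * ∑ σ ∈ matchClass J L {j₀} {l₀}, φ (a ∘ σ) (b ∘ ⇑σ⁻¹)
      = ∑ σ ∈ matchClass J L ∅ ∅ with σ j₀ = l₀, φ (a ∘ σ) (b ∘ ⇑σ⁻¹) := by
  have hpos : (Jᶜ.card : ℝ) ≠ 0 := by
    exact_mod_cast hne.card_pos.ne'
  apply mul_left_cancel₀ hpos
  rw [card_compl_mul_sum_matchClass_singleton hJ hL ha hb]
  have e : (Jᶜ.card : ℝ) * ∑ σ ∈ matchClass J L ∅ ∅ with σ j₀ = l₀, φ (a ∘ σ) (b ∘ ⇑σ⁻¹)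
      = ∑ p ∈ (matchClass J L ∅ ∅).filter (fun σ => σ j₀ = l₀) ×ˢ Jᶜ,
          φ (a ∘ p.1) (b ∘ ⇑(p.1)⁻¹) := by
    rw [Finset.sum_product]
    simp [Finset.mul_sum]
  rw [e]
  have hu : ∀ {J L : Finset κ} {P : Finset κ} {σ : Perm κ}, unmatched J L σ = P →
      ∀ j, j ∈ P ↔ j ∈ J ∧ σ j ∉ L := by
    rintro J L _ σ rfl j; exact mem_unmatched
  have key : ∀ σ : Perm κ, ∀ c, c ∉ J →
      (σ ∈ matchClass J L {j₀} {l₀} ∧ σ c = l₀ ↔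
        σ * swap j₀ c ∈ matchClass J L ∅ ∅ ∧ (σ * swap j₀ c) j₀ = l₀) := by
    intro σ c hc
    have hcj : c ≠ j₀ := by rintro rfl; exact hc hj₀
    simp only [mem_matchClass, Finset.ext_iff, mem_unmatched, Finset.mem_singleton,
      Finset.notMem_empty, iff_false, Perm.coe_mul, comp_apply, swap_apply_left, mul_inv_rev,
      swap_inv, not_and, not_not]
    constructor
    · rintro ⟨⟨h1, h2⟩, h3⟩
      refine ⟨⟨fun j hj => ?_, fun l hl => ?_⟩, h3⟩
      · rcases eq_or_ne j j₀ with rfl | h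
        · rw [swap_apply_left, h3]; exact hl₀
        · rw [swap_apply_of_ne_of_ne h (by rintro rfl; exact hc hj)]
          by_contra hcon
          exact h ((h1 j).1 ⟨hj, hcon⟩)
      · rcases eq_or_ne l l₀ with rfl | h
        · rw [← h3]; simpa using hj₀
        · have h4 : σ⁻¹ l ∈ J := by
            by_contra hcon
            exact h ((h2 l).1 ⟨hl, hcon⟩)
          rw [swap_apply_of_ne_of_ne]
          · exact h4
          · intro h5
            have := ((h1 j₀).2 rfl).2
            rw [← h5] at this
            simp at this
            exact this hl
          · rintro h5; exact hc (h5 ▸ h4)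
    · rintro ⟨⟨h1, h2⟩, h3⟩
      refine ⟨⟨fun j => ⟨fun ⟨h4, h5⟩ => ?_, ?_⟩, fun l => ⟨fun ⟨h4, h5⟩ => ?_, ?_⟩⟩, h3⟩
      · by_contra h
        have := h1 j h4
        rw [swap_apply_of_ne_of_ne h (by rintro rfl; exact hc h4)] at this
        exact h5 this
      · rintro rfl
        refine ⟨hj₀, fun h => ?_⟩
        have := h2 _ h
        simp at this
        exact hc this
      · by_contra h
        have h6 := h2 l h4
        have h7 : σ⁻¹ l ≠ c := by rintro rfl; simp at h3; exact h h3
        rcases eq_or_ne (σ⁻¹ l) j₀ with h8 | h8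
        · rw [h8, swap_apply_left] at h6; exact hc h6
        · rw [swap_apply_of_ne_of_ne h8 h7] at h6; exact h5 h6
      · rintro rfl
        refine ⟨hl₀, ?_⟩
        rw [← h3]; simpa using hc
  refine Finset.sum_bij' (fun σ _ => (σ * swap j₀ (σ⁻¹ l₀), σ⁻¹ l₀))
    (fun p _ => p.1 * swap j₀ p.2) ?_ ?_ ?_ ?_ ?_
  · intro σ hσ
    have hc : σ⁻¹ l₀ ∉ J := ((hu (mem_matchClass.1 hσ).2 l₀).1 (by simp)).2
    have := (key σ _ hc).1 ⟨hσ, by simp⟩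
    simp only [mem_product, mem_compl, mem_filter]
    exact ⟨this, hc⟩
  · rintro ⟨σ, c⟩ h
    simp only [mem_product, mem_compl, mem_filter] at h
    refine ((key _ c h.2).2 ?_).1
    simpa [mul_assoc] using h.1
  · intro σ hσ
    simp [mul_assoc]
  · rintro ⟨σ, c⟩ h
    simp only [mem_product, mem_compl, mem_filter] at h
    have : σ⁻¹ l₀ = j₀ := by rw [← h.1.2]; simp
    have h2 : (σ * swap j₀ c)⁻¹ l₀ = c := by
      rw [mul_inv_rev, swap_inv, Perm.mul_apply, this, swap_apply_left]
    simp only [h2]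
    simp [mul_assoc]
  · intro σ hσ
    have hc : σ⁻¹ l₀ ∉ J := ((hu (mem_matchClass.1 hσ).2 l₀).1 (by simp)).2
    have hd : σ j₀ ∉ L := ((hu (mem_matchClass.1 hσ).1 j₀).1 (by simp)).2
    trans φ (update (a ∘ σ) j₀ (a l₀)) (b ∘ ⇑(σ * swap j₀ (σ⁻¹ l₀))⁻¹)
    · refine (hL _).congr _ _ fun l hl => ?_
      rcases eq_or_ne l l₀ with rfl | h
      · simp
      · have h1 : σ⁻¹ l ≠ j₀ := by rintro rfl; simp at hd; exact hd hl
        have h2 : σ⁻¹ l ≠ σ⁻¹ l₀ := by simpa using h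
        rw [update_of_ne h]
        simp only [mul_inv_rev, swap_inv, Perm.coe_mul, comp_apply]
        rw [swap_apply_of_ne_of_ne h1 h2]
    · refine (hJ _).congr _ _ fun j hj => ?_
      rcases eq_or_ne j j₀ with rfl | h
      · simp
      · rw [update_of_ne h]
        simp only [Perm.coe_mul, comp_apply]
        rw [swap_apply_of_ne_of_ne h]
        rintro rfl; exact hc hj

/-- For a permutation that maps `J` onto `L`, the term depends only on its restriction to `J`.
Composing with a transposition inside `Jᶜ` makes `z` fixed, and the former preimage of `z` is an
arbitrary element of `Jᶜ`. -/
theorem sum_matched_eq_card_mul {J L : Finset κ} {φ : (κ → M) → (κ → M') → ℝ}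
    (hJ : ∀ y, AlternatingOn J fun x => φ x y) (hL : ∀ x, AlternatingOn L (φ x))
    {a : κ → M} {b : κ → M'} {z : κ} (hzJ : z ∉ J) (hzL : z ∉ L) :
    ∑ σ ∈ matchClass J L ∅ ∅, φ (a ∘ σ) (b ∘ ⇑σ⁻¹)
      = Jᶜ.card * ∑ σ ∈ matchClass J L ∅ ∅ with σ z = z, φ (a ∘ σ) (b ∘ ⇑σ⁻¹) := by
  have e : (Jᶜ.card : ℝ) * ∑ σ ∈ matchClass J L ∅ ∅ with σ z = z, φ (a ∘ σ) (b ∘ ⇑σ⁻¹)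
      = ∑ p ∈ (matchClass J L ∅ ∅).filter (fun σ => σ z = z) ×ˢ Jᶜ,
          φ (a ∘ p.1) (b ∘ ⇑(p.1)⁻¹) := by
    rw [Finset.sum_product]
    simp [Finset.mul_sum]
  rw [e]
  have hmem : ∀ σ : Perm κ, σ ∈ matchClass J L ∅ ∅ ↔ ∀ j, j ∈ J ↔ σ j ∈ L := by
    intro σ
    simp only [mem_matchClass, Finset.ext_iff, mem_unmatched, Finset.notMem_empty, iff_false,
      not_and, not_not]
    constructor
    · rintro ⟨h1, h2⟩ j
      refine ⟨h1 j, fun h => ?_⟩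
      simpa using h2 _ h
    · intro h
      refine ⟨fun j hj => (h j).1 hj, fun l hl => (h _).2 ?_⟩
      simpa using hl
  have hsw : ∀ {σ : Perm κ} {c : κ}, σ ∈ matchClass J L ∅ ∅ → c ∉ J →
      σ * swap c z ∈ matchClass J L ∅ ∅ ∧
      φ (a ∘ ⇑(σ * swap c z)) (b ∘ ⇑(σ * swap c z)⁻¹) = φ (a ∘ σ) (b ∘ ⇑σ⁻¹) := by
    intro σ c hσ hc
    have h0 : ∀ j ∈ J, swap c z j = j := by
      intro j hj
      exact swap_apply_of_ne_of_ne (by rintro rfl; exact hc hj) (by rintro rfl; exact hzJ hj)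
    have h1 : ∀ j ∉ J, swap c z j ∉ J := by
      intro j hj hcon
      have := h0 _ hcon
      rw [swap_apply_self] at this
      rw [← this] at hcon
      exact hj hcon
    rw [hmem] at hσ
    refine ⟨(hmem _).2 fun j => ?_, ?_⟩
    · rw [Perm.mul_apply, ← hσ]
      by_cases hj : j ∈ J
      · rw [h0 j hj]
      · simp [hj, h1 j hj]
    · trans φ (a ∘ σ) (b ∘ ⇑(σ * swap c z)⁻¹)
      · exact (hJ _).congr _ _ fun j hj => by simp [h0 j hj]
      · refine (hL _).congr _ _ fun l hl => ?_
        have : σ⁻¹ l ∈ J := (hσ _).2 (by simpa using hl)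
        simp only [mul_inv_rev, swap_inv, Perm.coe_mul, comp_apply, h0 _ this]
  have hz : ∀ {σ : Perm κ}, σ ∈ matchClass J L ∅ ∅ → σ⁻¹ z ∉ J := by
    intro σ hσ
    rw [hmem] at hσ
    rw [hσ]
    simpa using hzL
  refine Finset.sum_bij' (fun σ _ => (σ * swap (σ⁻¹ z) z, σ⁻¹ z))
    (fun p _ => p.1 * swap p.2 z) ?_ ?_ ?_ ?_ ?_
  · intro σ hσ
    simp only [mem_product, mem_compl, mem_filter]
    refine ⟨⟨(hsw hσ (hz hσ)).1, by simp⟩, hz hσ⟩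
  · rintro ⟨σ, c⟩ h
    simp only [mem_product, mem_compl, mem_filter] at h
    exact (hsw h.1.1 h.2).1
  · intro σ hσ
    simp [mul_assoc]
  · rintro ⟨σ, c⟩ h
    simp only [mem_product, mem_compl, mem_filter] at h
    have : σ⁻¹ z = z := by rw [Perm.inv_eq_iff_eq]; exact h.1.2.symm
    have h2 : (σ * swap c z)⁻¹ z = c := by
      rw [mul_inv_rev, swap_inv, Perm.mul_apply, this, swap_apply_right]
    simp only [h2]
    simp [mul_assoc]
  · intro σ hσ
    exact (hsw hσ (hz hσ)).2.symm

/-- At most one unmatched element of `J` matters. If `L` is smaller than `J`, exactly one is left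
and none in `L`, so the exchange of `card_compl_mul_sum_matchClass` yields an empty sum. If the
sizes agree, there are the perfect matchings and the classes with one unmatched element on each
side, and the latter are multiples of parts of the former. -/
theorem sum_perm_eq_card_mul_of_card_le {J L : Finset κ} (hle : L.card ≤ J.card)
    {φ : (κ → M) → (κ → M') → ℝ}
    (hJ : ∀ y, AlternatingOn J fun x => φ x y) (hL : ∀ x, AlternatingOn L (φ x))
    {a : κ → M} {b : κ → M'} (ha : ∑ i, a i = 0) (hb : ∑ i, b i = 0)
    {z : κ} (hzJ : z ∉ J) (hzL : z ∉ L) :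
    ∑ σ : Perm κ, φ (a ∘ σ) (b ∘ ⇑σ⁻¹)
      = Fintype.card κ * ∑ σ ∈ matchClass J L ∅ ∅ with σ z = z, φ (a ∘ σ) (b ∘ ⇑σ⁻¹) := by
  have hposL : (0 : ℝ) < Lᶜ.card := by
    exact_mod_cast Finset.card_pos.2 ⟨z, by simpa using hzL⟩
  rw [← Finset.sum_filter_add_sum_filter_not univ (fun σ => 1 < (unmatched J L σ).card),
    sum_perm_two_unmatched hJ hL, zero_add]
  rcases hle.lt_or_eq with hlt | heq
  · have hempty : matchClass J L ∅ ∅ = ∅ := by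
      ext σ
      simp only [mem_matchClass, Finset.notMem_empty, iff_false]
      rintro ⟨h1, h2⟩
      have := card_unmatched J L σ
      rw [h1, h2] at this
      simp at this
      omega
    rw [hempty]
    simp only [Finset.filter_empty, Finset.sum_empty, mul_zero]
    have hcov : (univ.filter fun σ : Perm κ => ¬ 1 < (unmatched J L σ).card)
        = J.biUnion fun j => matchClass J L {j} ∅ ∩
          (univ.filter fun σ : Perm κ => ¬ 1 < (unmatched J L σ).card) := by
      ext σ
      simp only [mem_filter, mem_univ, true_and, mem_biUnion, mem_inter, mem_matchClass]
      constructor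
      · intro h
        have hc := card_unmatched J L σ
        have h1 : (unmatched J L σ).card = 1 := by omega
        have h2 : (unmatched L J σ⁻¹).card = 0 := by omega
        obtain ⟨j, hj⟩ := Finset.card_eq_one.1 h1
        have hj' : j ∈ unmatched J L σ := by simp [hj]
        exact ⟨j, (mem_unmatched.1 hj').1, ⟨hj, Finset.card_eq_zero.1 h2⟩, h⟩
      · rintro ⟨j, -, -, h⟩; exact h
    have hin : ∀ j, matchClass J L {j} ∅ ∩
          (univ.filter fun σ : Perm κ => ¬ 1 < (unmatched J L σ).card)
          = matchClass J L {j} ∅ := by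
      intro j
      refine Finset.inter_eq_left.2 fun σ hσ => ?_
      simp [(mem_matchClass.1 hσ).1]
    rw [hcov, Finset.sum_biUnion]
    · refine Finset.sum_eq_zero fun j _ => ?_
      rw [hin]
      have := card_compl_mul_sum_matchClass (L := L) (Q := ∅) (j₀ := j) hJ ha
        (fun σ => b ∘ ⇑σ⁻¹) (by
          intro σ i hi i' hi' x
          refine (hL _).congr _ _ fun l hl => ?_
          have h1 : l ≠ i := by rintro rfl; exact hi hl
          have h2 : l ≠ i' := by rintro rfl; exact hi' hl
          simp [swap_apply_of_ne_of_ne h1 h2])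
      simp only [Finset.sum_empty, Finset.sum_const_zero, neg_zero] at this
      exact (mul_eq_zero.1 this).resolve_left hposL.ne'
    · intro i _ j _ hij
      simp only [hin]
      refine Finset.disjoint_left.2 fun σ h1 h2 => hij ?_
      have := (mem_matchClass.1 h1).1.symm.trans (mem_matchClass.1 h2).1
      simpa using this
  · have hcc : (Lᶜ.card : ℝ) = Jᶜ.card := by
      rw [Finset.card_compl, Finset.card_compl, heq]
    have hsplit : ∑ σ : Perm κ with ¬ 1 < (unmatched J L σ).card, φ (a ∘ σ) (b ∘ ⇑σ⁻¹)
        = ∑ σ ∈ matchClass J L ∅ ∅, φ (a ∘ σ) (b ∘ ⇑σ⁻¹)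
          + ∑ j ∈ J, ∑ l ∈ L, ∑ σ ∈ matchClass J L {j} {l}, φ (a ∘ σ) (b ∘ ⇑σ⁻¹) := by
      simp only [matchClass, Finset.sum_filter]
      rw [Finset.sum_congr rfl fun j _ => Finset.sum_comm, Finset.sum_comm,
        ← Finset.sum_add_distrib]
      refine Finset.sum_congr rfl fun σ _ => ?_
      have hc := card_unmatched J L σ
      rw [heq] at hc
      by_cases h0 : (unmatched J L σ).card = 0
      · have h0' : (unmatched L J σ⁻¹).card = 0 := by omega
        rw [Finset.card_eq_zero] at h0 h0'
        simp [h0, h0', eq_comm (a := (∅ : Finset κ))]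
      · by_cases h1 : (unmatched J L σ).card = 1
        · have h1' : (unmatched L J σ⁻¹).card = 1 := by omega
          obtain ⟨j, hj⟩ := Finset.card_eq_one.1 h1
          obtain ⟨l, hl⟩ := Finset.card_eq_one.1 h1'
          have hj' : j ∈ J := (mem_unmatched.1 (hj ▸ Finset.mem_singleton_self j)).1
          have hl' : l ∈ L := (mem_unmatched.1 (hl ▸ Finset.mem_singleton_self l)).1
          simp [hj, hl, hj', hl', ite_and]
        · have h2 : 1 < (unmatched J L σ).card := by omega
          have h3 : unmatched J L σ ≠ ∅ := by rintro h; simp [h] at h0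
          have h4 : ∀ j, unmatched J L σ ≠ {j} := by rintro j h; simp [h] at h1
          simp [h2, h3, h4]
    rw [hsplit]
    have hcls : ∀ j ∈ J, ∀ l ∈ L, ∑ σ ∈ matchClass J L {j} {l}, φ (a ∘ σ) (b ∘ ⇑σ⁻¹)
        = (Lᶜ.card : ℝ)⁻¹ * ∑ σ ∈ matchClass J L ∅ ∅ with σ j = l, φ (a ∘ σ) (b ∘ ⇑σ⁻¹) := by
      intro j hj l hl
      rw [← sum_matchClass_singleton hJ hL ha hb hj hl ⟨z, by simpa using hzJ⟩,
        inv_mul_cancel_left₀ hposL.ne']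
    rw [Finset.sum_congr rfl fun j hj => Finset.sum_congr rfl fun l hl => hcls j hj l hl]
    have hfib : ∀ j ∈ J, ∑ l ∈ L,
        ∑ σ ∈ matchClass J L ∅ ∅ with σ j = l, φ (a ∘ σ) (b ∘ ⇑σ⁻¹)
        = ∑ σ ∈ matchClass J L ∅ ∅, φ (a ∘ σ) (b ∘ ⇑σ⁻¹) := by
      intro j hj
      refine Finset.sum_fiberwise_of_maps_to (fun σ hσ => ?_) _
      by_contra hcon
      have : j ∈ unmatched J L σ := mem_unmatched.2 ⟨hj, hcon⟩
      rw [(mem_matchClass.1 hσ).1] at this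
      simp at this
    simp only [← Finset.mul_sum]
    rw [Finset.sum_congr rfl hfib, Finset.sum_const, nsmul_eq_mul,
      sum_matched_eq_card_mul hJ hL hzJ hzL, ← hcc]
    -- If `S` is the sum over the perfect matchings, the total is `S (1 + |J| / |Jᶜ|) = S |κ| /
    -- |Jᶜ|`, and `S` is `|Jᶜ|` times the part with `z` fixed.
    have hk : (J.card : ℝ) = Fintype.card κ - Lᶜ.card := by
      rw [hcc, Finset.card_compl, Nat.cast_sub (Finset.card_le_univ _)]; ring
    rw [hk]
    field_simp
    ring

/-- If `a` and `b` sum to zero, then the sum of an alternating form over all permutations reduces to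
the permutations that fix `z` and map `J` onto `L`. -/
theorem sum_perm_eq_card_mul {J L : Finset κ} {φ : (κ → M) → (κ → M') → ℝ}
    (hJ : ∀ y, AlternatingOn J fun x => φ x y) (hL : ∀ x, AlternatingOn L (φ x))
    {a : κ → M} {b : κ → M'} (ha : ∑ i, a i = 0) (hb : ∑ i, b i = 0)
    {z : κ} (hzJ : z ∉ J) (hzL : z ∉ L) :
    ∑ σ : Perm κ, φ (a ∘ σ) (b ∘ ⇑σ⁻¹)
      = Fintype.card κ * ∑ σ : Perm κ with σ z = z ∧ ∀ j, j ∈ J ↔ σ j ∈ L,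
          φ (a ∘ σ) (b ∘ ⇑σ⁻¹) := by
  have hmem : ∀ {J L : Finset κ} (σ : Perm κ),
      σ ∈ matchClass J L ∅ ∅ ↔ ∀ j, j ∈ J ↔ σ j ∈ L := by
    intro J L σ
    simp only [mem_matchClass, Finset.ext_iff, mem_unmatched, Finset.notMem_empty, iff_false,
      not_and, not_not]
    constructor
    · rintro ⟨h1, h2⟩ j
      refine ⟨h1 j, fun h => ?_⟩
      simpa using h2 _ h
    · intro h
      refine ⟨fun j hj => (h j).1 hj, fun l hl => (h _).2 ?_⟩
      simpa using hl
  rcases le_total L.card J.card with hle | hle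
  · rw [sum_perm_eq_card_mul_of_card_le hle hJ hL ha hb hzJ hzL]
    congr 2
    ext σ
    simp [hmem, and_comm]
  · have := sum_perm_eq_card_mul_of_card_le (φ := fun y x => φ x y) hle hL hJ hb ha hzL hzJ
    rw [← Equiv.sum_comp (Equiv.inv (Perm κ))]
    simp only [Equiv.inv_apply, inv_inv]
    rw [this]
    congr 1
    refine Finset.sum_bij' (fun σ _ => σ⁻¹) (fun σ _ => σ⁻¹) ?_ ?_ ?_ ?_ ?_
    · intro σ
      simp only [mem_filter, mem_univ, true_and, hmem]
      rintro ⟨h1, h2⟩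
      refine ⟨by rw [Perm.inv_eq_iff_eq]; exact h2.symm, fun j => ?_⟩
      rw [h1]; simp
    · intro σ
      simp only [mem_filter, mem_univ, true_and, hmem]
      rintro ⟨h1, h2⟩
      refine ⟨fun j => ?_, by rw [Perm.inv_eq_iff_eq]; exact h1.symm⟩
      rw [h2]; simp
    · simp
    · simp
    · simp

end PermSums

/-! ### From uniform permutations to signed permutations, one edge at a time -/

section AverageDet

open Finset Function Equiv

theorem sum_sum_update {ι X A : Type*} [Fintype ι] [DecidableEq ι] [Fintype X] [AddCommMonoid A]
    (e : ι) (Φ : (ι → X) → A) :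
    ∑ x : ι → X, ∑ t : X, Φ (update x e t) = Fintype.card X • ∑ x : ι → X, Φ x := by
  have h : ∀ Ψ : (ι → X) → A, ∑ x : ι → X, Ψ x
      = ∑ r : {j // j ≠ e} → X, ∑ t : X, Ψ ((Equiv.funSplitAt e X).symm (t, r)) := by
    intro Ψ
    rw [← Equiv.sum_comp (Equiv.funSplitAt e X).symm, Fintype.sum_prod_type_right]
  have hu : ∀ (r : {j // j ≠ e} → X) (t t' : X),
      update ((Equiv.funSplitAt e X).symm (t, r)) e t' = (Equiv.funSplitAt e X).symm (t', r) := by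
    intro r t t'
    funext j
    rcases eq_or_ne j e with rfl | hj
    · simp
    · simp [hj]
  rw [h, h Φ, Finset.smul_sum]
  refine Finset.sum_congr rfl fun r _ => ?_
  simp only [hu, Finset.sum_const, Finset.card_univ]

/-- Averages over families of independent variables can be exchanged one variable at a time. -/
theorem average_pi_eq {ι X Y C : Type*} [Fintype ι] [DecidableEq ι] [Fintype X] [Fintype Y]
    [Nonempty X] [Nonempty Y] (α : X → C) (β : Y → C) (F : (ι → C) → ℝ)
    (h : ∀ e c, (Fintype.card X : ℝ)⁻¹ * ∑ x, F (update c e (α x))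
      = (Fintype.card Y : ℝ)⁻¹ * ∑ y, F (update c e (β y))) :
    (Fintype.card (ι → X) : ℝ)⁻¹ * ∑ x : ι → X, F (α ∘ x)
      = (Fintype.card (ι → Y) : ℝ)⁻¹ * ∑ y : ι → Y, F (β ∘ y) := by
  have hX : (Fintype.card X : ℝ) ≠ 0 := by exact_mod_cast Fintype.card_ne_zero
  have hY : (Fintype.card Y : ℝ) ≠ 0 := by exact_mod_cast Fintype.card_ne_zero
  -- Hybrid families: the variables in `s` have already been exchanged, the others not yet.
  let c : Finset ι → (ι → X) → (ι → Y) → ι → C :=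
    fun s x y e => if e ∈ s then β (y e) else α (x e)
  have key : ∀ s : Finset ι, ∑ x, ∑ y, F (c s x y) = ∑ x, ∑ y, F (c ∅ x y) := by
    intro s
    induction s using Finset.induction_on with
    | empty => rfl
    | insert e s he ih =>
      rw [← ih]
      have h1 : ∀ x y t, c s (update x e t) y = update (c s x y) e (α t) := by
        intro x y t
        funext j
        rcases eq_or_ne j e with rfl | hj
        · simp [c, he]
        · simp [c, hj]
      have h2 : ∀ x y t, c (insert e s) x (update y e t) = update (c s x y) e (β t) := by
        intro x y t
        funext j
        rcases eq_or_ne j e with rfl | hj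
        · simp [c]
        · simp [c, hj]
      have e1 : ∑ x, ∑ y, F (c s x y)
          = ∑ x, ∑ y, (Fintype.card X : ℝ)⁻¹ * ∑ t, F (update (c s x y) e (α t)) := by
        rw [Finset.sum_comm, Finset.sum_comm (s := (univ : Finset (ι → X)))]
        refine Finset.sum_congr rfl fun y _ => ?_
        rw [← Finset.mul_sum, eq_inv_mul_iff_mul_eq₀ hX, ← nsmul_eq_mul, ← sum_sum_update e]
        simp only [h1]
      have e2 : ∑ x, ∑ y, F (c (insert e s) x y)
          = ∑ x, ∑ y, (Fintype.card Y : ℝ)⁻¹ * ∑ t, F (update (c s x y) e (β t)) := by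
        refine Finset.sum_congr rfl fun x _ => ?_
        rw [← Finset.mul_sum, eq_inv_mul_iff_mul_eq₀ hY, ← nsmul_eq_mul, ← sum_sum_update e]
        simp only [h2]
      rw [e1, e2]
      simp only [h]
  have hu := key univ
  have hl : ∀ x y, c ∅ x y = α ∘ x := by intro x y; funext j; simp [c]
  have hr : ∀ x y, c univ x y = β ∘ y := by intro x y; funext j; simp [c]
  simp only [hl, hr, Finset.sum_const, Finset.card_univ, nsmul_eq_mul, ← Finset.mul_sum] at hu
  have hX' : (Fintype.card (ι → X) : ℝ) ≠ 0 := by exact_mod_cast Fintype.card_ne_zero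
  have hY' : (Fintype.card (ι → Y) : ℝ) ≠ 0 := by exact_mod_cast Fintype.card_ne_zero
  field_simp
  linarith

variable {V : Type*} [DecidableEq V] {d : ℕ}

/-- The rows of `N` with those of the fibre of `u` indexed by `J` replaced by the entries of `x`. -/
def replaceFiber {R : Type*} (u : V) (J : Finset (Fin d)) (x : Fin d → R) (N : V × Fin d → R) :
    V × Fin d → R :=
  fun p => if p.1 = u ∧ p.2 ∈ J then x p.2 else N p

theorem replaceFiber_comm {R : Type*} {u v : V} (huv : u ≠ v) (J L : Finset (Fin d))
    (x y : Fin d → R) (N : V × Fin d → R) :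
    replaceFiber u J x (replaceFiber v L y N) = replaceFiber v L y (replaceFiber u J x N) := by
  funext p
  unfold replaceFiber
  by_cases h : p.1 = u
  · have : p.1 ≠ v := by rw [h]; exact huv
    simp [this]
  · simp [h]

theorem multilinear_add_fiber {R : Type*} [AddCommGroup R] [Module ℝ R]
    (f : MultilinearMap ℝ (fun _ : V × Fin d => R) ℝ) (u : V) (x : Fin d → R)
    (N : V × Fin d → R) :
    f (fun p => N p + if p.1 = u then x p.2 else 0)
      = ∑ J : Finset (Fin d), f (replaceFiber u J x N) := by
  let ι : Fin d ↪ V × Fin d := ⟨fun j => (u, j), fun i j h => by simpa using h⟩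
  have h := f.map_piecewise_add (fun p => x p.2) N (univ.map ι)
  have h1 : (univ.map ι).piecewise ((fun p => x p.2) + N) N
      = fun p => N p + if p.1 = u then x p.2 else 0 := by
    funext p
    by_cases hp : p.1 = u
    · rw [Finset.piecewise_eq_of_mem _ _ _
        (Finset.mem_map.2 ⟨p.2, Finset.mem_univ _, Prod.ext (id hp.symm : u = p.1) rfl⟩ :
          p ∈ univ.map ι)]
      simp [hp, add_comm]
    · rw [Finset.piecewise_eq_of_notMem]
      · simp [hp]
      · rintro hc
        obtain ⟨j, -, rfl⟩ := Finset.mem_map.1 hc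
        exact hp rfl
  rw [← h1, h]
  refine (Finset.sum_bij' (fun J _ => J.map ι) (fun s _ => univ.filter fun j => ι j ∈ s)
    ?_ ?_ ?_ ?_ ?_).symm
  · intro J _
    exact Finset.mem_powerset.2 (Finset.map_subset_map.2 (Finset.subset_univ _))
  · simp
  · intro J _
    ext j
    simp
  · intro s hs
    ext p
    simp only [mem_map, mem_filter, mem_univ, true_and]
    constructor
    · rintro ⟨j, h1, rfl⟩; exact h1
    · intro hp
      obtain ⟨j, -, rfl⟩ := Finset.mem_map.1 (Finset.mem_powerset.1 hs hp)
      exact ⟨j, hp, rfl⟩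
  · intro J _
    congr 1
    funext p
    by_cases hp : p.1 = u ∧ p.2 ∈ J
    · rw [Finset.piecewise_eq_of_mem _ _ _
        (Finset.mem_map.2 ⟨p.2, hp.2, Prod.ext (id hp.1.symm : u = p.1) rfl⟩ : p ∈ J.map ι)]
      simp [replaceFiber, hp]
    · rw [Finset.piecewise_eq_of_notMem]
      · simp [replaceFiber, hp]
      · rintro hc
        obtain ⟨j, hj, rfl⟩ := Finset.mem_map.1 hc
        exact hp ⟨rfl, hj⟩

/-- The rows are indexed by `d` letters, but the permutations act on `d + 1`. The shift by
`Fin.succ` keeps the letter `0` out of all row sets, so that it can serve as the fixed point `z` of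
`sum_perm_eq_card_mul`. -/
theorem alternatingOn_replaceFiber {R : Type*} [AddCommGroup R] [Module ℝ R]
    (f : R [⋀^V × Fin d]→ₗ[ℝ] ℝ) (u : V) (J : Finset (Fin d)) (N : V × Fin d → R) :
    AlternatingOn (J.map (Fin.succEmb d)) fun x : Fin (d + 1) → R =>
      f (replaceFiber u J (fun j => x j.succ) N) where
  congr x y h := by
    congr 1
    funext p
    unfold replaceFiber
    by_cases hp : p.1 = u ∧ p.2 ∈ J
    · have := h p.2.succ (Finset.mem_map.2 ⟨p.2, hp.2, rfl⟩)
      simp [hp, this]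
    · simp [hp]
  lin x j' hj' := by
    obtain ⟨j, hj, rfl⟩ := Finset.mem_map.1 hj'
    have : ∀ z, replaceFiber u J (fun i => update x (Fin.succEmb d j) z i.succ) N
        = update (replaceFiber u J (fun i => x i.succ) N) (u, j) z := by
      intro z
      funext p
      unfold replaceFiber
      rcases eq_or_ne p (u, j) with rfl | hp
      · simp [hj]
      · rw [update_of_ne hp]
        by_cases h : p.1 = u ∧ p.2 ∈ J
        · have : p.2.succ ≠ j.succ := by
            intro hc
            exact hp (Prod.ext h.1 (Fin.succ_injective _ hc))
          simp [h, update_of_ne this]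
        · simp [h]
    simp only [this]
    exact ⟨fun y z => f.map_update_add _ _ _ _, fun c y => f.map_update_smul _ _ _ _⟩
  alt x i hi j hj hij hx := by
    obtain ⟨i, hi', rfl⟩ := Finset.mem_map.1 hi
    obtain ⟨j, hj', rfl⟩ := Finset.mem_map.1 hj
    refine f.map_eq_zero_of_eq _ (i := (u, i)) (j := (u, j)) ?_ ?_
    · unfold replaceFiber
      rw [if_pos ⟨rfl, hi'⟩, if_pos ⟨rfl, hj'⟩]
      exact hx
    · rintro hc
      apply hij
      simpa using hc

variable [Fintype V]

/-- The real number `±1`. -/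
abbrev signReal (s : ℤˣ) : ℝ := ((s : ℤ) : ℝ)

/-- The sign of `j` occurs once for `j ∈ J` and once for `τ j ∈ L`. It averages out unless it occurs
twice or not at all. -/
theorem sum_sign_mul_prod (J L : Finset (Fin d)) (τ : Perm (Fin d)) :
    ∑ s : Fin d → ℤˣ, (∏ j, (if j ∈ J then signReal (s j) else 1)) *
        (∏ l, (if l ∈ L then signReal (s (τ⁻¹ l)) else 1))
      = if ∀ j, j ∈ J ↔ τ j ∈ L then 2 ^ d else 0 := by
  have h1 : ∀ s : Fin d → ℤˣ, (∏ j, (if j ∈ J then signReal (s j) else 1)) *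
        (∏ l, (if l ∈ L then signReal (s (τ⁻¹ l)) else 1))
        = ∏ j, ((if j ∈ J then signReal (s j) else 1) *
            (if τ j ∈ L then signReal (s j) else 1)) := by
    intro s
    rw [Finset.prod_mul_distrib, ← Equiv.prod_comp τ fun l =>
      if l ∈ L then signReal (s (τ⁻¹ l)) else 1]
    simp
  simp only [h1]
  have h2 := Finset.prod_univ_sum (fun _ : Fin d => (univ : Finset ℤˣ))
    (fun j t => (if j ∈ J then signReal t else 1) * (if τ j ∈ L then signReal t else 1))
  rw [Fintype.piFinset_univ] at h2
  rw [← h2]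
  have h3 : ∀ j, ∑ t : ℤˣ, (if j ∈ J then signReal t else 1) * (if τ j ∈ L then signReal t else 1)
      = if (j ∈ J ↔ τ j ∈ L) then 2 else 0 := by
    intro j
    by_cases a : j ∈ J <;> by_cases b : τ j ∈ L <;> (simp [a, b, signReal]; try norm_num)
  simp only [h3]
  split_ifs with h
  · simp [h]
  · push Not at h
    obtain ⟨j, hj⟩ := h
    refine Finset.prod_eq_zero (Finset.mem_univ j) ?_
    rw [if_neg]
    tauto

theorem prod_replaceFiber (u v : V) (huv : u ≠ v) (J L : Finset (Fin d)) (x y : Fin d → ℝ) :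
    ∏ p, replaceFiber u J x (replaceFiber v L y fun _ => 1) p
      = (∏ j, if j ∈ J then x j else 1) * ∏ l, if l ∈ L then y l else 1 := by
  have h : ∀ p, replaceFiber u J x (replaceFiber v L y fun _ => 1) p
      = (if p.1 = u then (if p.2 ∈ J then x p.2 else 1) else 1) *
        (if p.1 = v then (if p.2 ∈ L then y p.2 else 1) else 1) := by
    intro p
    unfold replaceFiber
    by_cases h : p.1 = u
    · have : p.1 ≠ v := by rw [h]; exact huv
      simp [h, huv]
    · simp [h, ite_and]
  have h2 : ∀ (w : V) (g : Fin d → ℝ), ∏ p : V × Fin d, (if p.1 = w then g p.2 else 1)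
      = ∏ j, g j := by
    intro w g
    rw [Fintype.prod_prod_type, Finset.prod_eq_single w]
    · simp
    · intro b _ hb; simp [hb]
    · simp
  simp only [h, Finset.prod_mul_distrib]
  rw [h2 u fun j => if j ∈ J then x j else 1, h2 v fun l => if l ∈ L then y l else 1]

theorem sum_perm_fix_zero (G : Perm (Fin (d + 1)) → ℝ) (P : Perm (Fin (d + 1)) → Prop)
    [DecidablePred P] :
    ∑ σ : Perm (Fin (d + 1)) with σ 0 = 0 ∧ P σ, G σ
      = ∑ τ : Perm (Fin d), if P (Perm.decomposeFin.symm (0, τ)) then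
          G (Perm.decomposeFin.symm (0, τ)) else 0 := by
  rw [Finset.sum_filter, ← Equiv.sum_comp Perm.decomposeFin.symm, Fintype.sum_prod_type,
    Finset.sum_eq_single 0]
  · simp
  · intro p _ hp
    simp [hp]
  · simp

theorem decomposeFin_symm_zero_inv (τ : Perm (Fin d)) :
    (Perm.decomposeFin.symm (0, τ))⁻¹ = Perm.decomposeFin.symm (0, τ⁻¹) := by
  rw [inv_eq_iff_mul_eq_one]
  ext i
  refine Fin.cases ?_ (fun i => ?_) i
  · simp
  · simp

/-- Expand both sides over the sets `J`, `L` of rows in the two fibres that take their entry from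
the edge. On the left, `sum_perm_eq_card_mul` leaves `d + 1` times a sum over the `τ ∈ S_d` that map
`J` onto `L`. On the right, the signs kill all other `τ` and give `2 ^ d` for these. The
normalizations agree because `(d + 1)! = (d + 1) d!`. -/
theorem average_alternating_fiber {R : Type*} [AddCommGroup R] [Module ℝ R]
    (f : R [⋀^V × Fin d]→ₗ[ℝ] ℝ) {u v : V} (huv : u ≠ v) (N : V × Fin d → R)
    {a b : Fin (d + 1) → R} (ha : ∑ i, a i = 0) (hb : ∑ i, b i = 0) :
    (Fintype.card (Perm (Fin (d + 1))) : ℝ)⁻¹ * ∑ σ : Perm (Fin (d + 1)),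
      f (fun p => N p + (if p.1 = u then a (σ p.2.succ) else 0)
        + (if p.1 = v then b (σ⁻¹ p.2.succ) else 0))
    = (Fintype.card (Perm (Fin d) × (Fin d → ℤˣ)) : ℝ)⁻¹ *
      ∑ y : Perm (Fin d) × (Fin d → ℤˣ),
      f (fun p => N p + (if p.1 = u then signReal (y.2 p.2) • a (y.1 p.2).succ else 0)
        + (if p.1 = v then signReal (y.2 (y.1⁻¹ p.2)) • b (y.1⁻¹ p.2).succ else 0)) := by
  have hexp : ∀ x y : Fin d → R,
      f (fun p => N p + (if p.1 = u then x p.2 else 0) + (if p.1 = v then y p.2 else 0))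
      = ∑ J : Finset (Fin d), ∑ L : Finset (Fin d),
          f (replaceFiber u J x (replaceFiber v L y N)) := by
    intro x y
    have h := multilinear_add_fiber f.toMultilinearMap v y
      (fun p => N p + if p.1 = u then x p.2 else 0)
    simp only [AlternatingMap.coe_multilinearMap] at h
    rw [h, Finset.sum_comm]
    refine Finset.sum_congr rfl fun L _ => ?_
    have h2 := multilinear_add_fiber f.toMultilinearMap u x (replaceFiber v L y N)
    simp only [AlternatingMap.coe_multilinearMap] at h2
    rw [← h2]
    congr 1
    funext p
    unfold replaceFiber
    by_cases hp : p.1 = u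
    · have : p.1 ≠ v := by rw [hp]; exact huv
      simp [this]
    · simp [hp]
  let F : Finset (Fin d) → Finset (Fin d) → Perm (Fin d) → ℝ := fun J L τ =>
    f (replaceFiber u J (fun j => a (τ j).succ) (replaceFiber v L (fun l => b (τ⁻¹ l).succ) N))
  have hleft : ∀ J L : Finset (Fin d), ∑ σ : Perm (Fin (d + 1)),
      f (replaceFiber u J (fun j => a (σ j.succ))
        (replaceFiber v L (fun l => b (σ⁻¹ l.succ)) N))
      = (d + 1) * ∑ τ : Perm (Fin d), if ∀ j, j ∈ J ↔ τ j ∈ L then F J L τ else 0 := by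
    intro J L
    have h := sum_perm_eq_card_mul (J := J.map (Fin.succEmb d)) (L := L.map (Fin.succEmb d))
      (φ := fun x y => f (replaceFiber u J (fun j => x j.succ)
        (replaceFiber v L (fun l => y l.succ) N)))
      (fun y => alternatingOn_replaceFiber f u J _)
      (fun x => by
        simp only [replaceFiber_comm huv]
        exact alternatingOn_replaceFiber f v L _) ha hb (z := 0) (by simp) (by simp)
    simp only [comp_apply] at h
    rw [h, sum_perm_fix_zero]
    simp only [Fintype.card_fin, Nat.cast_add, Nat.cast_one]
    congr 1
    refine Finset.sum_congr rfl fun τ _ => ?_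
    have hiff : (∀ j : Fin (d + 1), j ∈ J.map (Fin.succEmb d) ↔
        (Perm.decomposeFin.symm (0, τ)) j ∈ L.map (Fin.succEmb d)) ↔
        ∀ j, j ∈ J ↔ τ j ∈ L := by
      rw [Fin.forall_fin_succ]
      simp
    by_cases hP : ∀ j, j ∈ J ↔ τ j ∈ L
    · rw [if_pos (hiff.2 hP), if_pos hP]
      simp only [decomposeFin_symm_zero_inv, Perm.decomposeFin_symm_apply_succ, swap_self,
        Equiv.refl_apply, F]
    · rw [if_neg (mt hiff.1 hP), if_neg hP]
  have hright : ∀ (J L : Finset (Fin d)) (τ : Perm (Fin d)), ∑ s : Fin d → ℤˣ,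
      f (replaceFiber u J (fun j => signReal (s j) • a (τ j).succ)
        (replaceFiber v L (fun l => signReal (s (τ⁻¹ l)) • b (τ⁻¹ l).succ) N))
      = if ∀ j, j ∈ J ↔ τ j ∈ L then 2 ^ d * F J L τ else 0 := by
    intro J L τ
    have h : ∀ s : Fin d → ℤˣ, f (replaceFiber u J (fun j => signReal (s j) • a (τ j).succ)
        (replaceFiber v L (fun l => signReal (s (τ⁻¹ l)) • b (τ⁻¹ l).succ) N))
        = ((∏ j, (if j ∈ J then signReal (s j) else 1)) *
        (∏ l, (if l ∈ L then signReal (s (τ⁻¹ l)) else 1))) * F J L τ := by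
      intro s
      rw [← prod_replaceFiber u v huv J L (fun j => signReal (s j))
        (fun l => signReal (s (τ⁻¹ l)))]
      have := f.toMultilinearMap.map_smul_univ
        (replaceFiber u J (fun j => signReal (s j))
          (replaceFiber v L (fun l => signReal (s (τ⁻¹ l))) fun _ => 1))
        (replaceFiber u J (fun j => a (τ j).succ)
          (replaceFiber v L (fun l => b (τ⁻¹ l).succ) N))
      simp only [AlternatingMap.coe_multilinearMap, smul_eq_mul] at this
      rw [← this]
      congr 1
      funext p
      unfold replaceFiber
      by_cases h1 : p.1 = u ∧ p.2 ∈ J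
      · simp [h1]
      · by_cases h2 : p.1 = v ∧ p.2 ∈ L
        · simp only [if_neg h1, if_pos h2]
        · simp only [if_neg h1, if_neg h2, one_smul]
    simp only [h]
    rw [← Finset.sum_mul, sum_sign_mul_prod, ite_mul, zero_mul]
  have hfact : (Fintype.card (Perm (Fin (d + 1))) : ℝ)
      = (d + 1) * Fintype.card (Perm (Fin d)) := by
    simp [Fintype.card_perm, Nat.factorial_succ]
  have hcard : (Fintype.card (Perm (Fin d) × (Fin d → ℤˣ)) : ℝ)
      = Fintype.card (Perm (Fin d)) * 2 ^ d := by
    simp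
  have hne : (Fintype.card (Perm (Fin d)) : ℝ) ≠ 0 := by exact_mod_cast Fintype.card_ne_zero
  have hd : ((d : ℝ) + 1) ≠ 0 := by positivity
  simp only [fun σ : Perm (Fin (d + 1)) => hexp (fun j => a (σ j.succ)) (fun l => b (σ⁻¹ l.succ)),
    fun y : Perm (Fin d) × (Fin d → ℤˣ) => hexp (fun j => signReal (y.2 j) • a (y.1 j).succ)
      (fun l => signReal (y.2 (y.1⁻¹ l)) • b (y.1⁻¹ l).succ)]
  rw [Finset.sum_comm, Finset.sum_comm (s := (univ : Finset (Perm (Fin d) × (Fin d → ℤˣ)))),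
    Finset.mul_sum, Finset.mul_sum]
  refine Finset.sum_congr rfl fun J _ => ?_
  rw [Finset.sum_comm, Finset.sum_comm (s := (univ : Finset (Perm (Fin d) × (Fin d → ℤˣ)))),
    Finset.mul_sum, Finset.mul_sum]
  refine Finset.sum_congr rfl fun L _ => ?_
  rw [hleft, Fintype.sum_prod_type]
  simp only [hright]
  rw [hfact, hcard]
  have : ∀ τ : Perm (Fin d), (if ∀ j, j ∈ J ↔ τ j ∈ L then 2 ^ d * F J L τ else 0)
      = 2 ^ d * (if ∀ j, j ∈ J ↔ τ j ∈ L then F J L τ else 0) := by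
    intro τ; split_ifs <;> simp
  simp only [this]
  rw [← Finset.mul_sum]
  field_simp

end AverageDet

/-! ### The new part of the adjacency matrix as a sum over edges -/

section EdgeMatrices

open Finset Function Equiv

/-- The images of the standard basis of `ℝ ^ (d + 1)` in its quotient by the constant vectors, in
the basis formed by the last `d` of them. -/
def quotVec (d : ℕ) : Fin (d + 1) → Fin d → ℝ :=
  Fin.cons (fun _ => -1) fun k => Pi.single k 1

theorem quotVec_zero (d : ℕ) : quotVec d 0 = fun _ => -1 := rfl

theorem quotVec_succ (d : ℕ) (k : Fin d) : quotVec d k.succ = Pi.single k 1 := rfl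

theorem sum_quotVec (d : ℕ) : ∑ k, quotVec d k = 0 := by
  rw [Fin.sum_univ_succ]
  funext i
  simp [quotVec_zero, quotVec_succ, Finset.sum_apply, Pi.single_apply]

/-- A pair of families of vectors, one for each orientation of an edge. -/
abbrev EdgeVectors (d : ℕ) : Type := (Fin d → Fin d → ℝ) × (Fin d → Fin d → ℝ)

/-- The vectors that describe the action of `σ` on the quotient by the constant vectors. -/
def permVectors {d : ℕ} (σ : Perm (Fin (d + 1))) : EdgeVectors d :=
  (fun j => quotVec d (σ j.succ), fun j => quotVec d (σ⁻¹ j.succ))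

/-- The vectors that describe a signed permutation. -/
def signedVectors {d : ℕ} (y : Perm (Fin d) × (Fin d → ℤˣ)) : EdgeVectors d :=
  (fun j => signReal (y.2 j) • Pi.single (y.1 j) 1,
    fun j => signReal (y.2 (y.1⁻¹ j)) • Pi.single (y.1⁻¹ j) 1)

variable {V ι : Type*} [DecidableEq V] {d : ℕ}

/-- The part of the adjacency matrix that comes from an edge from `u` to `v`. -/
def edgeBlock (u v : V) (c : EdgeVectors d) : Matrix (V × Fin d) (V × Fin d) ℝ :=
  Matrix.of fun p q => (if p.1 = u ∧ q.1 = v then c.1 p.2 q.2 else 0)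
    + if p.1 = v ∧ q.1 = u then c.2 p.2 q.2 else 0

variable [Fintype V] [Fintype ι] [DecidableEq ι]

/-- The edge changes only rows over `u` and over `v`, which are different rows as `u ≠ v`, and there
it adds images of the vectors `quotVec`, whose sum is zero. -/
theorem average_det_edgeBlock {u v : V} (huv : u ≠ v) (N : Matrix (V × Fin d) (V × Fin d) ℝ) :
    (Fintype.card (Perm (Fin (d + 1))) : ℝ)⁻¹ * ∑ σ : Perm (Fin (d + 1)),
      (N - edgeBlock u v (permVectors σ)).det
    = (Fintype.card (Perm (Fin d) × (Fin d → ℤˣ)) : ℝ)⁻¹ *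
      ∑ y : Perm (Fin d) × (Fin d → ℤˣ), (N - edgeBlock u v (signedVectors y)).det := by
  -- The minus sign absorbs the subtraction of the block.
  let emb : V → (Fin d → ℝ) →ₗ[ℝ] (V × Fin d → ℝ) := fun w =>
    { toFun := fun z q => if q.1 = w then - z q.2 else 0
      map_add' := fun y z => by
        funext q
        simp only [Pi.add_apply]
        split_ifs
        · ring
        · ring
      map_smul' := fun y z => by
        funext q
        simp }
  have hemb : ∀ w z q, emb w z q = if q.1 = w then - z q.2 else 0 := fun _ _ _ => rfl
  have h := average_alternating_fiber (Matrix.detRowAlternating (n := V × Fin d) (R := ℝ)) huv N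
    (a := fun k => emb v (quotVec d k)) (b := fun k => emb u (quotVec d k))
    (by rw [← map_sum, sum_quotVec, map_zero]) (by rw [← map_sum, sum_quotVec, map_zero])
  have e1 : ∀ σ : Perm (Fin (d + 1)), (N - edgeBlock u v (permVectors σ)).det
      = Matrix.detRowAlternating fun p : V × Fin d => N p
        + (if p.1 = u then emb v (quotVec d (σ p.2.succ)) else 0)
        + (if p.1 = v then emb u (quotVec d (σ⁻¹ p.2.succ)) else 0) := by
    intro σ
    congr 1
    ext p q
    by_cases h1 : p.1 = u <;> by_cases h2 : p.1 = v <;> by_cases h3 : q.1 = v <;>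
      by_cases h4 : q.1 = u <;>
      simp [edgeBlock, permVectors, hemb, h1, h2, h3, h4, huv, huv.symm, sub_eq_add_neg]
  have e2 : ∀ y : Perm (Fin d) × (Fin d → ℤˣ), (N - edgeBlock u v (signedVectors y)).det
      = Matrix.detRowAlternating fun p : V × Fin d => N p
        + (if p.1 = u then signReal (y.2 p.2) • emb v (quotVec d (y.1 p.2).succ) else 0)
        + (if p.1 = v then
            signReal (y.2 (y.1⁻¹ p.2)) • emb u (quotVec d (y.1⁻¹ p.2).succ) else 0) := by
    intro y
    congr 1
    ext p q
    by_cases h1 : p.1 = u <;> by_cases h2 : p.1 = v <;> by_cases h3 : q.1 = v <;>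
      by_cases h4 : q.1 = u <;>
      simp [edgeBlock, signedVectors, hemb, h1, h2, h3, h4, huv, huv.symm, sub_eq_add_neg,
        quotVec_succ]
  simp only [e1, e2]
  exact h

/-- The average over all coverings of the characteristic polynomial of the new part of the adjacency
matrix is an average over signed coverings. -/
theorem average_det_edgeBlocks (s t : ι → V) (hst : ∀ e, s e ≠ t e) (x : ℝ) :
    (Fintype.card (ι → Perm (Fin (d + 1))) : ℝ)⁻¹ * ∑ σ : ι → Perm (Fin (d + 1)),
      (Matrix.scalar (V × Fin d) x - ∑ e, edgeBlock (s e) (t e) (permVectors (σ e))).det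
    = (Fintype.card (ι → Perm (Fin d) × (Fin d → ℤˣ)) : ℝ)⁻¹ *
      ∑ y : ι → Perm (Fin d) × (Fin d → ℤˣ),
      (Matrix.scalar (V × Fin d) x - ∑ e, edgeBlock (s e) (t e) (signedVectors (y e))).det := by
  refine average_pi_eq (α := permVectors (d := d)) (β := signedVectors (d := d))
    (F := fun c => (Matrix.scalar (V × Fin d) x - ∑ e, edgeBlock (s e) (t e) (c e)).det)
    fun e c => ?_
  have h : ∀ X : EdgeVectors d, Matrix.scalar (V × Fin d) x
      - ∑ e', edgeBlock (s e') (t e') (update c e X e')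
      = (Matrix.scalar (V × Fin d) x - ∑ e' ∈ univ.erase e, edgeBlock (s e') (t e') (c e'))
        - edgeBlock (s e) (t e) X := by
    intro X
    rw [← Finset.add_sum_erase _ _ (Finset.mem_univ e), update_self,
      Finset.sum_congr rfl fun e' he' => by rw [update_of_ne (Finset.ne_of_mem_erase he')]]
    abel
  simp only [h]
  exact average_det_edgeBlock (hst e) _

end EdgeMatrices

/-! ### Averages over signs: matching polynomials and their positivity -/

section SignedSums

open Finset Function Equiv

variable {I F : Type*} [DecidableEq I] [Fintype F]

/-- The start of a dart, an edge of the family `fun f => (P f, Q f)` with an orientation. -/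
def dartStart (P Q : F → I) (δ : F × Bool) : I := bif δ.2 then P δ.1 else Q δ.1

/-- The end of a dart. -/
def dartEnd (P Q : F → I) (δ : F × Bool) : I := bif δ.2 then Q δ.1 else P δ.1

/-- `x - A` for the signed adjacency matrix `A` with respect to the signs `s`, where the rows of the
vertices outside `S` have been replaced by those of the identity matrix. -/
def signedRows (P Q : F → I) (x : ℝ) (s : F → ℤˣ) (S : Finset I) : Matrix I I ℝ := fun p =>
  if p ∈ S then x • Pi.single p 1
    - ∑ δ : F × Bool with dartStart P Q δ = p, signReal (s δ.1) • Pi.single (dartEnd P Q δ) 1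
  else Pi.single p 1

variable {P Q : F → I} {x : ℝ}

theorem signedRows_eq_update (s : F → ℤˣ) {S : Finset I} {p : I} (hp : p ∈ S) :
    signedRows P Q x s S = (signedRows P Q x s (S.erase p)).updateRow p (x • Pi.single p 1
      - ∑ δ : F × Bool with dartStart P Q δ = p,
          signReal (s δ.1) • Pi.single (dartEnd P Q δ) 1) := by
  ext i j
  rcases eq_or_ne i p with rfl | h
  · simp [signedRows, hp]
  · simp [signedRows, h]

theorem signedRows_of_notMem (s : F → ℤˣ) {S : Finset I} {p : I} (hp : p ∉ S) :
    signedRows P Q x s S p = Pi.single p 1 := by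
  simp [signedRows, hp]

variable [DecidableEq F]

theorem sum_sign_mul_eq_zero (f : F) (g : (F → ℤˣ) → ℝ) (hg : ∀ s t, g (update s f t) = g s) :
    ∑ s : F → ℤˣ, signReal (s f) * g s = 0 := by
  have h := sum_sum_update f fun s => signReal (s f) * g s
  simp only [hg, update_self, ← Finset.sum_mul] at h
  have h0 : ∑ t : ℤˣ, signReal t = 0 := by simp [signReal]
  rw [h0] at h
  simpa using h

theorem signedRows_update {S : Finset I} (δ : F × Bool)
    (hp : dartStart P Q δ ∉ S) (hq : dartEnd P Q δ ∉ S) (s : F → ℤˣ) (t : ℤˣ) :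
    signedRows P Q x (update s δ.1 t) S = signedRows P Q x s S := by
  funext i
  unfold signedRows
  split_ifs with hi
  · congr 1
    refine Finset.sum_congr rfl fun δ' hδ' => ?_
    have hδ' := (Finset.mem_filter.1 hδ').2
    have : δ'.1 ≠ δ.1 := by
      intro h
      obtain ⟨f, a⟩ := δ
      obtain ⟨f', a'⟩ := δ'
      simp only at h
      subst h
      cases a <;> cases a' <;> simp_all [dartStart, dartEnd]
    rw [update_of_ne this]
  · rfl

variable [Fintype I]

/-- The sum over all signs of the edges of the determinants of `signedRows`. It is a multiple of the
matching polynomial of the graph induced on `S`. -/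
def signedDetSum (P Q : F → I) (x : ℝ) (S : Finset I) : ℝ :=
  ∑ s : F → ℤˣ, (signedRows P Q x s S).det

/-- Once the row of `p` is a unit vector, the sign of the edge occurs only in the row of `q`, in the
entry at `p`. The rest of that row is independent of the sign and averages out against the factor in
front. In the remaining part the two signs multiply to `1`, and the rows of `p` and `q` are
exchanged unit vectors, which undoes the minus sign of the entry. -/
theorem sum_sign_mul_det (hPQ : ∀ f, P f ≠ Q f) {S : Finset I} (δ : F × Bool)
    (hp : dartStart P Q δ ∉ S) (hq : dartEnd P Q δ ∈ S) :
    ∑ s : F → ℤˣ, signReal (s δ.1) * ((signedRows P Q x s S).updateRow (dartStart P Q δ)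
      (Pi.single (dartEnd P Q δ) 1)).det = signedDetSum P Q x (S.erase (dartEnd P Q δ)) := by
  set p := dartStart P Q δ with hpdef
  set q := dartEnd P Q δ with hqdef
  have hpq : p ≠ q := by rintro h; exact hp (h ▸ hq)
  have hrev : dartStart P Q (δ.1, !δ.2) = q := by
    obtain ⟨f, a⟩ := δ; cases a <;> rfl
  have hrev' : dartEnd P Q (δ.1, !δ.2) = p := by
    obtain ⟨f, a⟩ := δ; cases a <;> rfl
  let M : (F → ℤˣ) → Matrix I I ℝ := fun s => signedRows P Q x s (S.erase q)
  have hM : ∀ s t, M (update s δ.1 t) = M s := fun s t =>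
    signedRows_update δ (fun h => hp (Finset.mem_of_mem_erase h)) (by simp [← hqdef]) s t
  let w : (F → ℤˣ) → I → ℝ := fun s => x • Pi.single q 1
    - ∑ δ' ∈ (univ.filter fun δ' : F × Bool => dartStart P Q δ' = q).erase (δ.1, !δ.2),
        signReal (s δ'.1) • Pi.single (dartEnd P Q δ') 1
  have hw : ∀ s t, w (update s δ.1 t) = w s := by
    intro s t
    simp only [w]
    congr 1
    refine Finset.sum_congr rfl fun δ' hδ' => ?_
    obtain ⟨h1, h2⟩ := Finset.mem_erase.1 hδ'
    have h3 := (Finset.mem_filter.1 h2).2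
    have : δ'.1 ≠ δ.1 := by
      intro h
      obtain ⟨f, a⟩ := δ
      obtain ⟨f', a'⟩ := δ'
      simp only at h
      subst h
      have := hPQ f'
      cases a <;> cases a' <;> simp_all [dartStart, dartEnd]
    rw [update_of_ne this]
  have hrow : ∀ s, signedRows P Q x s S
      = (M s).updateRow q (w s + (- signReal (s δ.1)) • Pi.single p 1) := by
    intro s
    rw [signedRows_eq_update s hq, ← Finset.add_sum_erase _ _
      (Finset.mem_filter.2 ⟨Finset.mem_univ (δ.1, !δ.2), hrev⟩), hrev']
    congr 1
    simp only [w, neg_smul]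
    abel
  have hswap : ∀ s, (((M s).updateRow q (Pi.single p 1)).updateRow p (Pi.single q 1)).det
      = - (M s).det := by
    intro s
    have h := Matrix.det_permute (swap p q) (M s)
    rw [Perm.sign_swap hpq] at h
    simp only [Units.val_neg, Units.val_one, Int.cast_neg, Int.cast_one, neg_mul, one_mul] at h
    rw [← h]
    congr 1
    have hMp : M s p = Pi.single p 1 := signedRows_of_notMem s (by simp [hp])
    have hMq : M s q = Pi.single q 1 := signedRows_of_notMem s (by simp)
    ext i j
    rcases eq_or_ne i p with rfl | h1
    · simp [hMq]
    · rw [Matrix.updateRow_ne h1]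
      rcases eq_or_ne i q with rfl | h2
      · simp [hMp]
      · rw [Matrix.updateRow_ne h2]
        simp [swap_apply_of_ne_of_ne h1 h2]
  have hterm : ∀ s, signReal (s δ.1) * ((signedRows P Q x s S).updateRow p
      (Pi.single q 1)).det = signReal (s δ.1) * (((M s).updateRow q (w s)).updateRow p
      (Pi.single q 1)).det + (M s).det := by
    intro s
    have hcomm : ∀ z, ((M s).updateRow q z).updateRow p (Pi.single q 1)
        = ((M s).updateRow p (Pi.single q 1)).updateRow q z := by
      intro z
      exact Function.update_comm hpq.symm _ _ _
    have hsq : signReal (s δ.1) * signReal (s δ.1) = 1 := by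
      rcases Int.units_eq_one_or (s δ.1) with h | h <;> simp [h, signReal]
    rw [hrow, hcomm, Matrix.det_updateRow_add, Matrix.det_updateRow_smul, ← hcomm, ← hcomm, hswap]
    linear_combination (M s).det * hsq
  rw [Finset.sum_congr rfl fun s _ => hterm s, Finset.sum_add_distrib,
    sum_sign_mul_eq_zero δ.1 (fun s => (((M s).updateRow q (w s)).updateRow p
      (Pi.single q 1)).det) (fun s t => by simp only [hM, hw]), zero_add]
  rfl

/-- The recursion of the matching polynomials. -/
theorem signedDetSum_eq (hPQ : ∀ f, P f ≠ Q f) {S : Finset I} {p : I} (hp : p ∈ S) :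
    signedDetSum P Q x S = x * signedDetSum P Q x (S.erase p)
      - ∑ δ : F × Bool with dartStart P Q δ = p ∧ dartEnd P Q δ ∈ S,
          signedDetSum P Q x ((S.erase p).erase (dartEnd P Q δ)) := by
  have hdet : ∀ s, (signedRows P Q x s S).det = x * (signedRows P Q x s (S.erase p)).det
      - ∑ δ : F × Bool with dartStart P Q δ = p, signReal (s δ.1) *
          ((signedRows P Q x s (S.erase p)).updateRow p (Pi.single (dartEnd P Q δ) 1)).det := by
    intro s
    let ℓ : (I → ℝ) →ₗ[ℝ] ℝ :=
      (Matrix.detRowAlternating (n := I) (R := ℝ)).toMultilinearMap.toLinearMap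
        (signedRows P Q x s (S.erase p)) p
    have hℓ : ∀ z, ((signedRows P Q x s (S.erase p)).updateRow p z).det = ℓ z := fun z => rfl
    rw [signedRows_eq_update s hp, hℓ, map_sub, map_smul, map_sum]
    simp only [map_smul, smul_eq_mul]
    simp only [← hℓ]
    congr 2
    congr 1
    rw [← signedRows_of_notMem s (Finset.notMem_erase p S), Matrix.updateRow_eq_self]
  unfold signedDetSum
  simp only [hdet]
  rw [Finset.sum_sub_distrib, ← Finset.mul_sum, Finset.sum_comm]
  congr 1
  rw [← Finset.filter_filter, Finset.sum_filter (fun δ => dartEnd P Q δ ∈ S)]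
  refine Finset.sum_congr rfl fun δ hδ => ?_
  have hδ := (Finset.mem_filter.1 hδ).2
  have hne : dartEnd P Q δ ≠ p := by
    rw [← hδ]
    obtain ⟨f, a⟩ := δ
    have := hPQ f
    cases a
    · simpa [dartStart, dartEnd] using this
    · simpa [dartStart, dartEnd] using this.symm
  split_ifs with hS
  · rw [← hδ] at hne ⊢
    exact sum_sign_mul_det hPQ δ (Finset.notMem_erase _ _) (Finset.mem_erase.2 ⟨hne, hS⟩)
  -- If the end of the dart is outside `S`, its row is the same unit vector as the new row of `p`.
  · refine Finset.sum_eq_zero fun s _ => ?_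
    rw [Matrix.det_zero_of_row_eq hne, mul_zero]
    rw [Matrix.updateRow_self, Matrix.updateRow_ne hne,
      signedRows_of_notMem s fun h => hS (Finset.mem_of_mem_erase h)]

/-- A Heilmann–Lieb type argument: the weight `h δ` of a dart from `p` to `q` bounds the ratio of
the sums for `S` without `p, q` and for `S` without `p`. This follows from the induction hypothesis
at `q` and the inequality at the edge; inserted in the recursion at `p`, it gives the bound for `S`.
The strict inequality at the vertices keeps the sums positive. -/
theorem signedDetSum_pos_and_le (hPQ : ∀ f, P f ≠ Q f) (h : F × Bool → ℝ) (hpos : ∀ δ, 0 < h δ)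
    (hedge : ∀ δ, (h δ)⁻¹ + ∑ δ' : F × Bool with
      dartStart P Q δ' = dartEnd P Q δ ∧ δ' ≠ (δ.1, !δ.2), h δ' ≤ x)
    (hvert : ∀ p, ∑ δ : F × Bool with dartStart P Q δ = p, h δ < x) (S : Finset I) :
    0 < signedDetSum P Q x S ∧ ∀ p ∈ S,
      (x - ∑ δ : F × Bool with dartStart P Q δ = p ∧ dartEnd P Q δ ∈ S, h δ) *
        signedDetSum P Q x (S.erase p) ≤ signedDetSum P Q x S := by
  induction S using Finset.strongInduction with
  | H S ih =>
    have h2 : ∀ p ∈ S, (x - ∑ δ : F × Bool with dartStart P Q δ = p ∧ dartEnd P Q δ ∈ S, h δ) *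
        signedDetSum P Q x (S.erase p) ≤ signedDetSum P Q x S := by
      intro p hp
      rw [signedDetSum_eq hPQ hp, sub_mul, Finset.sum_mul]
      refine sub_le_sub_left (Finset.sum_le_sum fun δ hδ => ?_) _
      obtain ⟨hδ1, hδ2⟩ := (Finset.mem_filter.1 hδ).2
      have hne : dartEnd P Q δ ≠ p := by
        rw [← hδ1]
        obtain ⟨f, a⟩ := δ
        have := hPQ f
        cases a
        · simpa [dartStart, dartEnd] using this
        · simpa [dartStart, dartEnd] using this.symm
      have hq : dartEnd P Q δ ∈ S.erase p := Finset.mem_erase.2 ⟨hne, hδ2⟩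
      have hrev : dartEnd P Q (δ.1, !δ.2) = p := by
        rw [← hδ1]
        obtain ⟨f, a⟩ := δ; cases a <;> rfl
      have h3 := (ih _ (Finset.erase_ssubset hp)).2 _ hq
      have h4 := (ih _ ((Finset.erase_ssubset hq).trans (Finset.erase_ssubset hp))).1
      -- Since `p` has been deleted, the reversed dart does not contribute.
      have h5 : ∑ δ' : F × Bool with dartStart P Q δ' = dartEnd P Q δ ∧
          dartEnd P Q δ' ∈ S.erase p, h δ' ≤ ∑ δ' : F × Bool with
          dartStart P Q δ' = dartEnd P Q δ ∧ δ' ≠ (δ.1, !δ.2), h δ' := by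
        refine Finset.sum_le_sum_of_subset_of_nonneg ?_ fun δ' _ _ => (hpos δ').le
        intro δ' hδ'
        simp only [Finset.mem_filter, Finset.mem_univ, true_and] at hδ' ⊢
        refine ⟨hδ'.1, ?_⟩
        rintro rfl
        rw [hrev] at hδ'
        simp at hδ'
      have h6 : (h δ)⁻¹ * signedDetSum P Q x ((S.erase p).erase (dartEnd P Q δ))
          ≤ signedDetSum P Q x (S.erase p) := by
        refine le_trans (mul_le_mul_of_nonneg_right ?_ h4.le) h3
        have := hedge δ
        linarith
      rwa [inv_mul_le_iff₀ (hpos δ)] at h6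
    refine ⟨?_, h2⟩
    rcases S.eq_empty_or_nonempty with rfl | ⟨p, hp⟩
    · have : ∀ s, signedRows P Q x s ∅ = 1 := by
        intro s
        ext i j
        rw [signedRows_of_notMem s (Finset.notMem_empty i), Matrix.one_apply, Pi.single_apply]
        simp [eq_comm]
      simp only [signedDetSum, this, Matrix.det_one]
      simp
    · refine lt_of_lt_of_le (mul_pos ?_ (ih _ (Finset.erase_ssubset hp)).1) (h2 p hp)
      have h7 : ∑ δ : F × Bool with dartStart P Q δ = p ∧ dartEnd P Q δ ∈ S, h δ
          ≤ ∑ δ : F × Bool with dartStart P Q δ = p, h δ := by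
        refine Finset.sum_le_sum_of_subset_of_nonneg ?_ fun δ' _ _ => (hpos δ').le
        intro δ' hδ'
        simp only [Finset.mem_filter, Finset.mem_univ, true_and] at hδ' ⊢
        exact hδ'.1
      have := hvert p
      linarith

end SignedSums

/-! ### Positivity of the expected characteristic polynomial -/

section AveragePositivity

open Finset Function Equiv

variable {V ι : Type*} {d : ℕ}

/-- For fixed `τ` the blocks add up to a signed adjacency matrix of the `d`-covering defined by `τ`,
whose edges are indexed by `ι × Fin d`. -/
theorem sum_edgeBlock_signedVectors [Fintype V] [DecidableEq V] [Fintype ι]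
    (s t : ι → V) (τ : ι → Perm (Fin d)) (ε : ι × Fin d → ℤˣ)
    (x : ℝ) :
    Matrix.scalar (V × Fin d) x
        - ∑ e, edgeBlock (s e) (t e) (signedVectors (τ e, fun j => ε (e, j)))
      = signedRows (fun f : ι × Fin d => (s f.1, f.2)) (fun f => (t f.1, τ f.1 f.2)) x ε univ := by
  ext p q
  simp only [signedRows, Finset.mem_univ, if_true, Matrix.sub_apply, Pi.sub_apply, Pi.smul_apply,
    Matrix.sum_apply, Finset.sum_apply]
  congr 1
  · rw [Matrix.scalar_apply, Matrix.diagonal_apply, Pi.single_apply]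
    simp [eq_comm]
  · rw [Finset.sum_filter, Fintype.sum_prod_type, Fintype.sum_prod_type]
    refine Finset.sum_congr rfl fun e _ => ?_
    simp only [Fintype.sum_bool, dartStart, dartEnd, cond_true, cond_false]
    rw [Finset.sum_add_distrib]
    simp only [edgeBlock, Matrix.of_apply, signedVectors]
    congr 1
    · rw [Finset.sum_eq_single p.2]
      · by_cases h1 : p.1 = s e <;> by_cases h2 : q.1 = t e <;>
          by_cases h3 : q.2 = τ e p.2 <;>
          simp [Prod.ext_iff, Pi.single_apply, h1, h2, h3, eq_comm]
      · intro j _ hj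
        exact if_neg fun h => hj (congrArg Prod.snd h)
      · simp
    · rw [Finset.sum_eq_single ((τ e)⁻¹ p.2)]
      · by_cases h1 : p.1 = t e <;> by_cases h2 : q.1 = s e <;>
          by_cases h3 : q.2 = (τ e)⁻¹ p.2 <;>
          simp_all [Prod.ext_iff, Pi.single_apply, eq_comm]
      · intro j _ hj
        refine if_neg fun h => hj ?_
        rw [← congrArg Prod.snd h]
        simp
      · simp

/-- The darts at a vertex of a covering project injectively to darts of the base. So weights pulled
back from the base satisfy the same inequalities on the covering. -/
theorem sum_dart_lift_le [DecidableEq ι] (s t : ι → V) (τ : ι → Perm (Fin d)) (h : ι × Bool → ℝ)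
    (hpos : ∀ δ, 0 < h δ) (p : V × Fin d) (A : Finset ((ι × Fin d) × Bool)) (B : Finset (ι × Bool))
    (hA : ∀ δ ∈ A, dartStart (fun f : ι × Fin d => (s f.1, f.2))
      (fun f => (t f.1, τ f.1 f.2)) δ = p)
    (hAB : ∀ δ ∈ A, (δ.1.1, δ.2) ∈ B) :
    ∑ δ ∈ A, h (δ.1.1, δ.2) ≤ ∑ δ ∈ B, h δ := by
  rw [← Finset.sum_image (f := h) (g := fun δ : (ι × Fin d) × Bool => (δ.1.1, δ.2))]
  · refine Finset.sum_le_sum_of_subset_of_nonneg (Finset.image_subset_iff.2 hAB)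
      fun _ _ _ => (hpos _).le
  · rintro ⟨⟨e, j⟩, b⟩ h1 ⟨⟨e', j'⟩, b'⟩ h2 h3
    simp only [Prod.mk.injEq] at h3
    obtain ⟨rfl, rfl⟩ := h3
    have h4 := (hA _ h1).trans (hA _ h2).symm
    cases b <;> simpa [dartStart] using h4

variable [Fintype V] [DecidableEq V] [Fintype ι] [DecidableEq ι]

/-- The average over all coverings of the new part of the characteristic polynomial is positive at
`x` if `x` is large in the sense of the weights `h`. -/
theorem average_det_pos (s t : ι → V) (hst : ∀ e, s e ≠ t e) (x : ℝ) (h : ι × Bool → ℝ)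
    (hpos : ∀ δ, 0 < h δ)
    (hedge : ∀ δ, (h δ)⁻¹ + ∑ δ' : ι × Bool with
      dartStart s t δ' = dartEnd s t δ ∧ δ' ≠ (δ.1, !δ.2), h δ' ≤ x)
    (hvert : ∀ p, ∑ δ : ι × Bool with dartStart s t δ = p, h δ < x) :
    0 < (Fintype.card (ι → Perm (Fin (d + 1))) : ℝ)⁻¹ * ∑ σ : ι → Perm (Fin (d + 1)),
      (Matrix.scalar (V × Fin d) x - ∑ e, edgeBlock (s e) (t e) (permVectors (σ e))).det := by
  rw [average_det_edgeBlocks s t hst]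
  refine mul_pos (inv_pos.2 (by exact_mod_cast Fintype.card_pos)) ?_
  -- Separating the permutations from the signs, each covering `τ` contributes a positive sum over
  -- signs.
  let E : (ι → Perm (Fin d)) × (ι × Fin d → ℤˣ) ≃ (ι → Perm (Fin d) × (Fin d → ℤˣ)) :=
    (Equiv.prodCongr (Equiv.refl _) (Equiv.curry ι (Fin d) ℤˣ)).trans
      (Equiv.arrowProdEquivProdArrow ι (fun _ => Perm (Fin d)) (fun _ => Fin d → ℤˣ)).symm
  rw [← Equiv.sum_comp E, Fintype.sum_prod_type]
  refine Finset.sum_pos (fun τ _ => ?_) Finset.univ_nonempty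
  have hE : ∀ ε, ∑ e, edgeBlock (s e) (t e) (signedVectors (E (τ, ε) e))
      = ∑ e, edgeBlock (s e) (t e) (signedVectors (τ e, fun j => ε (e, j))) := fun ε => rfl
  simp only [hE, sum_edgeBlock_signedVectors]
  have hmain := signedDetSum_pos_and_le (P := fun f : ι × Fin d => (s f.1, f.2))
    (Q := fun f => (t f.1, τ f.1 f.2)) (x := x)
    (fun f hf => hst f.1 (congrArg Prod.fst hf)) (fun δ => h (δ.1.1, δ.2)) (fun δ => hpos _)
    (fun δ => ?_) (fun p => ?_) univ
  · exact hmain.1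
  · refine le_trans (add_le_add_right ?_ _) (hedge (δ.1.1, δ.2))
    refine sum_dart_lift_le s t τ h hpos _ _ _
      (fun δ' hδ' => (Finset.mem_filter.1 hδ').2.1) fun δ' hδ' => ?_
    obtain ⟨h1, h2⟩ := (Finset.mem_filter.1 hδ').2
    refine Finset.mem_filter.2 ⟨Finset.mem_univ _, ?_, ?_⟩
    · have := congrArg Prod.fst h1
      obtain ⟨⟨e, j⟩, b⟩ := δ
      obtain ⟨⟨e', j'⟩, b'⟩ := δ'
      cases b <;> cases b' <;> simpa [dartStart, dartEnd] using this
    · intro h3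
      apply h2
      obtain ⟨⟨e, j⟩, b⟩ := δ
      obtain ⟨⟨e', j'⟩, b'⟩ := δ'
      simp only [Prod.mk.injEq] at h3
      obtain ⟨rfl, rfl⟩ := h3
      cases b <;> simp_all [dartStart, dartEnd]
  · refine lt_of_le_of_lt ?_ (hvert p.1)
    refine sum_dart_lift_le s t τ h hpos p _ _
      (fun δ' hδ' => (Finset.mem_filter.1 hδ').2) fun δ' hδ' => ?_
    have h1 := (Finset.mem_filter.1 hδ').2
    refine Finset.mem_filter.2 ⟨Finset.mem_univ _, ?_⟩
    rw [← h1]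
    obtain ⟨⟨e', j'⟩, b'⟩ := δ'
    cases b' <;> rfl

end AveragePositivity

/-! ### Zeros of pencils `F + t G` in the upper half-plane -/

section ComplexLemmas

open Filter Topology

/-- Absence of zeros `t` in the closed upper half-plane means that `F / G` has positive imaginary
part, a convex condition. It is essential that both pencils have the same `G`. -/
theorem convex_combination_ne_zero {F₀ F₁ G : ℂ} (hG : G ≠ 0)
    (h₀ : ∀ t : ℂ, 0 ≤ t.im → F₀ + t * G ≠ 0) (h₁ : ∀ t : ℂ, 0 ≤ t.im → F₁ + t * G ≠ 0)
    {p : ℝ} (hp : 0 ≤ p) (hp' : p ≤ 1) : (p : ℂ) * F₀ + (1 - p) * F₁ ≠ 0 := by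
  have him : ∀ F : ℂ, (∀ t : ℂ, 0 ≤ t.im → F + t * G ≠ 0) → 0 < (F / G).im := by
    intro F h
    by_contra hc
    push Not at hc
    refine h (-(F / G)) (by simpa using hc) ?_
    field_simp
    ring
  have a := him F₀ h₀
  have b := him F₁ h₁
  intro h
  have h2 : (p : ℂ) * (F₀ / G) + ((1 - p : ℝ) : ℂ) * (F₁ / G) = 0 := by
    push_cast
    rw [← mul_div_assoc, ← mul_div_assoc, ← add_div, h, zero_div]
  have h3 := congrArg Complex.im h2
  rw [Complex.add_im, Complex.im_ofReal_mul, Complex.im_ofReal_mul, Complex.zero_im] at h3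
  rcases hp.eq_or_lt with rfl | hp
  · simp at h3; exact b.ne' h3
  · have : 0 < p * (F₀ / G).im := mul_pos hp a
    have : 0 ≤ (1 - p) * (F₁ / G).im := mul_nonneg (by linarith) b.le
    linarith

/-- If `G` vanished at `0` without vanishing identically nearby, `G / F` would be an open map there
and would take a small positive multiple of `i` as a value. The pencil would then have a zero `t` in
the upper half-plane. -/
theorem ne_zero_of_eventually_pencil_ne_zero {F G : ℂ → ℂ} (hF : AnalyticAt ℂ F 0)
    (hG : AnalyticAt ℂ G 0) (h : ∀ᶠ x in 𝓝 (0 : ℂ), ∀ t : ℂ, 0 ≤ t.im → F x + t * G x ≠ 0)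
    (hG0 : ¬ ∀ᶠ x in 𝓝 (0 : ℂ), G x = 0) : G 0 ≠ 0 := by
  intro hzero
  have hF0 : ∀ᶠ x in 𝓝 (0 : ℂ), F x ≠ 0 := by
    filter_upwards [h] with x hx
    simpa using hx 0 (by simp)
  have hφ : AnalyticAt ℂ (fun x => G x / F x) 0 := hG.div hF hF0.self_of_nhds
  rcases hφ.eventually_constant_or_nhds_le_map_nhds with hc | hc
  · apply hG0
    filter_upwards [hc, hF0] with x hx hx'
    rw [hzero, zero_div, div_eq_zero_iff] at hx
    exact hx.resolve_right hx'
  · rw [hzero, zero_div] at hc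
    have hmem := hc (image_mem_map (inter_mem h hF0))
    obtain ⟨ε, hε, hball⟩ := Metric.mem_nhds_iff.1 hmem
    have hw : ((ε / 2 : ℝ) : ℂ) * Complex.I ∈ Metric.ball (0 : ℂ) ε := by
      rw [mem_ball_zero_iff, norm_mul, Complex.norm_I, mul_one, Complex.norm_real,
        Real.norm_of_nonneg (by positivity)]
      linarith
    obtain ⟨x, ⟨hx1, hx2⟩, hx3⟩ := hball hw
    have hx2 : F x ≠ 0 := hx2
    have hx3 : G x / F x = ((ε / 2 : ℝ) : ℂ) * Complex.I := hx3
    -- With `G = (ε / 2) i F` and `t = (2 / ε) i`, the pencil is `F (1 + i ^ 2) = 0`.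
    refine hx1 (((ε / 2)⁻¹ : ℝ) * Complex.I) ?_ ?_
    · rw [Complex.im_ofReal_mul, Complex.I_im]
      positivity
    · rw [(div_eq_iff hx2).1 hx3]
      have he : (ε : ℂ) ≠ 0 := by exact_mod_cast hε.ne'
      have hI := Complex.I_mul_I
      push_cast
      field_simp
      linear_combination F x * hI

/-- Affinity on the line through `2 x` and `2 y` gives the value at their midpoint `x + y`, and
affinity on the lines through `0` removes the factors `2`. -/
theorem map_add_of_affine_on_lines {E : Type*} [AddCommGroup E] [Module ℂ E] (φ : E → ℂ)
    (h : ∀ u w, ∃ c, ∀ t : ℂ, φ (u + t • w) = φ u + t * c) (x y : E) :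
    φ (x + y) - φ x = φ y - φ 0 := by
  have hhalf : ∀ z, φ z = φ 0 + (1 / 2 : ℂ) * (φ ((2 : ℂ) • z) - φ 0) := by
    intro z
    obtain ⟨c, hc⟩ := h 0 ((2 : ℂ) • z)
    have h1 := hc 1
    have h2 := hc (1 / 2)
    rw [zero_add, one_smul] at h1
    rw [zero_add, smul_smul] at h2
    norm_num at h2
    rw [h1, h2]
    ring
  have hmid : φ (x + y) = (1 / 2 : ℂ) * φ ((2 : ℂ) • x) + (1 / 2 : ℂ) * φ ((2 : ℂ) • y) := by
    obtain ⟨c, hc⟩ := h ((2 : ℂ) • x) ((2 : ℂ) • y - (2 : ℂ) • x)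
    have h1 := hc 1
    have h2 := hc (1 / 2)
    have e1 : (2 : ℂ) • x + (1 : ℂ) • ((2 : ℂ) • y - (2 : ℂ) • x) = (2 : ℂ) • y := by
      rw [one_smul]; abel
    have e2 : (2 : ℂ) • x + (1 / 2 : ℂ) • ((2 : ℂ) • y - (2 : ℂ) • x) = x + y := by
      module
    rw [e1] at h1
    rw [e2] at h2
    rw [h1, h2]
    ring
  rw [hmid, hhalf x, hhalf y]
  ring

end ComplexLemmas

/-! ### Determinants under rank one perturbations -/

section DetLemmas

open Matrix

variable {n : Type*} [Fintype n] [DecidableEq n]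

/-- By the Schur complement this is the determinant of a bordered matrix in which `t` occurs in a
single column. -/
theorem det_add_smul_vecMulVec (A : Matrix n n ℂ) (u w : n → ℂ) :
    ∃ c, ∀ t : ℂ, (A + t • vecMulVec u w).det = A.det + t * c := by
  have h : ∀ t : ℂ, (A + t • vecMulVec u w).det
      = (fromBlocks A (- t • replicateCol Unit u) (replicateRow Unit w) 1).det := by
    intro t
    rw [det_fromBlocks_one₂₂, Matrix.smul_mul, ← vecMulVec_eq Unit, neg_smul, sub_neg_eq_add]
  let B : Matrix (n ⊕ Unit) (n ⊕ Unit) ℂ := fromBlocks A 0 (replicateRow Unit w) 0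
  have h2 : ∀ t : ℂ, fromBlocks A (- t • replicateCol Unit u) (replicateRow Unit w) 1
      = B.updateCol (Sum.inr ()) (Pi.single (Sum.inr ()) 1 + t • Sum.elim (-u) 0) := by
    intro t
    ext i j
    rcases i with i | i <;> rcases j with j | j <;> simp [B]
  refine ⟨(B.updateCol (Sum.inr ()) (Sum.elim (-u) 0)).det, fun t => ?_⟩
  have h3 := h 0
  rw [zero_smul, add_zero, h2, zero_smul, add_zero] at h3
  rw [h, h2, det_updateCol_add, det_updateCol_smul, h3]

-- By the matrix determinant lemma the increment is `det K` times the value of the positive definite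
-- form `K⁻¹` at `w`.
open scoped ComplexOrder in
theorem det_lt_det_add_vecMulVec {K : Matrix n n ℂ} (hK : K.PosDef) {w : n → ℂ} (hw : w ≠ 0) :
    0 < (K + vecMulVec w (star w)).det - K.det := by
  have hu : IsUnit K.det := hK.det_pos.ne'.isUnit
  rw [vecMulVec_eq Unit, det_add_replicateCol_mul_replicateRow hu, det_unique (n := Unit),
    Matrix.add_apply, mul_add]
  simp only [Matrix.one_apply_eq, mul_one, add_sub_cancel_left]
  refine mul_pos hK.det_pos ?_
  have h := hK.inv.dotProduct_mulVec_pos hw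
  have e : (replicateRow Unit (star w) * K⁻¹ * replicateCol Unit w) default default
      = star w ⬝ᵥ (K⁻¹ *ᵥ w) := by
    rw [Matrix.mul_assoc]
    rfl
  rw [e]
  exact h

theorem differentiable_det_add_smul (A B : Matrix n n ℂ) :
    Differentiable ℂ fun x : ℂ => (A + x • B).det := by
  simp only [Matrix.det_apply]
  refine Differentiable.fun_sum fun σ _ => Differentiable.const_smul ?_ _
  refine Differentiable.fun_finsetProd fun i _ => ?_
  simp only [Matrix.add_apply, Matrix.smul_apply, smul_eq_mul]
  fun_prop

end DetLemmas

/-! ### Coins in the group algebra and matrices with positive imaginary part -/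

section Stability

open Finset Function Equiv Filter Topology Matrix

variable {Γ : Type*} [Group Γ]

/-- The element `p + (1 - p) g` of the group algebra. -/
noncomputable def coin (p : ℝ) (g : Γ) : MonoidAlgebra ℝ Γ :=
  MonoidAlgebra.single 1 p + MonoidAlgebra.single g (1 - p)

/-- The random choices between the identity and an element of `S`. -/
def coinSet (S : Set Γ) : Set (MonoidAlgebra ℝ Γ) :=
  {m | ∃ p : ℝ, 0 ≤ p ∧ p ≤ 1 ∧ ∃ g ∈ S, m = coin p g}

section

variable [Fintype Γ]

/-- The sum of `h (γ x)` with the weights of the element `m` of the group algebra. -/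
noncomputable def weightedSum {W : Type*} [AddCommGroup W] [Module ℝ W] (m : MonoidAlgebra ℝ Γ)
    (γ : Γ) (h : Γ → W) : W :=
  ∑ x, m.coeff x • h (γ * x)

section

variable {W : Type*} [AddCommGroup W] [Module ℝ W]

theorem weightedSum_mul_coin (m : MonoidAlgebra ℝ Γ) (p : ℝ) (g γ : Γ) (h : Γ → W) :
    weightedSum (m * coin p g) γ h
      = p • weightedSum m γ h + (1 - p) • weightedSum m γ fun x => h (x * g) := by
  unfold weightedSum coin
  rw [mul_add, Finset.smul_sum, Finset.smul_sum]
  simp only [MonoidAlgebra.coeff_add, Finsupp.add_apply, MonoidAlgebra.coeff_mul_single_apply,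
    add_smul, Finset.sum_add_distrib]
  congr 1
  · refine Finset.sum_congr rfl fun x _ => ?_
    rw [inv_one, mul_one, smul_smul, mul_comm]
  · rw [← Equiv.sum_comp (Equiv.mulRight g)]
    refine Finset.sum_congr rfl fun x _ => ?_
    simp [smul_smul, mul_comm, mul_assoc]

theorem weightedSum_coin_mul (m : MonoidAlgebra ℝ Γ) (p : ℝ) (g γ : Γ) (h : Γ → W) :
    weightedSum (coin p g * m) γ h
      = p • weightedSum m γ h + (1 - p) • weightedSum m (γ * g) h := by
  unfold weightedSum coin
  rw [add_mul, Finset.smul_sum, Finset.smul_sum]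
  simp only [MonoidAlgebra.coeff_add, Finsupp.add_apply, MonoidAlgebra.coeff_single_mul_apply,
    add_smul, Finset.sum_add_distrib]
  congr 1
  · refine Finset.sum_congr rfl fun x _ => ?_
    rw [inv_one, one_mul, smul_smul]
  · rw [← Equiv.sum_comp (Equiv.mulLeft g)]
    refine Finset.sum_congr rfl fun x _ => ?_
    simp [smul_smul, mul_assoc]

theorem weightedSum_one (γ : Γ) (h : Γ → W) : weightedSum 1 γ h = h γ := by
  classical
  unfold weightedSum
  rw [Finset.sum_eq_single 1]
  · simp [MonoidAlgebra.one_def]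
  · intro b _ hb
    simp [MonoidAlgebra.one_def, hb.symm]
  · simp

theorem coeff_nonneg_of_mem_closure {S : Set Γ} {m : MonoidAlgebra ℝ Γ}
    (hm : m ∈ Submonoid.closure (coinSet S)) : (∀ x, 0 ≤ m.coeff x) ∧ ∑ x, m.coeff x = 1 := by
  have hsum : ∀ m : MonoidAlgebra ℝ Γ, ∑ x, m.coeff x = weightedSum m 1 fun _ => (1 : ℝ) := by
    intro m; simp [weightedSum]
  induction hm using Submonoid.closure_induction_right with
  | one =>
    classical
    rw [hsum, weightedSum_one]
    refine ⟨fun x => ?_, rfl⟩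
    rw [MonoidAlgebra.one_def, MonoidAlgebra.coeff_single, Finsupp.single_apply]
    split_ifs <;> norm_num
  | mul_right m _ c hc ih =>
    obtain ⟨p, hp, hp', g, -, rfl⟩ := hc
    refine ⟨fun x => ?_, ?_⟩
    · unfold coin
      rw [mul_add, MonoidAlgebra.coeff_add, Finsupp.add_apply,
        MonoidAlgebra.coeff_mul_single_apply, MonoidAlgebra.coeff_mul_single_apply]
      exact add_nonneg (mul_nonneg (ih.1 _) hp) (mul_nonneg (ih.1 _) (by linarith))
    · rw [hsum, weightedSum_mul_coin, ← hsum, ih.2]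
      simp

end

end

variable {κ N M : Type*}

/-- The action of `Γ` on families of matrices by permutations of the rows and columns. -/
def permAct (θ : κ → Γ →* Perm N) (γ : Γ) (Z : κ → Matrix N N ℂ) : κ → Matrix N N ℂ :=
  fun e => (Z e).submatrix ⇑(θ e γ)⁻¹ ⇑(θ e γ)⁻¹

theorem permAct_mul (θ : κ → Γ →* Perm N) (γ γ' : Γ) (Z : κ → Matrix N N ℂ) :
    permAct θ (γ * γ') Z = permAct θ γ (permAct θ γ' Z) := by
  funext e
  ext i j
  simp [permAct]

variable [Fintype N]

/-- The imaginary parts of the matrices `Z e` are uniformly positive definite. -/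
def PosIm (Z : κ → Matrix N N ℂ) : Prop :=
  ∃ a : ℝ, 0 < a ∧ ∀ e (w : N → ℂ), a * ∑ i, ‖w i‖ ^ 2 ≤ (star w ⬝ᵥ (Z e *ᵥ w)).im

theorem PosIm.permAct {θ : κ → Γ →* Perm N} {Z : κ → Matrix N N ℂ} (h : PosIm Z) (γ : Γ) :
    PosIm (permAct θ γ Z) := by
  obtain ⟨a, ha, h⟩ := h
  refine ⟨a, ha, fun e w => ?_⟩
  have h1 := h e (w ∘ θ e γ)
  have e1 : ∑ i, ‖(w ∘ θ e γ) i‖ ^ 2 = ∑ i, ‖w i‖ ^ 2 :=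
    Equiv.sum_comp (θ e γ) fun i => ‖w i‖ ^ 2
  have e2 : star (w ∘ θ e γ) ⬝ᵥ (Z e *ᵥ (w ∘ θ e γ))
      = star w ⬝ᵥ (_root_.permAct θ γ Z e *ᵥ w) := by
    simp only [dotProduct, mulVec, _root_.permAct, submatrix_apply]
    conv_rhs => rw [← Equiv.sum_comp (θ e γ)]
    refine Finset.sum_congr rfl fun i _ => ?_
    congr 1
    conv_rhs => rw [← Equiv.sum_comp (θ e γ)]
    simp
  rwa [e1, e2] at h1

theorem star_dotProduct_vecMulVec (v w : N → ℂ) :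
    star w ⬝ᵥ (vecMulVec v (star v) *ᵥ w) = ((‖star v ⬝ᵥ w‖ ^ 2 : ℝ) : ℂ) := by
  rw [vecMulVec_mulVec]
  have : star w ⬝ᵥ v = star (star v ⬝ᵥ w) := by
    rw [star_dotProduct]
  simp only [dotProduct_smul, this]
  rw [op_smul_eq_smul, smul_eq_mul, Complex.star_def, Complex.mul_conj,
    Complex.normSq_eq_norm_sq]

theorem PosIm.update_add_vecMulVec [DecidableEq κ] {Z : κ → Matrix N N ℂ} (h : PosIm Z) (e : κ)
    (v : N → ℂ) {t : ℂ} (ht : 0 ≤ t.im) : PosIm (update Z e (Z e + t • vecMulVec v (star v))) := by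
  obtain ⟨a, ha, h⟩ := h
  refine ⟨a, ha, fun e' w => (h e' w).trans ?_⟩
  rcases eq_or_ne e' e with rfl | he
  · rw [update_self, add_mulVec, dotProduct_add, smul_mulVec, dotProduct_smul,
      star_dotProduct_vecMulVec, Complex.add_im, smul_eq_mul, Complex.im_mul_ofReal]
    exact le_add_of_nonneg_right (mul_nonneg ht (by positivity))
  · rw [update_of_ne he]

theorem PosIm.eventually_update_add_smul_one [DecidableEq κ] [DecidableEq N]
    {Z : κ → Matrix N N ℂ} (h : PosIm Z) (e : κ) :
    ∀ᶠ x in 𝓝 (0 : ℂ), PosIm (update Z e (Z e + x • (1 : Matrix N N ℂ))) := by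
  obtain ⟨a, ha, h⟩ := h
  have hev : ∀ᶠ x in 𝓝 (0 : ℂ), -(a / 2) < x.im := by
    refine (Complex.continuous_im.tendsto 0).eventually (lt_mem_nhds ?_)
    simpa using ha
  filter_upwards [hev] with x hx
  refine ⟨a / 2, by positivity, fun e' w => ?_⟩
  have hnn : 0 ≤ ∑ i, ‖w i‖ ^ 2 := by positivity
  have h1 := h e' w
  rcases eq_or_ne e' e with rfl | he
  · have e1 : star w ⬝ᵥ w = ((∑ i, ‖w i‖ ^ 2 : ℝ) : ℂ) := by
      simp only [dotProduct, Pi.star_apply, Complex.star_def]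
      push_cast
      exact Finset.sum_congr rfl fun i _ => Complex.conj_mul' _
    rw [update_self, add_mulVec, dotProduct_add, smul_mulVec, dotProduct_smul, one_mulVec,
      Complex.add_im, smul_eq_mul, e1, Complex.im_mul_ofReal]
    nlinarith
  · rw [update_of_ne he]
    nlinarith

variable [Fintype κ] [Fintype M] [DecidableEq M]

/-- The determinant of the compression of the sum of a family of matrices. -/
noncomputable def compressedDet (q : Matrix M N ℂ) (Z : κ → Matrix N N ℂ) : ℂ :=
  (q * (∑ e, Z e) * qᴴ).det

/-- A kernel vector `w` would give a nonzero `y = qᴴ w` at which the forms `Z e` add up to zero,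
although each has positive imaginary part at `y`. -/
theorem compressedDet_ne_zero [Nonempty κ] {q : Matrix M N ℂ}
    (hq : Injective fun w => w ᵥ* q) {Z : κ → Matrix N N ℂ} (hZ : PosIm Z) :
    compressedDet q Z ≠ 0 := by
  obtain ⟨a, ha, h⟩ := hZ
  intro h0
  obtain ⟨w, hw, hw0⟩ := exists_mulVec_eq_zero_iff.2 h0
  set y := qᴴ *ᵥ w with hy
  have hyq : y = star (star w ᵥ* q) := by
    rw [star_vecMul, star_star]
  have hy0 : y ≠ 0 := by
    intro hc
    rw [hyq, star_eq_zero] at hc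
    have : star w = 0 := hq (by simpa using hc)
    exact hw (star_eq_zero.1 this)
  have h1 : star y ⬝ᵥ ((∑ e, Z e) *ᵥ y) = 0 := by
    have : star w ⬝ᵥ ((q * (∑ e, Z e) * qᴴ) *ᵥ w) = 0 := by rw [hw0, dotProduct_zero]
    rw [← mulVec_mulVec, ← mulVec_mulVec, dotProduct_mulVec, ← hy] at this
    rw [hyq, star_star]
    rw [hyq] at this
    exact this
  rw [sum_mulVec, dotProduct_sum] at h1
  have h2 := congrArg Complex.im h1
  rw [Complex.im_sum, Complex.zero_im] at h2
  have hpos : 0 < ∑ i, ‖y i‖ ^ 2 := by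
    obtain ⟨i, hi⟩ := Function.ne_iff.1 hy0
    refine Finset.sum_pos' (fun _ _ => by positivity) ⟨i, Finset.mem_univ _, ?_⟩
    have : y i ≠ 0 := hi
    positivity
  have h3 : 0 < ∑ e : κ, (star y ⬝ᵥ (Z e *ᵥ y)).im :=
    Finset.sum_pos (fun e _ => (mul_pos ha hpos).trans_le (h e y)) Finset.univ_nonempty
  exact h3.ne' h2

end Stability

/-! ### Expected determinants and their rank one increments -/

section StabilityStep

open Finset Function Equiv Filter Topology Matrix

/-- Exchanging two rows adds a rank one matrix with left factor `v = e_i - e_j`, and exchanging two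
columns one with right factor `v`. Neither changes the increment of an expected determinant in the
direction `v vᵀ`. -/
theorem submatrix_swap_eq {n : Type*} [DecidableEq n] (A : Matrix n n ℂ)
    (i j : n) :
    ∃ r c : n → ℂ, A.submatrix ⇑(swap i j) ⇑(swap i j)
      = A + vecMulVec (Pi.single i 1 - Pi.single j 1) r
        + vecMulVec c (Pi.single i 1 - Pi.single j 1) := by
  let r : n → ℂ := fun b => A j b - A i b
  let A' : Matrix n n ℂ := A + vecMulVec (Pi.single i 1 - Pi.single j 1) r
  have h1 : ∀ a b, A (swap i j a) b = A' a b := by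
    intro a b
    simp only [A', r, Matrix.add_apply, vecMulVec_apply, Pi.sub_apply, Pi.single_apply]
    rcases eq_or_ne a i with rfl | hi
    · rcases eq_or_ne a j with rfl | hj
      · simp
      · simp [hj]
    · rcases eq_or_ne a j with rfl | hj
      · simp [hi]
      · simp [hi, hj, swap_apply_of_ne_of_ne]
  refine ⟨r, fun a => A' a j - A' a i, ?_⟩
  ext a b
  rw [submatrix_apply, h1]
  change _ = A' a b + _
  simp only [vecMulVec_apply, Pi.sub_apply, Pi.single_apply]
  rcases eq_or_ne b i with rfl | hi
  · rcases eq_or_ne b j with rfl | hj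
    · simp
    · simp [hj]
  · rcases eq_or_ne b j with rfl | hj
    · simp [hi]
    · simp [hi, hj, swap_apply_of_ne_of_ne]

variable {Γ : Type*} [Group Γ] {κ N M : Type*} [Fintype κ] [DecidableEq κ] [Fintype N]

theorem compressed_permAct_update (q : Matrix M N ℂ) (θ : κ → Γ →* Perm N) (γ : Γ)
    (Z : κ → Matrix N N ℂ) (e : κ) (B : Matrix N N ℂ) :
    q * (∑ e', permAct θ γ (update Z e (Z e + B)) e') * qᴴ
      = q * (∑ e', permAct θ γ Z e') * qᴴ
        + q * B.submatrix ⇑(θ e γ)⁻¹ ⇑(θ e γ)⁻¹ * qᴴ := by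
  rw [← Finset.add_sum_erase univ (permAct θ γ (update Z e (Z e + B))) (Finset.mem_univ e),
    ← Finset.add_sum_erase univ (permAct θ γ Z) (Finset.mem_univ e)]
  have h1 : ∑ e' ∈ univ.erase e, permAct θ γ (update Z e (Z e + B)) e'
      = ∑ e' ∈ univ.erase e, permAct θ γ Z e' := by
    refine Finset.sum_congr rfl fun e' he' => ?_
    simp [permAct, update_of_ne (Finset.ne_of_mem_erase he')]
  have h2 : permAct θ γ (update Z e (Z e + B)) e
      = permAct θ γ Z e + B.submatrix ⇑(θ e γ)⁻¹ ⇑(θ e γ)⁻¹ := by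
    simp [permAct, submatrix_add]
  rw [h1, h2, ← Matrix.add_mul, ← Matrix.mul_add]
  congr 2
  abel

theorem compressed_vecMulVec_submatrix (q : Matrix M N ℂ) (π : Perm N) (t : ℂ) (u w : N → ℂ) :
    q * (t • vecMulVec u w).submatrix ⇑π ⇑π * qᴴ
      = t • vecMulVec (q *ᵥ (u ∘ π)) ((w ∘ π) ᵥ* qᴴ) := by
  have : (t • vecMulVec u w).submatrix ⇑π ⇑π = t • vecMulVec (u ∘ π) (w ∘ π) := rfl
  rw [this, Matrix.mul_smul, Matrix.smul_mul, mul_vecMulVec, vecMulVec_mul]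

variable [Fintype Γ] [Fintype M] [DecidableEq M]

/-- The weighted sum of the determinants of the transforms of `Z`. -/
noncomputable def expectedDet (q : Matrix M N ℂ) (θ : κ → Γ →* Perm N) (m : MonoidAlgebra ℝ Γ)
    (γ : Γ) (Z : κ → Matrix N N ℂ) : ℂ :=
  weightedSum m γ fun x => compressedDet q (permAct θ x Z)

/-- Every transform and compression of a rank one matrix has rank at most one, so each term is
affine in `t`. -/
theorem expectedDet_update_affine (q : Matrix M N ℂ) (θ : κ → Γ →* Perm N)
    (m : MonoidAlgebra ℝ Γ) (γ : Γ) (Z : κ → Matrix N N ℂ) (e : κ) (u w : N → ℂ) :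
    ∃ c, ∀ t : ℂ, expectedDet q θ m γ (update Z e (Z e + t • vecMulVec u w))
      = expectedDet q θ m γ Z + t * c := by
  have h : ∀ x : Γ, ∃ c, ∀ t : ℂ,
      compressedDet q (permAct θ x (update Z e (Z e + t • vecMulVec u w)))
        = compressedDet q (permAct θ x Z) + t * c := by
    intro x
    obtain ⟨c, hc⟩ := det_add_smul_vecMulVec (q * (∑ e', permAct θ x Z e') * qᴴ)
      (q *ᵥ (u ∘ ⇑(θ e x)⁻¹)) ((w ∘ ⇑(θ e x)⁻¹) ᵥ* qᴴ)
    refine ⟨c, fun t => ?_⟩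
    unfold compressedDet
    rw [compressed_permAct_update, compressed_vecMulVec_submatrix, hc]
  choose c hc using h
  refine ⟨weightedSum m γ c, fun t => ?_⟩
  unfold expectedDet weightedSum
  simp only [hc, smul_add, Finset.sum_add_distrib, Finset.mul_sum]
  congr 1
  refine Finset.sum_congr rfl fun x _ => ?_
  rw [mul_smul_comm]

/-- The increment of `expectedDet` in the direction of the rank one matrix `v vᵀ`. -/
noncomputable def rankOneIncrement (q : Matrix M N ℂ) (θ : κ → Γ →* Perm N)
    (m : MonoidAlgebra ℝ Γ) (γ : Γ) (e : κ) (v : N → ℂ) (Z : κ → Matrix N N ℂ) : ℂ :=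
  expectedDet q θ m γ (update Z e (Z e + vecMulVec v (star v))) - expectedDet q θ m γ Z

theorem expectedDet_update_eq (q : Matrix M N ℂ) (θ : κ → Γ →* Perm N)
    (m : MonoidAlgebra ℝ Γ) (γ : Γ) (Z : κ → Matrix N N ℂ) (e : κ) (v : N → ℂ) (t : ℂ) :
    expectedDet q θ m γ (update Z e (Z e + t • vecMulVec v (star v)))
      = expectedDet q θ m γ Z + t * rankOneIncrement q θ m γ e v Z := by
  obtain ⟨c, hc⟩ := expectedDet_update_affine q θ m γ Z e v (star v)
  have h1 := hc 1
  rw [one_smul, one_mul] at h1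
  rw [rankOneIncrement, hc, h1]
  ring

/-- With the left factor `v` fixed, the expected determinant is affine on every line of right
factors. Hence its increment by `star v` does not depend on the right factor added before. -/
theorem rankOneIncrement_add_left (q : Matrix M N ℂ) (θ : κ → Γ →* Perm N)
    (m : MonoidAlgebra ℝ Γ) (γ : Γ) (e : κ) (v r : N → ℂ) (Z : κ → Matrix N N ℂ) :
    rankOneIncrement q θ m γ e v (update Z e (Z e + vecMulVec v r))
      = rankOneIncrement q θ m γ e v Z := by
  have h := map_add_of_affine_on_lines
    (fun w => expectedDet q θ m γ (update Z e (Z e + vecMulVec v w))) (fun u w => by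
      obtain ⟨c, hc⟩ := expectedDet_update_affine q θ m γ
        (update Z e (Z e + vecMulVec v u)) e v w
      refine ⟨c, fun t => ?_⟩
      rw [← hc t, update_self, update_idem, vecMulVec_add, vecMulVec_smul, add_assoc]) r (star v)
  simp only [vecMulVec_zero, add_zero, update_eq_self] at h
  unfold rankOneIncrement
  rw [update_self, update_idem, add_assoc, ← vecMulVec_add]
  exact h

theorem rankOneIncrement_add_right (q : Matrix M N ℂ) (θ : κ → Γ →* Perm N)
    (m : MonoidAlgebra ℝ Γ) (γ : Γ) (e : κ) (v c : N → ℂ) (Z : κ → Matrix N N ℂ) :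
    rankOneIncrement q θ m γ e v (update Z e (Z e + vecMulVec c (star v)))
      = rankOneIncrement q θ m γ e v Z := by
  have h := map_add_of_affine_on_lines
    (fun w => expectedDet q θ m γ (update Z e (Z e + vecMulVec w (star v)))) (fun u w => by
      obtain ⟨c, hc⟩ := expectedDet_update_affine q θ m γ
        (update Z e (Z e + vecMulVec u (star v))) e w (star v)
      refine ⟨c, fun t => ?_⟩
      rw [← hc t, update_self, update_idem, add_vecMulVec, smul_vecMulVec, add_assoc]) c v
  simp only [zero_vecMulVec, add_zero, update_eq_self] at h
  unfold rankOneIncrement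
  rw [update_self, update_idem, add_assoc, ← add_vecMulVec]
  exact h

theorem differentiable_expectedDet (q : Matrix M N ℂ) (θ : κ → Γ →* Perm N)
    (m : MonoidAlgebra ℝ Γ) (γ : Γ) (Z : κ → Matrix N N ℂ) (e : κ) (B : Matrix N N ℂ) :
    Differentiable ℂ fun x : ℂ => expectedDet q θ m γ (update Z e (Z e + x • B)) := by
  unfold expectedDet weightedSum compressedDet
  refine Differentiable.fun_sum fun y _ => Differentiable.const_smul ?_ _
  simp only [compressed_permAct_update]
  have h : ∀ x : ℂ, q * (x • B).submatrix ⇑(θ e (γ * y))⁻¹ ⇑(θ e (γ * y))⁻¹ * qᴴ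
      = x • (q * B.submatrix ⇑(θ e (γ * y))⁻¹ ⇑(θ e (γ * y))⁻¹ * qᴴ) := fun x => by
    change q * (x • B.submatrix _ _) * qᴴ = _
    rw [Matrix.mul_smul, Matrix.smul_mul]
  simp only [h]
  exact differentiable_det_add_smul _ _

end StabilityStep

/-! ### Products of coins preserve stability -/

section StabilityMain

open Finset Function Equiv Filter Topology Matrix

variable {Γ : Type*} [Group Γ] [Fintype Γ] {κ N M : Type*} [Fintype κ] [DecidableEq κ]
  [Fintype N] [DecidableEq N] [Fintype M] [DecidableEq M]

-- Compare the behaviour for large `x`. With `z = x⁻¹`, the difference divided by a power of `x` is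
-- continuous at `z = 0`, where it is an average of the positive numbers `det (K + w w*) - det K`.
open scoped ComplexOrder in
theorem exists_sum_det_ne {X : Type*} [Fintype X] {K : Matrix M M ℂ} (hK : K.PosDef)
    (C : X → Matrix M M ℂ) {w : X → M → ℂ} (hw : ∀ y, w y ≠ 0) {a : X → ℝ} (ha : ∀ y, 0 ≤ a y)
    (ha' : ∑ y, a y = 1) :
    ∃ x : ℂ, ∑ y, a y • (C y + x • (K + vecMulVec (w y) (star (w y)))).det
      ≠ ∑ y, a y • (C y + x • K).det := by
  by_contra! hall
  let Φ : ℂ → ℂ := fun z => ∑ y, a y • ((K + vecMulVec (w y) (star (w y)) + z • C y).det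
    - (K + z • C y).det)
  have hcont : Continuous Φ := by
    refine continuous_finsetSum _ fun y _ => Continuous.fun_const_smul (Continuous.sub ?_ ?_) _
    · exact (differentiable_det_add_smul _ _).continuous
    · exact (differentiable_det_add_smul _ _).continuous
  have hzero : ∀ z : ℂ, z ≠ 0 → Φ z = 0 := by
    intro z hz
    have h := hall z⁻¹
    have e : ∀ y (B : Matrix M M ℂ), (C y + z⁻¹ • B).det
        = (z⁻¹) ^ Fintype.card M * (B + z • C y).det := by
      intro y B
      rw [← det_smul, smul_add, smul_smul, inv_mul_cancel₀ hz, one_smul, add_comm]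
    simp only [e, ← mul_smul_comm, ← Finset.mul_sum] at h
    have h2 := mul_left_cancel₀ (pow_ne_zero _ (inv_ne_zero hz)) h
    simp only [Φ, smul_sub, Finset.sum_sub_distrib, h2, sub_self]
  have h0 : Φ 0 = 0 := by
    have h1 : Set.EqOn Φ (fun _ => 0) {z | z ≠ 0} := hzero
    have h2 : Dense {z : ℂ | z ≠ 0} := dense_compl_singleton 0
    exact congrFun (Continuous.ext_on h2 hcont continuous_const h1) 0
  have hpos : ∀ y, 0 < ((K + vecMulVec (w y) (star (w y))).det - K.det).re := fun y =>
    (Complex.lt_def.1 (det_lt_det_add_vecMulVec hK (hw y))).1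
  have hre := congrArg Complex.re h0
  simp only [Φ, zero_smul, add_zero, Complex.re_sum, Complex.smul_re, Complex.zero_re,
    smul_eq_mul] at hre
  obtain ⟨y, -, hy⟩ : ∃ y ∈ univ, a y ≠ 0 := by
    by_contra! hc
    rw [Finset.sum_eq_zero hc] at ha'
    exact zero_ne_one ha'
  refine (Finset.sum_pos' (fun y _ => mul_nonneg (ha y) (hpos y).le)
    ⟨y, mem_univ _, mul_pos ((ha y).lt_of_ne hy.symm) (hpos y)⟩).ne' hre

-- The identity matrix is invariant under all the permutations, so a multiple `x` of it adds `x q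
-- qᴴ` to every term, whereas `x v v*` adds `x` times a nonzero positive rank one matrix. If the
-- increment vanished for all `x`, both shifts would always give the same expectation.
open scoped ComplexOrder in
theorem exists_rankOneIncrement_ne_zero {q : Matrix M N ℂ} (hq : Injective fun w => w ᵥ* q)
    {θ : κ → Γ →* Perm N} {m : MonoidAlgebra ℝ Γ} (ha : ∀ x, 0 ≤ m.coeff x)
    (ha' : ∑ x, m.coeff x = 1) (γ : Γ) (e : κ) (v : N → ℂ)
    (hv : ∀ x, q *ᵥ (v ∘ ⇑(θ e x)⁻¹) ≠ 0) (Z : κ → Matrix N N ℂ) :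
    ∃ x : ℂ, rankOneIncrement q θ m γ e v (update Z e (Z e + x • (1 : Matrix N N ℂ))) ≠ 0 := by
  obtain ⟨x, hx⟩ := exists_sum_det_ne (Matrix.PosDef.mul_conjTranspose_self q hq)
    (fun y => q * (∑ e', permAct θ (γ * y) Z e') * qᴴ)
    (w := fun y => q *ᵥ (v ∘ ⇑(θ e (γ * y))⁻¹)) (fun y => hv _) ha ha'
  refine ⟨x, fun h0 => hx ?_⟩
  have h := expectedDet_update_eq q θ m γ (update Z e (Z e + x • (1 : Matrix N N ℂ))) e v x
  rw [h0, mul_zero, add_zero, update_self, update_idem, add_assoc] at h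
  unfold expectedDet weightedSum compressedDet at h
  have e1 : ∀ y, q * (x • (1 : Matrix N N ℂ)).submatrix ⇑(θ e (γ * y))⁻¹ ⇑(θ e (γ * y))⁻¹ * qᴴ
      = x • (q * qᴴ) := by
    intro y
    change q * (x • (1 : Matrix N N ℂ).submatrix _ _) * qᴴ = _
    rw [submatrix_one_equiv, Matrix.mul_smul, Matrix.smul_mul, Matrix.mul_one]
  have e2 : ∀ y, q * (x • (1 : Matrix N N ℂ) + x • vecMulVec v (star v)).submatrix
        ⇑(θ e (γ * y))⁻¹ ⇑(θ e (γ * y))⁻¹ * qᴴ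
      = x • (q * qᴴ + vecMulVec (q *ᵥ (v ∘ ⇑(θ e (γ * y))⁻¹))
        (star (q *ᵥ (v ∘ ⇑(θ e (γ * y))⁻¹)))) := by
    intro y
    rw [submatrix_add, Pi.add_apply, Pi.add_apply, Matrix.mul_add, Matrix.add_mul, e1,
      compressed_vecMulVec_submatrix, smul_add, star_mulVec]
    rfl
  simp only [compressed_permAct_update, e1, e2] at h
  exact h

/-- Near `x = 0` the shift of `Z e` by `x` keeps the imaginary parts positive, so the pencils there
have no zeros in the closed upper half-plane. As the increment is not identically zero in `x`, it
cannot vanish at `x = 0`. -/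
theorem rankOneIncrement_ne_zero {q : Matrix M N ℂ} (hq : Injective fun w => w ᵥ* q)
    {θ : κ → Γ →* Perm N} {m : MonoidAlgebra ℝ Γ} (ha : ∀ x, 0 ≤ m.coeff x)
    (ha' : ∑ x, m.coeff x = 1) (γ : Γ) (e : κ) (v : N → ℂ)
    (hv : ∀ x, q *ᵥ (v ∘ ⇑(θ e x)⁻¹) ≠ 0)
    (hm : ∀ Z : κ → Matrix N N ℂ, PosIm Z → expectedDet q θ m γ Z ≠ 0)
    {Z : κ → Matrix N N ℂ} (hZ : PosIm Z) : rankOneIncrement q θ m γ e v Z ≠ 0 := by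
  let Zx : ℂ → κ → Matrix N N ℂ := fun x => update Z e (Z e + x • (1 : Matrix N N ℂ))
  have hF : Differentiable ℂ fun x => expectedDet q θ m γ (Zx x) :=
    differentiable_expectedDet q θ m γ Z e 1
  have hG : Differentiable ℂ fun x => rankOneIncrement q θ m γ e v (Zx x) := by
    unfold rankOneIncrement
    refine Differentiable.sub ?_ hF
    have h := differentiable_expectedDet q θ m γ (update Z e (Z e + vecMulVec v (star v))) e 1
    simp only [update_self, update_idem] at h
    simpa only [Zx, update_self, update_idem, add_right_comm] using h
  have key := ne_zero_of_eventually_pencil_ne_zero (hF.analyticAt 0) (hG.analyticAt 0) ?_ ?_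
  · simpa [Zx] using key
  · filter_upwards [hZ.eventually_update_add_smul_one e] with x hx t ht
    rw [← expectedDet_update_eq]
    exact hm _ (hx.update_add_vecMulVec e v ht)
  · intro hev
    obtain ⟨x, hx⟩ := exists_rankOneIncrement_ne_zero hq ha ha' γ e v hv Z
    have hGa : AnalyticOnNhd ℂ (fun x => rankOneIncrement q θ m γ e v (Zx x)) Set.univ :=
      fun x _ => hG.analyticAt x
    exact hx (hGa.eqOn_zero_of_preconnected_of_eventuallyEq_zero isPreconnected_univ
      (Set.mem_univ 0) hev (Set.mem_univ x))

/-- A coin averages the values at `Z` and at its image under a transposition in one slot. These have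
the same increment in the direction `v v*` with `v = e_i - e_j`, and moving by `t v v*` with `t` in
the closed upper half-plane preserves positivity. So they are two pencils with a common nonzero `G`,
to which `convex_combination_ne_zero` applies. -/
theorem expectedDet_ne_zero [Nonempty κ] {q : Matrix M N ℂ} (hq : Injective fun w => w ᵥ* q)
    {θ : κ → Γ →* Perm N} {S : Set Γ}
    (hS : ∀ g ∈ S, ∃ e i j, θ e g = Equiv.swap i j ∧ (∀ e', e' ≠ e → θ e' g = 1) ∧
      ∀ x, q *ᵥ ((Pi.single i 1 - Pi.single j 1 : N → ℂ) ∘ ⇑(θ e x)⁻¹) ≠ 0)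
    {m : MonoidAlgebra ℝ Γ} (hm : m ∈ Submonoid.closure (coinSet S)) (γ : Γ)
    {Z : κ → Matrix N N ℂ} (hZ : PosIm Z) : expectedDet q θ m γ Z ≠ 0 := by
  -- The rightmost coin acts first on `Z`; the hypothesis for all families with positive imaginary
  -- part then applies to both of its outcomes.
  induction hm using Submonoid.closure_induction_right generalizing Z with
  | one =>
    rw [expectedDet, weightedSum_one]
    exact compressedDet_ne_zero hq (hZ.permAct γ)
  | mul_right m hm c hc ih =>
    obtain ⟨p, hp, hp', g, hg, rfl⟩ := hc
    obtain ⟨e, i, j, hge, hge', hv⟩ := hS g hg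
    set v : N → ℂ := Pi.single i 1 - Pi.single j 1 with hvdef
    have hstar : star v = v := by
      rw [hvdef, star_sub, Pi.star_single, Pi.star_single, star_one]
    have hperm : permAct θ g Z
        = update Z e ((Z e).submatrix ⇑(Equiv.swap i j) ⇑(Equiv.swap i j)) := by
      funext e'
      rcases eq_or_ne e' e with rfl | he
      · simp [permAct, hge]
      · simp [permAct, hge' e' he, update_of_ne he]
    have hinc : rankOneIncrement q θ m γ e v (permAct θ g Z)
        = rankOneIncrement q θ m γ e v Z := by
      obtain ⟨r, c, hrc⟩ := submatrix_swap_eq (Z e) i j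
      rw [hperm, hrc, ← hvdef]
      have h1 := rankOneIncrement_add_right q θ m γ e v c
        (update Z e (Z e + vecMulVec v r))
      rw [update_self, update_idem, hstar] at h1
      rw [h1, rankOneIncrement_add_left]
    obtain ⟨ha, ha'⟩ := coeff_nonneg_of_mem_closure hm
    have hG : rankOneIncrement q θ m γ e v Z ≠ 0 :=
      rankOneIncrement_ne_zero hq ha ha' γ e v hv (fun Z hZ => ih hZ) hZ
    have h := convex_combination_ne_zero (F₀ := expectedDet q θ m γ Z)
      (F₁ := expectedDet q θ m γ (permAct θ g Z)) hG (fun t ht => by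
        rw [← expectedDet_update_eq]
        exact ih (hZ.update_add_vecMulVec e v ht)) (fun t ht => by
        rw [← hinc, ← expectedDet_update_eq]
        exact ih ((hZ.permAct g).update_add_vecMulVec e v ht)) hp hp'
    have e1 : expectedDet q θ (m * coin p g) γ Z
        = (p : ℂ) * expectedDet q θ m γ Z + (1 - p) * expectedDet q θ m γ (permAct θ g Z) := by
      unfold expectedDet
      rw [weightedSum_mul_coin]
      simp only [permAct_mul, Complex.real_smul]
      push_cast
      rfl
    rw [e1]
    exact h

end StabilityMain

/-! ### Segments of real-rooted polynomials -/

section Interlacing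

open Polynomial

theorem splits_of_forall_im_pos {p : ℝ[X]} (hp : p ≠ 0)
    (h : ∀ z : ℂ, 0 < z.im → aeval z p ≠ 0) : p.Splits := by
  refine Splits.of_splits_map (algebraMap ℝ ℂ) (IsAlgClosed.splits _) fun z hz => ?_
  have hz0 : aeval z p = 0 := by
    rw [mem_roots (Polynomial.map_ne_zero hp), IsRoot, eval_map_algebraMap] at hz
    exact hz
  rcases lt_trichotomy z.im 0 with hi | hi | hi
  · refine absurd ?_ (h (starRingEnd ℂ z) (by simpa using hi))
    rw [aeval_conj, hz0, map_zero]
  · exact ⟨z.re, Complex.ext rfl hi.symm⟩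
  · exact absurd hz0 (h z hi)

theorem coeff_prod_X_sub_C_pos (s : Multiset ℝ) (hs : ∀ r ∈ s, r < 0) :
    (∀ k ≤ s.card, 0 < ((s.map fun r => X - C r).prod).coeff k) ∧
      ∀ k, 0 ≤ ((s.map fun r => X - C r).prod).coeff k := by
  induction s using Multiset.induction with
  | empty =>
    simp only [Multiset.card_zero, Multiset.map_zero, Multiset.prod_zero, coeff_one]
    refine ⟨fun k hk => by simp [Nat.le_zero.1 hk], fun k => by split_ifs <;> norm_num⟩
  | cons r s ih =>
    obtain ⟨ih1, ih2⟩ := ih fun a ha => hs a (Multiset.mem_cons_of_mem ha)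
    have hr := hs r (Multiset.mem_cons_self r s)
    simp only [Multiset.map_cons, Multiset.prod_cons, Multiset.card_cons]
    set P := (s.map fun r => X - C r).prod
    have h0 : ((X - C r) * P).coeff 0 = -r * P.coeff 0 := by
      simp [sub_mul]
    have h1 : ∀ k, ((X - C r) * P).coeff (k + 1) = P.coeff k + -r * P.coeff (k + 1) := by
      intro k
      rw [sub_mul, coeff_sub, coeff_X_mul, coeff_C_mul]
      ring
    refine ⟨fun k hk => ?_, fun k => ?_⟩
    · rcases k with - | k
      · rw [h0]
        exact mul_pos (by linarith) (ih1 0 (Nat.zero_le _))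
      · rw [h1]
        exact add_pos_of_pos_of_nonneg (ih1 k (by omega)) (mul_nonneg (by linarith) (ih2 _))
    · rcases k with - | k
      · rw [h0]
        exact mul_nonneg (by linarith) (ih2 0)
      · rw [h1]
        exact add_nonneg (ih2 k) (mul_nonneg (by linarith) (ih2 _))

/-- All roots are negative, and products of factors `X - r` with `r < 0` have positive coefficients.
-/
theorem Polynomial.Splits.coeff_pos {p : ℝ[X]} (hs : p.Splits) (hm : p.Monic)
    (h : ∀ x, 0 ≤ x → 0 < p.eval x) {k : ℕ} (hk : k ≤ p.natDegree) : 0 < p.coeff k := by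
  have hroots : ∀ r ∈ p.roots, r < 0 := by
    intro r hr
    by_contra! hc
    exact (h r hc).ne' (isRoot_of_mem_roots hr)
  have e := hs.eq_prod_roots_of_monic hm
  have h1 := (coeff_prod_X_sub_C_pos p.roots hroots).1 k (by
    rw [← hs.natDegree_eq_card_roots]
    exact hk)
  rwa [← e] at h1

theorem eval_pos_of_coeff_nonneg {p : ℝ[X]} (h : ∀ k, 0 ≤ p.coeff k) (h0 : 0 < p.coeff 0) {x : ℝ}
    (hx : 0 ≤ x) : 0 < p.eval x := by
  rw [eval_eq_sum_range]
  refine Finset.sum_pos' (fun k _ => mul_nonneg (h k) (pow_nonneg hx k)) ⟨0, by simp, ?_⟩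
  simpa using h0

variable {n : ℕ} {P₀ P₁ : ℝ[X]}

theorem natDegree_convex_combination_le (h₀ : P₀.natDegree = n) (h₁ : P₁.natDegree = n) (t : ℝ) :
    (C (1 - t) * P₀ + C t * P₁).natDegree ≤ n :=
  natDegree_add_le_of_degree_le ((natDegree_C_mul_le _ _).trans h₀.le)
    ((natDegree_C_mul_le _ _).trans h₁.le)

theorem monic_convex_combination (m₀ : P₀.Monic) (m₁ : P₁.Monic) (h₀ : P₀.natDegree = n)
    (h₁ : P₁.natDegree = n) (t : ℝ) : (C (1 - t) * P₀ + C t * P₁).Monic := by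
  refine monic_of_natDegree_le_of_coeff_eq_one n (natDegree_convex_combination_le h₀ h₁ t) ?_
  rw [coeff_add, coeff_C_mul, coeff_C_mul]
  have e₀ : P₀.coeff n = 1 := h₀ ▸ m₀
  have e₁ : P₁.coeff n = 1 := h₁ ▸ m₁
  rw [e₀, e₁]
  ring

/-- The constant coefficient is positive along the whole segment. For real-rooted polynomials
nonnegative coefficients then exclude roots in `[0, ∞)`, and so all coefficients are positive. Hence
the parameters with nonnegative coefficients form a set that is both closed and open, and it
contains the end `1`. -/
theorem coeff_pos_of_convex_combinations (m₀ : P₀.Monic) (m₁ : P₁.Monic) (h₀ : P₀.natDegree = n)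
    (h₁ : P₁.natDegree = n) (hs : ∀ t, 0 ≤ t → t ≤ 1 → (C (1 - t) * P₀ + C t * P₁).Splits)
    (hp : 0 < P₀.coeff 0) (hc : ∀ k ≤ n, 0 < P₁.coeff k) : ∀ k ≤ n, 0 < P₀.coeff k := by
  let Q : ℝ → ℝ[X] := fun t => C (1 - t) * P₀ + C t * P₁
  have hQ : ∀ k t, (Q t).coeff k = (1 - t) * P₀.coeff k + t * P₁.coeff k := by
    intro k t
    simp only [Q, coeff_add, coeff_C_mul]
  have hcont : ∀ k, Continuous fun t : Set.Icc (0 : ℝ) 1 => (Q t).coeff k := by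
    intro k
    simp only [hQ]
    fun_prop
  have hz : ∀ t : Set.Icc (0 : ℝ) 1, 0 < (Q t).coeff 0 := by
    rintro ⟨t, ht0, ht1⟩
    rw [hQ]
    have := hc 0 (Nat.zero_le n)
    rcases ht0.eq_or_lt with rfl | ht
    · simpa using hp
    · exact add_pos_of_nonneg_of_pos (mul_nonneg (by simpa using ht1) hp.le) (mul_pos ht this)
  let A : Set (Set.Icc (0 : ℝ) 1) := {t | ∀ k ∈ Finset.range (n + 1), 0 ≤ (Q t).coeff k}
  let B : Set (Set.Icc (0 : ℝ) 1) := {t | ∀ k ∈ Finset.range (n + 1), 0 < (Q t).coeff k}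
  have hA : IsClosed A := by
    simp only [A, Set.ofPred_forall]
    exact isClosed_biInter fun k _ => isClosed_le continuous_const (hcont k)
  have hB : IsOpen B := by
    have : B = ⋂ k ∈ Finset.range (n + 1), {t : Set.Icc (0 : ℝ) 1 | 0 < (Q t).coeff k} := by
      ext t; simp [B]
    rw [this]
    exact isOpen_biInter_finset fun k _ => isOpen_lt continuous_const (hcont k)
  have hBA : B = A := by
    refine Set.Subset.antisymm (fun t ht k hk => (ht k hk).le) fun t ht k hk => ?_
    have hdeg : (Q t).natDegree ≤ n := natDegree_convex_combination_le h₀ h₁ _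
    have hmon : (Q t).Monic := monic_convex_combination m₀ m₁ h₀ h₁ _
    have hnn : ∀ k, 0 ≤ (Q t).coeff k := by
      intro k
      rcases le_or_gt k n with hk | hk
      · exact ht k (Finset.mem_range_succ_iff.2 hk)
      · rw [coeff_eq_zero_of_natDegree_lt (hdeg.trans_lt hk)]
    have hn : (Q t).natDegree = n := by
      refine le_antisymm hdeg (le_natDegree_of_ne_zero ?_)
      have e₀ : P₀.coeff n = 1 := h₀ ▸ m₀
      have e₁ : P₁.coeff n = 1 := h₁ ▸ m₁
      rw [hQ, e₀, e₁]
      norm_num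
    exact (hs t t.2.1 t.2.2).coeff_pos hmon (fun x hx => eval_pos_of_coeff_nonneg hnn (hz t) hx)
      (hn.symm ▸ Finset.mem_range_succ_iff.1 hk)
  have huniv : A = Set.univ := by
    refine IsClopen.eq_univ ⟨hA, hBA ▸ hB⟩ ⟨⟨1, by norm_num, le_rfl⟩, fun k hk => ?_⟩
    rw [hQ]
    simpa using (hc k (Finset.mem_range_succ_iff.1 hk)).le
  intro k hk
  have h : (⟨0, le_rfl, by norm_num⟩ : Set.Icc (0 : ℝ) 1) ∈ B := by
    rw [hBA, huniv]; trivial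
  simpa [hQ] using h k (Finset.mem_range_succ_iff.2 hk)

/-- Positivity on the half-line is read off from the coefficients, and
`coeff_pos_of_convex_combinations` carries it to `P₀` along the segment from the given combination.
The latter is part of the segment from `P₁`, so real-rootedness is available. -/
theorem convex_combination_eval_pos_zero (m₀ : P₀.Monic) (m₁ : P₁.Monic) (h₀ : P₀.natDegree = n)
    (h₁ : P₁.natDegree = n) (hs : ∀ t, 0 ≤ t → t ≤ 1 → (C (1 - t) * P₀ + C t * P₁).Splits)
    {t : ℝ} (ht : 0 ≤ t) (ht' : t ≤ 1)
    (h : ∀ x, 0 ≤ x → 0 < (C (1 - t) * P₀ + C t * P₁).eval x) (hP : 0 < P₀.coeff 0) :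
    ∀ x, 0 ≤ x → 0 < P₀.eval x := by
  have hm := monic_convex_combination m₀ m₁ h₀ h₁ t
  have hn : (C (1 - t) * P₀ + C t * P₁).natDegree = n := by
    refine le_antisymm (natDegree_convex_combination_le h₀ h₁ t) (le_natDegree_of_ne_zero ?_)
    have e₀ : P₀.coeff n = 1 := h₀ ▸ m₀
    have e₁ : P₁.coeff n = 1 := h₁ ▸ m₁
    rw [coeff_add, coeff_C_mul, coeff_C_mul, e₀, e₁]
    norm_num
  have key := coeff_pos_of_convex_combinations m₀ hm h₀ hn (fun s hs0 hs1 => by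
    have e : C (1 - s) * P₀ + C s * (C (1 - t) * P₀ + C t * P₁)
        = C (1 - s * t) * P₀ + C (s * t) * P₁ := by
      simp only [C_sub, C_mul, C_1]
      ring
    rw [e]
    exact hs _ (mul_nonneg hs0 ht) (mul_le_one₀ hs1 ht ht')) hP
    (fun k hk => (hs t ht ht').coeff_pos hm h (hn.symm ▸ hk))
  intro x hx
  refine eval_pos_of_coeff_nonneg (fun k => ?_) hP hx
  rcases le_or_gt k n with hk | hk
  · exact (key k hk).le
  · rw [coeff_eq_zero_of_natDegree_lt (h₀.trans_lt hk)]

/-- If both ends failed, let `c` be the smaller of the two points of failure. The combination is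
positive at `c`, hence so is one of the ends; after a translation by `c` this end is positive on all
of `[c, ∞)`, which contains its point of failure. -/
theorem eval_pos_or_eval_pos_of_convex_combination (m₀ : P₀.Monic) (m₁ : P₁.Monic)
    (h₀ : P₀.natDegree = n) (h₁ : P₁.natDegree = n)
    (hs : ∀ t, 0 ≤ t → t ≤ 1 → (C (1 - t) * P₀ + C t * P₁).Splits)
    {t : ℝ} (ht : 0 ≤ t) (ht' : t ≤ 1) {ρ : ℝ}
    (h : ∀ x, ρ < x → 0 < (C (1 - t) * P₀ + C t * P₁).eval x) :
    (∀ x, ρ < x → 0 < P₀.eval x) ∨ ∀ x, ρ < x → 0 < P₁.eval x := by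
  by_contra! hc
  obtain ⟨⟨x₀, hx₀, hx₀'⟩, x₁, hx₁, hx₁'⟩ := hc
  let c := min x₀ x₁
  have hcomp : ∀ t, C (1 - t) * P₀.comp (X + C c) + C t * P₁.comp (X + C c)
      = (C (1 - t) * P₀ + C t * P₁).comp (X + C c) := by
    intro t
    simp
  have hev : ∀ (P : ℝ[X]) x, (P.comp (X + C c)).eval x = P.eval (x + c) := by
    intro P x
    simp [eval_comp]
  have hcoeff : ∀ P : ℝ[X], (P.comp (X + C c)).coeff 0 = P.eval c := by
    intro P
    rw [coeff_zero_eq_eval_zero, hev, zero_add]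
  have hd : ∀ P : ℝ[X], P.natDegree = n → (P.comp (X + C c)).natDegree = n := by
    intro P hP
    rw [natDegree_comp, natDegree_X_add_C, mul_one, hP]
  have hpos : 0 < (1 - t) * P₀.eval c + t * P₁.eval c := by
    simpa using h c (lt_min hx₀ hx₁)
  have hpos' : ∀ x, 0 ≤ x → ρ < x + c := fun x hx => by
    have : ρ < c := lt_min hx₀ hx₁
    linarith
  rcases lt_or_ge 0 (P₀.eval c) with hp | hp
  · have := convex_combination_eval_pos_zero (m₀.comp_X_add_C c) (m₁.comp_X_add_C c) (hd _ h₀)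
      (hd _ h₁) (fun s hs0 hs1 => by rw [hcomp]; exact (hs s hs0 hs1).comp_X_add_C c) ht ht'
      (fun x hx => by rw [hcomp, hev]; exact h _ (hpos' x hx)) (by rwa [hcoeff])
      (x₀ - c) (sub_nonneg.2 (min_le_left _ _))
    rw [hev, sub_add_cancel] at this
    exact this.not_ge hx₀'
  · have hp1 : 0 < P₁.eval c := by
      by_contra! hc
      nlinarith
    have hcomp' : ∀ t, C (1 - t) * P₁.comp (X + C c) + C t * P₀.comp (X + C c)
        = (C (1 - (1 - t)) * P₀ + C (1 - t) * P₁).comp (X + C c) := by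
      intro t
      rw [← hcomp, sub_sub_cancel, add_comm]
    have := convex_combination_eval_pos_zero (m₁.comp_X_add_C c) (m₀.comp_X_add_C c) (hd _ h₁)
      (hd _ h₀) (fun s hs0 hs1 => by
        rw [hcomp']; exact (hs _ (by linarith) (by linarith)).comp_X_add_C c)
      (t := 1 - t) (by linarith) (by linarith)
      (fun x hx => by
        rw [hcomp', hev]
        simpa only [sub_sub_cancel] using h _ (hpos' x hx)) (by rwa [hcoeff])
      (x₁ - c) (sub_nonneg.2 (min_le_right _ _))
    rw [hev, sub_add_cancel] at this
    exact this.not_ge hx₁'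

end Interlacing

/-! ### Deciding the coins one by one -/

section Descent

open Polynomial

variable {Γ : Type*} [Group Γ] [Fintype Γ]

/-- The leftmost coin replaces the base point `γ` by `γ` or `γ g`, and the two resulting averages
span a segment of real-rooted polynomials: changing the bias of that coin stays among the products
of coins. One outcome inherits the positivity, and `γ` records the outcomes so far. -/
theorem exists_eval_pos_of_weightedSum {S : Set Γ} {n : ℕ} {φ : Γ → ℝ[X]} (hφ : ∀ x, (φ x).Monic)
    (hn : ∀ x, (φ x).natDegree = n)
    (hs : ∀ m ∈ Submonoid.closure (coinSet S), ∀ γ, ∀ z : ℂ, 0 < z.im →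
      aeval z (weightedSum m γ φ) ≠ 0)
    {m : MonoidAlgebra ℝ Γ} (hm : m ∈ Submonoid.closure (coinSet S)) {ρ : ℝ} (γ : Γ)
    (h : ∀ x, ρ < x → 0 < (weightedSum m γ φ).eval x) :
    ∃ σ, ∀ x, ρ < x → 0 < (φ σ).eval x := by
  have hdeg : ∀ m ∈ Submonoid.closure (coinSet S), ∀ γ,
      (weightedSum m γ φ).Monic ∧ (weightedSum m γ φ).natDegree = n := by
    intro m hm γ
    have hle : (weightedSum m γ φ).natDegree ≤ n :=
      natDegree_sum_le_of_forall_le _ _ fun x _ => (natDegree_smul_le _ _).trans (hn _).le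
    have hc : (weightedSum m γ φ).coeff n = 1 := by
      have e : ∀ x, (φ x).coeff n = 1 := fun x => hn x ▸ hφ x
      simp only [weightedSum, finsetSum_coeff, coeff_smul, e, smul_eq_mul, mul_one]
      exact (coeff_nonneg_of_mem_closure hm).2
    refine ⟨monic_of_natDegree_le_of_coeff_eq_one n hle hc,
      le_antisymm hle (le_natDegree_of_ne_zero ?_)⟩
    rw [hc]
    exact one_ne_zero
  induction hm using Submonoid.closure_induction_left generalizing γ with
  | one => exact ⟨γ, by simpa only [weightedSum_one] using h⟩
  | mul_left c hc m hm ih =>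
    obtain ⟨p, hp, hp', g, hg, rfl⟩ := hc
    have hcomb : ∀ t : ℝ, C (1 - t) * weightedSum m γ φ + C t * weightedSum m (γ * g) φ
        = weightedSum (coin (1 - t) g * m) γ φ := by
      intro t
      rw [weightedSum_coin_mul, smul_eq_C_mul, smul_eq_C_mul, sub_sub_cancel]
    obtain ⟨m₀, h₀⟩ := hdeg m hm γ
    obtain ⟨m₁, h₁⟩ := hdeg m hm (γ * g)
    rcases eval_pos_or_eval_pos_of_convex_combination m₀ m₁ h₀ h₁ (fun t ht ht' => by
      refine splits_of_forall_im_pos (monic_convex_combination m₀ m₁ h₀ h₁ t).ne_zero ?_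
      rw [hcomb]
      exact hs _ (mul_mem (Submonoid.subset_closure
        ⟨1 - t, by linarith, by linarith, g, hg, rfl⟩) hm) γ)
      (t := 1 - p) (by linarith) (by linarith)
      (fun x hx => by
        rw [hcomb, sub_sub_cancel]
        exact h x hx) with h | h
    · exact ih γ h
    · exact ih _ h

end Descent

/-! ### The uniform distribution on permutations as a product of coins -/

section UniformElement

open Finset Equiv

variable {Γ G H : Type*} [Group Γ] [Group G] [Fintype G] [Group H] [Fintype H]

/-- The average in the group algebra of the image of a finite group. -/
noncomputable def groupAverage (f : G →* Γ) : MonoidAlgebra ℝ Γ :=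
  (Fintype.card G : ℝ)⁻¹ • ∑ x, MonoidAlgebra.of ℝ Γ (f x)

theorem of_mul_groupAverage (f : G →* Γ) (h : G) :
    MonoidAlgebra.of ℝ Γ (f h) * groupAverage f = groupAverage f := by
  unfold groupAverage
  rw [mul_smul_comm, Finset.mul_sum, ← Equiv.sum_comp (Equiv.mulLeft h) fun x =>
    MonoidAlgebra.of ℝ Γ (f x)]
  simp only [Equiv.coe_mulLeft, map_mul]

theorem groupAverage_mul_of (f : G →* Γ) (h : G) :
    groupAverage f * MonoidAlgebra.of ℝ Γ (f h) = groupAverage f := by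
  unfold groupAverage
  rw [smul_mul_assoc, Finset.sum_mul, ← Equiv.sum_comp (Equiv.mulRight h) fun x =>
    MonoidAlgebra.of ℝ Γ (f x)]
  simp only [Equiv.coe_mulRight, map_mul]

theorem groupAverage_comp_mul (f : G →* Γ) (i : H →* G) :
    groupAverage (f.comp i) * groupAverage f = groupAverage f := by
  rw [groupAverage, smul_mul_assoc, Finset.sum_mul]
  simp only [MonoidHom.comp_apply, of_mul_groupAverage, Finset.sum_const, card_univ]
  rw [← Nat.cast_smul_eq_nsmul ℝ, smul_smul, inv_mul_cancel₀, one_smul]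
  exact_mod_cast Fintype.card_ne_zero

/-- Permutations of `Fin n` as permutations of `Fin (n + 1)` fixing `0`. -/
def succPerm (n : ℕ) : Perm (Fin n) →* Perm (Fin (n + 1)) where
  toFun e := Perm.decomposeFin.symm (0, e)
  map_one' := by rw [Perm.decomposeFin_symm_of_one, swap_self]; rfl
  map_mul' e e' := by
    ext x
    refine Fin.cases ?_ (fun x => ?_) x <;> simp

theorem succPerm_zero {n : ℕ} (e : Perm (Fin n)) : succPerm n e 0 = 0 := by
  simp [succPerm]

theorem succPerm_succ {n : ℕ} (e : Perm (Fin n)) (x : Fin n) :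
    succPerm n e x.succ = (e x).succ := by
  simp [succPerm]

theorem succPerm_swap {n : ℕ} (i j : Fin n) :
    succPerm n (swap i j) = swap i.succ j.succ := by
  ext x
  refine Fin.cases ?_ (fun x => ?_) x
  · rw [succPerm_zero, swap_apply_of_ne_of_ne (Fin.succ_ne_zero _).symm (Fin.succ_ne_zero _).symm]
  · rw [succPerm_succ, (Fin.succ_injective n).map_swap]

theorem decomposeFin_symm_eq {n : ℕ} (p : Fin (n + 1)) (e : Perm (Fin n)) :
    Perm.decomposeFin.symm (p, e) = swap 0 p * succPerm n e := by
  ext x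
  refine Fin.cases ?_ (fun x => ?_) x
  · simp [succPerm_zero]
  · simp [succPerm_succ]

/-- The stabilizer of `0` has two double cosets, itself and that of the transposition of `0` and
`1`. A uniform permutation lies in the first with probability `1 / (n + 2)`, and multiplying by
uniform elements of the stabilizer on both sides makes the result uniform on each. -/
theorem groupAverage_perm_succ {n : ℕ} (f : Perm (Fin (n + 2)) →* Γ) :
    groupAverage f = groupAverage (f.comp (succPerm (n + 1)))
      * coin (1 / (n + 2 : ℝ)) (f (swap 0 1)) * groupAverage (f.comp (succPerm (n + 1))) := by
  set u := groupAverage (f.comp (succPerm (n + 1))) with hu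
  let o : Γ →* MonoidAlgebra ℝ Γ := MonoidAlgebra.of ℝ Γ
  have huu : u * u = u := by
    have := groupAverage_comp_mul (f.comp (succPerm (n + 1)))
      (MonoidHom.id (Perm (Fin (n + 1))))
    rwa [MonoidHom.comp_id] at this
  have h1 : groupAverage f = ((n + 2 : ℝ))⁻¹ • ∑ p : Fin (n + 2), o (f (swap 0 p)) * u := by
    rw [groupAverage, ← Equiv.sum_comp Perm.decomposeFin.symm, Fintype.sum_prod_type, hu]
    simp only [decomposeFin_symm_eq, map_mul, ← Finset.mul_sum, groupAverage, mul_smul_comm]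
    rw [← Finset.smul_sum, smul_smul]
    congr 1
    rw [Fintype.card_perm, Fintype.card_perm, Fintype.card_fin, Fintype.card_fin,
      Nat.factorial_succ (n + 1)]
    push_cast
    rw [mul_inv]
    congr 2
    ring
  -- Between the two averages, all transpositions moving `0` are equivalent, since they are
  -- conjugate under the stabilizer.
  have h2 : ∀ p : Fin (n + 1), u * (o (f (swap 0 p.succ)) * u) = u * (o (f (swap 0 1)) * u) := by
    intro p
    have e : swap (0 : Fin (n + 2)) p.succ
        = succPerm (n + 1) (swap 0 p) * swap 0 1 * succPerm (n + 1) (swap 0 p) := by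
      have := swap_apply_apply (succPerm (n + 1) (swap 0 p)) 0 1
      rw [succPerm_zero, ← Fin.succ_zero_eq_one, succPerm_succ, swap_apply_left, ← map_inv,
        swap_inv] at this
      rw [this, Fin.succ_zero_eq_one]
    have a1 : o (f (succPerm (n + 1) (swap 0 p))) * u = u :=
      of_mul_groupAverage (f.comp (succPerm (n + 1))) (swap 0 p)
    have a2 : u * o (f (succPerm (n + 1) (swap 0 p))) = u :=
      groupAverage_mul_of (f.comp (succPerm (n + 1))) (swap 0 p)
    rw [e, map_mul, map_mul, map_mul, map_mul, mul_assoc, a1, ← mul_assoc, ← mul_assoc, a2,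
      mul_assoc]
  have h3 : groupAverage f = u * groupAverage f := (groupAverage_comp_mul f _).symm
  rw [h3, h1, mul_smul_comm, Finset.mul_sum, Fin.sum_univ_succ]
  simp only [h2, Finset.sum_const, card_univ, Fintype.card_fin]
  have h4 : coin (1 / (n + 2 : ℝ)) (f (swap 0 1))
      = (1 / (n + 2 : ℝ)) • (1 : MonoidAlgebra ℝ Γ)
        + (1 - 1 / (n + 2 : ℝ)) • o (f (swap 0 1)) := by
    simp [coin, o, MonoidAlgebra.one_def]
  rw [h4, mul_add, add_mul, swap_self, mul_smul_comm, mul_smul_comm, smul_mul_assoc,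
    smul_mul_assoc, mul_one, smul_add, mul_assoc, one_div, ← Nat.cast_smul_eq_nsmul ℝ, smul_smul]
  congr 2
  · change u * (o (f 1) * u) = _
    rw [map_one, map_one, one_mul]
  · have : (n + 2 : ℝ) ≠ 0 := by positivity
    push_cast
    field_simp
    ring

theorem groupAverage_eq_one (f : G →* Γ) (hf : ∀ x, f x = 1) : groupAverage f = 1 := by
  simp only [groupAverage, hf, map_one, Finset.sum_const, card_univ]
  rw [← Nat.cast_smul_eq_nsmul ℝ, smul_smul, inv_mul_cancel₀, one_smul]
  exact_mod_cast Fintype.card_ne_zero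

theorem groupAverage_perm_mem_closure {S : Set Γ} (n : ℕ) (f : Perm (Fin n) →* Γ)
    (hf : ∀ i j, i ≠ j → f (swap i j) ∈ S) :
    groupAverage f ∈ Submonoid.closure (coinSet S) := by
  induction n with
  | zero =>
    rw [groupAverage_eq_one f fun x => by rw [Subsingleton.elim x 1, map_one]]
    exact one_mem _
  | succ n ih =>
    rcases n with - | n
    · rw [groupAverage_eq_one f fun x => by
        rw [show x = 1 from Equiv.ext fun i => Subsingleton.elim (α := Fin 1) (x i) i, map_one]]
      exact one_mem _
    · have h := ih (f.comp (succPerm (n + 1))) fun i j hij => by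
        rw [MonoidHom.comp_apply, succPerm_swap]
        exact hf _ _ fun h => hij (Fin.succ_injective _ h)
      rw [groupAverage_perm_succ]
      refine mul_mem (mul_mem h (Submonoid.subset_closure ?_)) h
      refine ⟨_, by positivity, ?_, _, hf 0 1 (by simp), rfl⟩
      rw [div_le_one (by positivity)]
      have : (0 : ℝ) ≤ n := n.cast_nonneg
      linarith

section

variable {ι : Type*} [Fintype ι] [DecidableEq ι]

/-- The projection of a power of `G` to the coordinates in `s`. -/
def restrictCoords (s : Finset ι) : (ι → G) →* (ι → G) where
  toFun y e := if e ∈ s then y e else 1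
  map_one' := by ext; simp
  map_mul' y y' := by
    ext e
    by_cases h : e ∈ s <;> simp [h]

/-- Independent coordinates multiply in the group algebra, so a family can be randomized one
coordinate at a time. -/
theorem groupAverage_restrictCoords_insert (f : (ι → G) →* Γ) {e : ι} {s : Finset ι}
    (he : e ∉ s) : groupAverage (f.comp (restrictCoords (insert e s)))
      = groupAverage (f.comp (MonoidHom.mulSingle (fun _ => G) e))
        * groupAverage (f.comp (restrictCoords s)) := by
  have key : ∀ (x : G) (y : ι → G), MonoidHom.mulSingle (fun _ => G) e x * restrictCoords s y
      = restrictCoords (insert e s) (Function.update y e x) := by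
    intro x y
    ext j
    by_cases hj : j = e
    · subst hj; simp [restrictCoords, he]
    · by_cases hs : j ∈ s <;> simp [restrictCoords, hj, hs]
  have h := sum_sum_update e fun y : ι → G =>
    MonoidAlgebra.of ℝ Γ (f (restrictCoords (insert e s) y))
  rw [Finset.sum_comm] at h
  simp only [← key, map_mul, ← Finset.mul_sum] at h
  rw [← Finset.sum_mul] at h
  simp only [groupAverage, smul_mul_smul_comm, MonoidHom.comp_apply]
  rw [h, ← Nat.cast_smul_eq_nsmul ℝ, smul_smul, mul_right_comm, inv_mul_cancel₀, one_mul]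
  exact_mod_cast Fintype.card_ne_zero

theorem groupAverage_pi_mem_closure {S : Set Γ} (f : (ι → G) →* Γ)
    (h : ∀ e, groupAverage (f.comp (MonoidHom.mulSingle (fun _ => G) e))
      ∈ Submonoid.closure (coinSet S)) : groupAverage f ∈ Submonoid.closure (coinSet S) := by
  have key : ∀ s : Finset ι, groupAverage (f.comp (restrictCoords s))
      ∈ Submonoid.closure (coinSet S) := by
    intro s
    induction s using Finset.induction_on with
    | empty =>
      rw [groupAverage_eq_one]
      · exact one_mem _
      · intro y
        have : restrictCoords (∅ : Finset ι) y = 1 := by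
          ext
          simp [restrictCoords]
        rw [MonoidHom.comp_apply, this, map_one]
    | insert e s he ih =>
      rw [groupAverage_restrictCoords_insert f he]
      exact mul_mem (h e) ih
  have e : ∀ y : ι → G, restrictCoords univ y = y := fun y => by
    ext
    simp [restrictCoords]
  have e' : f.comp (restrictCoords univ) = f := by
    ext y
    rw [MonoidHom.comp_apply, e]
  simpa only [e'] using key univ

/-- The uniform distribution on families of permutations. -/
theorem groupAverage_pi_perm_mem_closure (n : ℕ) :
    groupAverage (MonoidHom.id (ι → Perm (Fin n))) ∈ Submonoid.closure
      (coinSet {g : ι → Perm (Fin n) |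
        ∃ (e : ι) (i j : Fin n), i ≠ j ∧ g = Pi.mulSingle e (swap i j)}) :=
  groupAverage_pi_mem_closure _ fun e => groupAverage_perm_mem_closure n _ fun i j hij =>
    ⟨e, i, j, hij, rfl⟩

end

theorem weightedSum_groupAverage {W : Type*} [AddCommGroup W] [Module ℝ W] (h : G → W) :
    weightedSum (groupAverage (MonoidHom.id G)) 1 h = (Fintype.card G : ℝ)⁻¹ • ∑ x, h x := by
  classical
  have : ∀ x, (groupAverage (MonoidHom.id G)).coeff x = (Fintype.card G : ℝ)⁻¹ := by
    intro x
    simp [groupAverage, Finsupp.single_apply]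
  simp only [weightedSum, this, one_mul, Finset.smul_sum]

end UniformElement

/-! ### Splitting the characteristic polynomial of a covering -/

section LiftMatrices

open Finset Equiv Matrix

variable {V : Type*} [DecidableEq V] {d : ℕ}

/-- The part of the adjacency matrix of a covering that lies over an edge from `u` to `v`. -/
def liftBlock {r : ℕ} (u v : V) (σ : Perm (Fin r)) : Matrix (V × Fin r) (V × Fin r) ℝ :=
  Matrix.of fun p q => (if p.1 = u ∧ q.1 = v ∧ σ p.2 = q.2 then 1 else 0)
    + if p.1 = v ∧ q.1 = u ∧ σ q.2 = p.2 then 1 else 0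

/-- The adjacency matrix of an edge from `u` to `v`. -/
def linkBlock (u v : V) : Matrix V V ℝ :=
  Matrix.of fun x y => (if x = u ∧ y = v then 1 else 0) + if x = v ∧ y = u then 1 else 0

/-- The projection to the quotient by the functions that are constant on the fibres. -/
def quotMatrix (V : Type*) [DecidableEq V] (d : ℕ) : Matrix (V × Fin d) (V × Fin (d + 1)) ℝ :=
  Matrix.of fun p k => if p.1 = k.1 then quotVec d k.2 p.2 else 0

/-- The inclusion of the functions that are constant on the fibres. -/
def constMatrix (V : Type*) [DecidableEq V] (d : ℕ) : Matrix (V × Fin (d + 1)) V ℝ :=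
  Matrix.of fun k x => if k.1 = x then 1 else 0

/-- A function with sum zero is determined by its values off `0`, and the vectors `quotVec` give the
coefficients. -/
theorem sum_quotVec_mul (k : Fin (d + 1)) (f : Fin (d + 1) → ℝ) (hf : ∑ k, f k = 0) :
    ∑ j, quotVec d k j * f j.succ = f k := by
  refine Fin.cases ?_ (fun k => ?_) k
  · rw [Fin.sum_univ_succ] at hf
    simp only [quotVec_zero, neg_one_mul, Finset.sum_neg_distrib]
    linarith
  · simp [quotVec_succ, Pi.single_apply]

theorem quotVec_injective (d : ℕ) : Function.Injective (quotVec d) := by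
  intro a b
  refine Fin.cases ?_ (fun a => ?_) a <;> refine Fin.cases ?_ (fun b => ?_) b
  · simp
  · intro h
    have := congrFun h b
    rw [quotVec_zero, quotVec_succ, Pi.single_eq_same] at this
    norm_num at this
  · intro h
    have := congrFun h a
    rw [quotVec_zero, quotVec_succ, Pi.single_eq_same] at this
    norm_num at this
  · intro h
    rw [quotVec_succ, quotVec_succ] at h
    have := congrFun h a
    rw [Pi.single_eq_same, Pi.single_apply] at this
    by_contra hne
    rw [if_neg fun h => hne (congrArg Fin.succ h)] at this
    norm_num at this

variable [Fintype V]

/-- The columns of the transposed `quotMatrix` are the differences `e_{i+1} - e_0` in the fibres, a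
basis of the fibrewise sum zero functions. The lift preserves this space, and `edgeBlock` is its
matrix there. -/
theorem liftBlock_mul_quotMatrix (u v : V) (σ : Perm (Fin (d + 1))) :
    liftBlock u v σ * (quotMatrix V d)ᵀ = (quotMatrix V d)ᵀ * edgeBlock u v (permVectors σ) := by
  ext ⟨a, k⟩ ⟨b, i⟩
  have hsum : ∀ τ : Perm (Fin (d + 1)), ∑ k, quotVec d (τ k) i = 0 := by
    intro τ
    rw [Equiv.sum_comp τ fun k => quotVec d k i]
    simpa using congrFun (sum_quotVec d) i
  have e1 : (liftBlock u v σ * (quotMatrix V d)ᵀ) (a, k) (b, i)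
      = (if a = u ∧ b = v then quotVec d (σ k) i else 0)
        + if a = v ∧ b = u then quotVec d (σ⁻¹ k) i else 0 := by
    simp only [Matrix.mul_apply, Fintype.sum_prod_type, liftBlock, quotMatrix, of_apply,
      transpose_apply, mul_ite, mul_zero]
    rw [Finset.sum_eq_single b]
    · simp only [if_true, add_mul, Finset.sum_add_distrib, ite_mul, one_mul, zero_mul]
      congr 1
      · by_cases h : a = u ∧ b = v
        · simp [h]
        · have : ∀ l, ¬ (a = u ∧ b = v ∧ σ k = l) := fun l hl => h ⟨hl.1, hl.2.1⟩
          simp [h, this]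
      · by_cases h : a = v ∧ b = u
        · simp [h, ← Perm.eq_inv_iff_eq]
        · have : ∀ l, ¬ (a = v ∧ b = u ∧ σ l = k) := fun l hl => h ⟨hl.1, hl.2.1⟩
          simp [h, this]
    · intro c _ hc
      simp [hc.symm]
    · simp
  have e2 : ((quotMatrix V d)ᵀ * edgeBlock u v (permVectors σ)) (a, k) (b, i)
      = (if a = u ∧ b = v then ∑ j, quotVec d k j * quotVec d (σ j.succ) i else 0)
        + if a = v ∧ b = u then ∑ j, quotVec d k j * quotVec d (σ⁻¹ j.succ) i else 0 := by
    simp only [Matrix.mul_apply, Fintype.sum_prod_type, edgeBlock, quotMatrix, of_apply,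
      transpose_apply, permVectors, ite_mul, zero_mul]
    rw [Finset.sum_eq_single a]
    · simp only [if_true, mul_add, Finset.sum_add_distrib, mul_ite, mul_zero]
      congr 1
      · by_cases h : a = u ∧ b = v <;> simp [h]
      · by_cases h : a = v ∧ b = u <;> simp [h]
    · intro c _ hc
      simp [hc]
    · simp
  rw [e1, e2, sum_quotVec_mul k (fun k => quotVec d (σ k) i) (hsum σ),
    sum_quotVec_mul k (fun k => quotVec d (σ⁻¹ k) i) (hsum σ⁻¹)]

theorem liftBlock_mul_constMatrix (u v : V) (σ : Perm (Fin (d + 1))) :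
    liftBlock u v σ * constMatrix V d = constMatrix V d * linkBlock u v := by
  ext ⟨a, k⟩ b
  have e1 : (liftBlock u v σ * constMatrix V d) (a, k) b
      = (if a = u ∧ b = v then 1 else 0) + if a = v ∧ b = u then 1 else 0 := by
    simp only [Matrix.mul_apply, Fintype.sum_prod_type, liftBlock, constMatrix, of_apply,
      mul_ite, mul_zero, mul_one]
    rw [Finset.sum_eq_single b]
    · simp only [if_true, Finset.sum_add_distrib]
      congr 1
      · by_cases h : a = u ∧ b = v
        · simp [h]
        · have : ∀ l, ¬ (a = u ∧ b = v ∧ σ k = l) := fun l hl => h ⟨hl.1, hl.2.1⟩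
          simp [h, this]
      · by_cases h : a = v ∧ b = u
        · simp [h, ← Perm.eq_inv_iff_eq]
        · have : ∀ l, ¬ (a = v ∧ b = u ∧ σ l = k) := fun l hl => h ⟨hl.1, hl.2.1⟩
          simp [h, this]
    · intro c _ hc
      simp [hc]
    · simp
  rw [e1]
  simp [Matrix.mul_apply, constMatrix, linkBlock]

variable {ι : Type*} [Fintype ι]

/-- Functions constant on fibres and functions with sum zero on fibres are complementary invariant
subspaces; in a basis adapted to them the matrix is block diagonal. -/
theorem charpoly_sum_liftBlock (s t : ι → V) (σ : ι → Perm (Fin (d + 1))) :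
    (∑ e, liftBlock (s e) (t e) (σ e)).charpoly
      = (∑ e, linkBlock (s e) (t e)).charpoly
        * (∑ e, edgeBlock (s e) (t e) (permVectors (σ e))).charpoly := by
  let A := ∑ e, liftBlock (s e) (t e) (σ e)
  let B := ∑ e, linkBlock (s e) (t e)
  let C := ∑ e, edgeBlock (s e) (t e) (permVectors (σ e))
  have h1 : A * (quotMatrix V d)ᵀ = (quotMatrix V d)ᵀ * C := by
    simp only [A, C, Matrix.sum_mul, Matrix.mul_sum,
      liftBlock_mul_quotMatrix]
  have h2 : A * constMatrix V d = constMatrix V d * B := by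
    simp only [A, B, Matrix.sum_mul, Matrix.mul_sum, liftBlock_mul_constMatrix]
  let P : Matrix (V × Fin (d + 1)) (V ⊕ V × Fin d) ℝ :=
    Matrix.fromCols (constMatrix V d) (quotMatrix V d)ᵀ
  let D : Matrix (V ⊕ V × Fin d) (V ⊕ V × Fin d) ℝ := Matrix.fromBlocks B 0 0 C
  have hP : A * P = P * D := by
    simp only [P, D]
    rw [Matrix.mul_fromCols, h1, h2, Matrix.fromCols_mul_fromBlocks]
    simp
  -- The inverse of the change of basis: `L₁` takes the mean over a fibre, and `L₂` the deviations
  -- from the mean at the letters other than `0`.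
  let L₁ : Matrix V (V × Fin (d + 1)) ℝ :=
    Matrix.of fun x k => if k.1 = x then ((d : ℝ) + 1)⁻¹ else 0
  let L₂ : Matrix (V × Fin d) (V × Fin (d + 1)) ℝ :=
    Matrix.of fun p k => if k.1 = p.1 then (if k.2 = p.2.succ then 1 else 0) - ((d : ℝ) + 1)⁻¹
      else 0
  have hd : (d : ℝ) + 1 ≠ 0 := by positivity
  have hq : ∀ i, ∑ k, quotVec d k i = 0 := fun i => by
    simpa using congrFun (sum_quotVec d) i
  have hLP : Matrix.fromRows L₁ L₂ * P = 1 := by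
    simp only [P]
    rw [Matrix.fromRows_mul_fromCols, ← Matrix.fromBlocks_one]
    congr 1
    · ext x y
      simp only [Matrix.mul_apply, L₁, constMatrix, of_apply, Fintype.sum_prod_type, mul_ite,
        mul_one, mul_zero]
      rcases eq_or_ne x y with rfl | h
      · simp [hd]
      · simp [h, h.symm]
    · ext x ⟨y, i⟩
      simp only [Matrix.mul_apply, L₁, quotMatrix, of_apply, Fintype.sum_prod_type, ite_mul,
        zero_mul, mul_ite, mul_zero, transpose_apply]
      rcases eq_or_ne x y with rfl | h
      · simp [← Finset.mul_sum, hq]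
      · refine Finset.sum_eq_zero fun c _ => Finset.sum_eq_zero fun j _ => ?_
        rcases eq_or_ne c x with rfl | hc
        · simp [h.symm]
        · simp [hc]
    · ext ⟨x, i⟩ y
      simp only [Matrix.mul_apply, L₂, constMatrix, of_apply, Fintype.sum_prod_type, mul_ite,
        mul_one, mul_zero]
      rcases eq_or_ne x y with rfl | h
      · simp [hd]
      · simp [h.symm]
    · ext ⟨x, i⟩ ⟨y, j⟩
      simp only [Matrix.mul_apply, L₂, quotMatrix, of_apply, Fintype.sum_prod_type, ite_mul,
        zero_mul, mul_ite, mul_zero, transpose_apply]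
      rcases eq_or_ne x y with rfl | h
      · simp [sub_mul, ← Finset.mul_sum, hq, quotVec_succ, Matrix.one_apply, Pi.single_apply,
          eq_comm]
      · rw [Matrix.one_apply_ne (by simp [h])]
        refine Finset.sum_eq_zero fun c _ => Finset.sum_eq_zero fun j _ => ?_
        rcases eq_or_ne c x with rfl | hc
        · simp [h.symm]
        · simp [hc]
  have hcard : Fintype.card (V ⊕ V × Fin d) = Fintype.card (V × Fin (d + 1)) := by
    simp
    ring
  have hPL : P * Matrix.fromRows L₁ L₂ = 1 := (Matrix.mul_eq_one_comm_of_card_eq _ _ _ hcard).1 hLP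
  have hA : A = P * (D * Matrix.fromRows L₁ L₂) := by
    rw [← Matrix.mul_assoc, ← hP, Matrix.mul_assoc, hPL, Matrix.mul_one]
  have hchar : A.charpoly = D.charpoly := by
    have h := Matrix.charpoly_mul_comm' P (D * Matrix.fromRows L₁ L₂)
    rw [← hA, Matrix.mul_assoc, hLP, Matrix.mul_one, hcard] at h
    exact mul_left_cancel₀ (pow_ne_zero _ Polynomial.X_ne_zero) h
  exact hchar.trans (Matrix.charpoly_fromBlocks_zero₁₂ B 0 C)

end LiftMatrices

/-! ### Stability of averaged new characteristic polynomials -/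

section RandomLifts

open Finset Equiv Matrix Polynomial

variable {V : Type*} [DecidableEq V] {d : ℕ}

/-- The action of the permutations of a fibre. -/
def fiberPerm (V : Type*) [DecidableEq V] (F : Type*) (v : V) : Perm F →* Perm (V × F) where
  toFun σ := Perm.prodExtendRight v σ
  map_one' := by
    ext ⟨a, i⟩ : 1
    rcases eq_or_ne a v with rfl | h
    · simp [Perm.prodExtendRight_apply_eq]
    · simp [Perm.prodExtendRight_apply_ne _ h]
  map_mul' σ τ := by
    ext ⟨a, i⟩ : 1
    rcases eq_or_ne a v with rfl | h
    · simp [Perm.prodExtendRight_apply_eq]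
    · simp [Perm.prodExtendRight_apply_ne _ h]

theorem fiberPerm_apply_self {F : Type*} (v : V) (σ : Perm F) (i : F) :
    fiberPerm V F v σ (v, i) = (v, σ i) :=
  Perm.prodExtendRight_apply_eq v σ i

theorem fiberPerm_apply_of_ne {F : Type*} {v a : V} (h : a ≠ v) (σ : Perm F) (i : F) :
    fiberPerm V F v σ (a, i) = (a, i) :=
  Perm.prodExtendRight_apply_ne σ h i

theorem fiberPerm_swap {F : Type*} [DecidableEq F] (v : V) (i j : F) :
    fiberPerm V F v (swap i j) = swap (v, i) (v, j) := by
  ext ⟨a, k⟩ : 1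
  rcases eq_or_ne a v with rfl | h
  · rw [fiberPerm_apply_self]
    exact (Prod.mk_right_injective a).map_swap ..
  · rw [fiberPerm_apply_of_ne h, swap_apply_of_ne_of_ne (by simp [h]) (by simp [h])]

/-- As `u ≠ v`, relabeling the fibre over `v` moves only one end of each edge. So the choice of a
label is a permutation of rows and columns, as required for `expectedDet`. -/
theorem liftBlock_submatrix_fiberPerm {r : ℕ} {u v : V} (h : u ≠ v) (σ : Perm (Fin r)) :
    (liftBlock u v 1).submatrix ⇑(fiberPerm V (Fin r) v σ)⁻¹ ⇑(fiberPerm V (Fin r) v σ)⁻¹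
      = liftBlock u v σ := by
  rw [← map_inv]
  ext ⟨a, k⟩ ⟨b, l⟩
  by_cases ha : a = v <;> by_cases hb : b = v
  · subst ha; subst hb
    simp only [submatrix_apply, liftBlock, of_apply, fiberPerm_apply_self]
    simp [h.symm]
  · subst ha
    simp only [submatrix_apply, liftBlock, of_apply, fiberPerm_apply_self,
      fiberPerm_apply_of_ne hb]
    simp [h.symm, Equiv.eq_symm_apply]
  · subst hb
    simp only [submatrix_apply, liftBlock, of_apply, fiberPerm_apply_self,
      fiberPerm_apply_of_ne ha]
    simp [h.symm, Equiv.eq_symm_apply]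
  · simp only [submatrix_apply, liftBlock, of_apply, fiberPerm_apply_of_ne ha,
      fiberPerm_apply_of_ne hb]
    simp [ha, hb]

theorem liftBlock_isSymm {r : ℕ} (u v : V) (σ : Perm (Fin r)) : (liftBlock u v σ).IsSymm := by
  ext p q
  simp only [liftBlock, transpose_apply, of_apply]
  rw [add_comm]
  congr 1 <;> exact if_congr (by tauto) rfl rfl

variable [Fintype V]

theorem quotMatrix_vecMul_injective :
    Function.Injective fun w : V × Fin d → ℂ => w ᵥ* (quotMatrix V d).map (algebraMap ℝ ℂ) := by
  intro w w' h
  have key : ∀ (w : V × Fin d → ℂ) a j,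
      (w ᵥ* (quotMatrix V d).map (algebraMap ℝ ℂ)) (a, Fin.succ j) = w (a, j) := by
    intro w a j
    simp only [vecMul, dotProduct, map_apply, quotMatrix, of_apply, quotVec_succ,
      Fintype.sum_prod_type]
    rw [Finset.sum_eq_single a (fun b _ hb => by simp [hb]) (by simp),
      Finset.sum_eq_single j (fun i _ hi => by simp [hi]) (by simp)]
    simp
  ext ⟨a, j⟩
  rw [← key w a j, ← key w' a j]
  exact congrFun h _

theorem quotMatrix_mulVec_ne_zero (v : V) {i j : Fin (d + 1)} (hij : i ≠ j) :
    (quotMatrix V d).map (algebraMap ℝ ℂ)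
      *ᵥ (Pi.single (v, i) 1 - Pi.single (v, j) 1) ≠ 0 := by
  intro h
  refine hij (quotVec_injective d (funext fun k => ?_))
  have := congrFun h (v, k)
  rw [mulVec_sub, mulVec_single_one, mulVec_single_one] at this
  simp only [Pi.sub_apply, col_apply, map_apply, quotMatrix, of_apply, if_true, Pi.zero_apply,
    sub_eq_zero] at this
  simpa using this

variable {ι : Type*} [Fintype ι]

/-- The family of matrices, one for each edge, whose transforms add up to `z` minus
the adjacency matrix of a covering. -/
noncomputable def slotMatrix (r : ℕ) (s t : ι → V) (z : ℂ) (e : ι) :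
    Matrix (V × Fin r) (V × Fin r) ℂ :=
  (z / Fintype.card ι) • (1 : Matrix (V × Fin r) (V × Fin r) ℂ)
    - (liftBlock (s e) (t e) (1 : Perm (Fin r))).map (algebraMap ℝ ℂ)

theorem posIm_slotMatrix [Nonempty ι] (r : ℕ) (s t : ι → V) {z : ℂ} (hz : 0 < z.im) :
    PosIm (slotMatrix r s t z) := by
  have hc : (0 : ℝ) < Fintype.card ι := by exact_mod_cast Fintype.card_pos
  refine ⟨z.im / Fintype.card ι, by positivity, fun e w => ?_⟩
  have hH : ((liftBlock (s e) (t e) (1 : Perm (Fin r))).map (algebraMap ℝ ℂ)).IsHermitian := by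
    ext p q
    simp only [conjTranspose_apply, map_apply, Complex.coe_algebraMap, Complex.star_def,
      Complex.conj_ofReal]
    rw [(liftBlock_isSymm (s e) (t e) 1).apply]
  have h0 : (star w ⬝ᵥ ((liftBlock (s e) (t e) (1 : Perm (Fin r))).map (algebraMap ℝ ℂ)
      *ᵥ w)).im = 0 := hH.im_star_dotProduct_mulVec_self w
  have e1 : star w ⬝ᵥ w = ((∑ i, ‖w i‖ ^ 2 : ℝ) : ℂ) := by
    simp only [dotProduct, Pi.star_apply, Complex.star_def]
    push_cast
    exact Finset.sum_congr rfl fun i _ => Complex.conj_mul' _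
  rw [slotMatrix, sub_mulVec, dotProduct_sub, Complex.sub_im, h0, smul_mulVec, one_mulVec,
    dotProduct_smul, e1, smul_eq_mul, Complex.im_mul_ofReal, sub_zero, Complex.div_natCast_im]

/-- The action of the families of permutations on the matrices of the edges. -/
def slotAction (r : ℕ) (t : ι → V) (e : ι) : (ι → Perm (Fin r)) →* Perm (V × Fin r) :=
  (fiberPerm V (Fin r) (t e)).comp (Pi.evalMonoidHom _ e)

theorem sum_permAct_slotMatrix [Nonempty ι] (r : ℕ) {s t : ι → V} (hst : ∀ e, s e ≠ t e) (z : ℂ)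
    (σ : ι → Perm (Fin r)) : ∑ e, permAct (slotAction r t) σ (slotMatrix r s t z) e
      = z • (1 : Matrix (V × Fin r) (V × Fin r) ℂ)
        - (∑ e, liftBlock (s e) (t e) (σ e)).map (algebraMap ℝ ℂ) := by
  have h : ∀ e, permAct (slotAction r t) σ (slotMatrix r s t z) e
      = (z / Fintype.card ι) • (1 : Matrix (V × Fin r) (V × Fin r) ℂ)
        - (liftBlock (s e) (t e) (σ e)).map (algebraMap ℝ ℂ) := by
    intro e
    rw [← liftBlock_submatrix_fiberPerm (hst e)]
    change (z / Fintype.card ι) • (1 : Matrix (V × Fin r) (V × Fin r) ℂ).submatrix _ _ - _ = _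
    rw [submatrix_one_equiv]
    rfl
  have hc : (Fintype.card ι : ℂ) ≠ 0 := by exact_mod_cast Fintype.card_ne_zero
  have hm : (∑ e, liftBlock (s e) (t e) (σ e)).map (algebraMap ℝ ℂ)
      = ∑ e, (liftBlock (s e) (t e) (σ e)).map (algebraMap ℝ ℂ) := by
    exact map_sum (algebraMap ℝ ℂ).mapMatrix _ _
  rw [hm, Finset.sum_congr rfl fun e _ => h e, Finset.sum_sub_distrib, Finset.sum_const, card_univ,
    ← Nat.cast_smul_eq_nsmul ℂ, smul_smul, mul_div_cancel₀ _ hc]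

/-- From `A qᴴ = qᴴ B` follows `q (z - A) qᴴ = q qᴴ (z - B)`, so the compressed determinant is a
constant times the new characteristic polynomial. -/
theorem compressedDet_permAct_slotMatrix [Nonempty ι] {s t : ι → V} (hst : ∀ e, s e ≠ t e) (z : ℂ)
    (σ : ι → Perm (Fin (d + 1))) :
    compressedDet ((quotMatrix V d).map (algebraMap ℝ ℂ))
        (permAct (slotAction (d + 1) t) σ (slotMatrix (d + 1) s t z))
      = ((quotMatrix V d).map (algebraMap ℝ ℂ) * ((quotMatrix V d).map (algebraMap ℝ ℂ))ᴴ).det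
        * aeval z (∑ e, edgeBlock (s e) (t e) (permVectors (σ e))).charpoly := by
  set q := (quotMatrix V d).map (algebraMap ℝ ℂ) with hq
  have hqT : qᴴ = (quotMatrix V d)ᵀ.map (algebraMap ℝ ℂ) := by
    ext p k
    simp [hq]
  have h1 : (∑ e, liftBlock (s e) (t e) (σ e)) * (quotMatrix V d)ᵀ
      = (quotMatrix V d)ᵀ * ∑ e, edgeBlock (s e) (t e) (permVectors (σ e)) := by
    simp only [Matrix.sum_mul, Matrix.mul_sum, liftBlock_mul_quotMatrix]
  have h2 := congrArg (fun A => A.map (algebraMap ℝ ℂ)) h1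
  simp only [Matrix.map_mul, ← hqT] at h2
  have h3 : (z • (1 : Matrix (V × Fin (d + 1)) (V × Fin (d + 1)) ℂ)
        - (∑ e, liftBlock (s e) (t e) (σ e)).map (algebraMap ℝ ℂ)) * qᴴ
      = qᴴ * (scalar (V × Fin d) z
        - (∑ e, edgeBlock (s e) (t e) (permVectors (σ e))).map (algebraMap ℝ ℂ)) := by
    rw [Matrix.sub_mul, h2, Matrix.mul_sub, scalar_apply, ← smul_one_eq_diagonal, Matrix.smul_mul,
      Matrix.mul_smul, Matrix.one_mul, Matrix.mul_one]
  rw [compressedDet, sum_permAct_slotMatrix _ hst, Matrix.mul_assoc, h3, ← Matrix.mul_assoc,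
    det_mul, ← eval_charpoly, charpoly_map, eval_map_algebraMap]

variable [DecidableEq ι]

/-- A transposition in one coordinate acts on one slot only, by exchanging two points of a fibre,
and the difference of two such points is not killed by `quotMatrix`. So `expectedDet_ne_zero`
applies. -/
theorem aeval_weightedSum_charpoly_ne_zero [Nonempty ι] {s t : ι → V} (hst : ∀ e, s e ≠ t e)
    {m : MonoidAlgebra ℝ (ι → Perm (Fin (d + 1)))}
    (hm : m ∈ Submonoid.closure (coinSet {g : ι → Perm (Fin (d + 1)) |
      ∃ (e : ι) (i j : Fin (d + 1)), i ≠ j ∧ g = Pi.mulSingle e (swap i j)}))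
    (γ : ι → Perm (Fin (d + 1))) {z : ℂ} (hz : 0 < z.im) :
    aeval z (weightedSum m γ fun σ =>
      (∑ e, edgeBlock (s e) (t e) (permVectors (σ e))).charpoly) ≠ 0 := by
  have h := expectedDet_ne_zero (quotMatrix_vecMul_injective (V := V) (d := d))
    (θ := slotAction (d + 1) t) ?_ hm γ (posIm_slotMatrix (d + 1) s t hz)
  · unfold expectedDet weightedSum at h
    simp only [compressedDet_permAct_slotMatrix hst, ← mul_smul_comm, ← Finset.mul_sum] at h
    have h' := right_ne_zero_of_mul h
    rwa [weightedSum, map_sum, Finset.sum_congr rfl fun x _ => map_smul _ _ _]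
  · rintro g ⟨e, i, j, hij, rfl⟩
    refine ⟨e, (t e, i), (t e, j), ?_, fun e' he' => ?_, fun x => ?_⟩
    · simp [slotAction, fiberPerm_swap]
    · simp [slotAction, Pi.mulSingle_eq_of_ne he']
    · have e1 : ∀ i, (Pi.single (t e, i) 1 : V × Fin (d + 1) → ℂ) ∘ ⇑(slotAction (d + 1) t e x)⁻¹
          = Pi.single (t e, x e i) 1 := by
        intro i
        have : (t e, x e i) = slotAction (d + 1) t e x (t e, i) :=
          (fiberPerm_apply_self (t e) (x e) i).symm
        rw [this]
        ext p
        simp only [Function.comp_apply, Pi.single_apply, Perm.inv_eq_iff_eq]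
      rw [Pi.sub_comp, e1, e1]
      exact quotMatrix_mulVec_ne_zero _ ((x e).injective.ne hij)

/-- If the expected characteristic polynomial of the new part of a random covering is positive
beyond `ρ`, so is the one of some covering. -/
theorem exists_perm_eval_charpoly_pos {s t : ι → V} (hst : ∀ e, s e ≠ t e) {ρ : ℝ}
    (h : ∀ x, ρ < x → 0 < (Fintype.card (ι → Perm (Fin (d + 1))) : ℝ)⁻¹ *
      ∑ σ : ι → Perm (Fin (d + 1)), (Matrix.scalar (V × Fin d) x
        - ∑ e, edgeBlock (s e) (t e) (permVectors (σ e))).det) :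
    ∃ σ : ι → Perm (Fin (d + 1)), ∀ x, ρ < x →
      0 < (∑ e, edgeBlock (s e) (t e) (permVectors (σ e))).charpoly.eval x := by
  -- Without edges there are no slots among which `z` could be divided.
  rcases isEmpty_or_nonempty ι with hι | hι
  · refine ⟨fun e => 1, fun x hx => ?_⟩
    have h' := h x hx
    simpa [← eval_charpoly] using h'
  · refine exists_eval_pos_of_weightedSum (n := Fintype.card (V × Fin d))
      (fun σ => charpoly_monic _) (fun σ => charpoly_natDegree_eq_dim _)
      (fun m hm γ z hz => aeval_weightedSum_charpoly_ne_zero hst hm γ hz)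
      (groupAverage_pi_perm_mem_closure (ι := ι) (d + 1)) 1 fun x hx => ?_
    rw [weightedSum_groupAverage, eval_smul, eval_finsetSum, smul_eq_mul]
    simpa only [eval_charpoly] using h x hx

end RandomLifts

/-! ### Superharmonic functions beyond the spectral radius -/

section SpectralRadius

open Filter Topology Finset

variable {W : Type*}

namespace SimpleGraph

open Classical in
/-- The number of walks of length `n` from `o`. -/
noncomputable def numWalks (T : SimpleGraph W) (o : W) : ℕ → W → ℝ
  | 0, w => (Pi.single o 1 : W → ℝ) w
  | n + 1, w => ∑ᶠ u ∈ T.neighborSet w, T.numWalks o n u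

theorem numWalks_nonneg (T : SimpleGraph W) (o : W) (n : ℕ) (w : W) : 0 ≤ T.numWalks o n w := by
  classical
  induction n generalizing w with
  | zero =>
    rw [numWalks, Pi.single_apply]
    split_ifs <;> norm_num
  | succ n ih => exact finsum_nonneg fun u => finsum_nonneg fun _ => ih u

theorem HasBoundedDegree.finite {T : SimpleGraph W} (hT : T.HasBoundedDegree) (w : W) :
    (T.neighborSet w).Finite :=
  (hT.choose_spec w).1

open Classical in
theorem adjOperator_pow_single (T : SimpleGraph W) (hT : T.HasBoundedDegree) (o : W) (n : ℕ)
    (w : W) : ((T.adjOperator hT ^ n) (lp.single 2 o (1 : ℂ)) : W → ℂ) w = T.numWalks o n w := by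
  induction n generalizing w with
  | zero =>
    change (Pi.single o (1 : ℂ) : W → ℂ) w = _
    rw [numWalks, Pi.single_apply, Pi.single_apply]
    split_ifs <;> simp
  | succ n ih =>
    rw [pow_succ']
    change T.adjSum _ w = _
    rw [adjSum, numWalks, finsum_mem_eq_finite_toFinset_sum _ (hT.finite w),
      finsum_mem_eq_finite_toFinset_sum _ (hT.finite w), Complex.ofReal_sum]
    exact Finset.sum_congr rfl fun u _ => ih u

theorem adjSpectralRadius_nonneg (T : SimpleGraph W) (hT : T.HasBoundedDegree) :
    0 ≤ T.adjSpectralRadius hT :=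
  ENNReal.toReal_nonneg

/-- Walk counts are entries of powers of the adjacency operator, whose norms are controlled by
Gelfand's formula. -/
theorem eventually_numWalks_le (T : SimpleGraph W) (hT : T.HasBoundedDegree) (o : W) {y : ℝ}
    (hy : T.adjSpectralRadius hT < y) : ∀ᶠ n in atTop, ∀ w, T.numWalks o n w ≤ y ^ n := by
  classical
  have : Nontrivial (lp (fun _ : W => ℂ) 2) := by
    refine ⟨lp.single 2 o 1, 0, fun h => ?_⟩
    have := congrArg norm h
    rw [lp.norm_single (by norm_num), norm_one, norm_zero] at this
    exact one_ne_zero this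
  have hne : spectralRadius ℂ (T.adjOperator hT) ≠ ⊤ :=
    ((spectrum.spectralRadius_le_nnnorm _).trans_lt ENNReal.coe_lt_top).ne
  have hy0 : 0 < y := (T.adjSpectralRadius_nonneg hT).trans_lt hy
  have hlt : spectralRadius ℂ (T.adjOperator hT) < ENNReal.ofReal y :=
    (ENNReal.lt_ofReal_iff_toReal_lt hne).2 hy
  filter_upwards [(spectrum.pow_norm_pow_one_div_tendsto_nhds_spectralRadius
    (T.adjOperator hT)).eventually (gt_mem_nhds hlt), eventually_ne_atTop 0] with n hn hn0 w
  rw [ENNReal.ofReal_lt_ofReal_iff hy0, one_div] at hn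
  have h1 : ‖T.adjOperator hT ^ n‖ ≤ y ^ n := by
    rw [← Real.rpow_inv_natCast_pow (norm_nonneg (T.adjOperator hT ^ n)) hn0]
    gcongr
  have h2 : ‖((T.adjOperator hT ^ n) (lp.single 2 o (1 : ℂ)) : W → ℂ) w‖ ≤ y ^ n := by
    refine (lp.norm_apply_le_norm (by norm_num) _ w).trans ?_
    refine (ContinuousLinearMap.le_opNorm _ _).trans ?_
    rw [lp.norm_single (by norm_num), norm_one, mul_one]
    exact h1
  rw [adjOperator_pow_single, Complex.norm_real] at h2
  exact (le_abs_self _).trans h2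

/-- Beyond the spectral radius there are nonnegative superharmonic functions. -/
theorem exists_superharmonic (T : SimpleGraph W) (hT : T.HasBoundedDegree) (o : W) {x : ℝ}
    (hx : T.adjSpectralRadius hT < x) : ∃ g : W → ℝ, (∀ w, 0 ≤ g w) ∧ 0 < g o ∧
      ∀ w, ∑ᶠ u ∈ T.neighborSet w, g u ≤ x * g w := by
  classical
  obtain ⟨y, hy, hyx⟩ := exists_between hx
  have hy0 : 0 < y := (T.adjSpectralRadius_nonneg hT).trans_lt hy
  have hx0 : 0 < x := hy0.trans hyx
  have hsum : ∀ w, Summable fun n => x⁻¹ ^ (n + 1) * T.numWalks o n w := by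
    intro w
    have hgeo : Summable fun n : ℕ => x⁻¹ * (x⁻¹ * y) ^ n :=
      (summable_geometric_of_lt_one (by positivity) (by
        rw [inv_mul_lt_one₀ hx0]; exact hyx)).mul_left _
    refine Summable.of_norm_bounded_eventually_nat hgeo ?_
    filter_upwards [T.eventually_numWalks_le hT o hy] with n hn
    rw [Real.norm_of_nonneg (mul_nonneg (by positivity) (T.numWalks_nonneg o n w)), mul_pow,
      pow_succ', mul_assoc]
    have := hn w
    gcongr
  have hnn : ∀ w n, 0 ≤ x⁻¹ ^ (n + 1) * T.numWalks o n w := fun w n =>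
    mul_nonneg (by positivity) (T.numWalks_nonneg o n w)
  -- The Green function of the walk from `o`: applying the adjacency operator shifts the series, and
  -- the result is `x g` minus the unit mass at `o`.
  refine ⟨fun w => ∑' n, x⁻¹ ^ (n + 1) * T.numWalks o n w, fun w => tsum_nonneg (hnn w), ?_,
    fun w => ?_⟩
  · refine (hsum o).tsum_pos (hnn o) 0 ?_
    simpa [numWalks] using hx0
  · have h1 : ∑ᶠ u ∈ T.neighborSet w, ∑' n, x⁻¹ ^ (n + 1) * T.numWalks o n u
        = ∑' n, x⁻¹ ^ (n + 1) * T.numWalks o (n + 1) w := by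
      rw [finsum_mem_eq_finite_toFinset_sum _ (hT.finite w), ← Summable.tsum_finsetSum fun u _ =>
        hsum u]
      refine tsum_congr fun n => ?_
      rw [numWalks, finsum_mem_eq_finite_toFinset_sum _ (hT.finite w), Finset.mul_sum]
    have h2 : ∀ n, x * (x⁻¹ ^ (n + 1) * T.numWalks o n w) = x⁻¹ ^ n * T.numWalks o n w := by
      intro n
      rw [pow_succ']
      field_simp
    have hs2 : Summable fun n => x⁻¹ ^ n * T.numWalks o n w := by
      simpa only [h2] using (hsum w).mul_left x
    rw [h1, ← tsum_mul_left]
    simp only [h2]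
    rw [hs2.tsum_eq_zero_add, pow_zero, one_mul]
    exact le_add_of_nonneg_left (T.numWalks_nonneg o 0 w)

end SimpleGraph

end SpectralRadius

/-! ### Edge weights from the universal covering tree -/

section UniversalCover

namespace Graph

variable {α β : Type*} {G : Graph α β}

/-- The last vertex of a walk from `v₀`. -/
def walkEnd (v₀ : α) (w : List G.OrientedEdge) : α := w.foldl (fun _ d => d.snd) v₀

theorem walkEnd_append_singleton (v₀ : α) (w : List G.OrientedEdge) (d : G.OrientedEdge) :
    walkEnd v₀ (w ++ [d]) = d.snd := by
  simp [walkEnd]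

theorem isNonBacktrackingFrom_append_singleton {v₀ : α} {w : List G.OrientedEdge}
    {d : G.OrientedEdge} : G.IsNonBacktrackingFrom v₀ (w ++ [d]) ↔
      G.IsNonBacktrackingFrom v₀ w ∧ walkEnd v₀ w = d.fst ∧ w.getLast? ≠ some d.reverse := by
  rcases List.eq_nil_or_concat w with rfl | ⟨w', d', rfl⟩
  · simp [IsNonBacktrackingFrom, walkEnd, eq_comm]
  · rw [List.concat_eq_append, walkEnd_append_singleton]
    unfold IsNonBacktrackingFrom
    rw [List.isChain_append (l₁ := w' ++ [d'])]
    have h1 : (w' ++ [d'] ++ [d]).head? = (w' ++ [d']).head? := by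
      rcases w' with - | ⟨a, w'⟩ <;> simp
    have h2 : d ≠ d'.reverse ↔ d' ≠ d.reverse :=
      not_congr ⟨fun h => by rw [h]; rfl, fun h => by rw [h]; rfl⟩
    rw [h1]
    simp only [List.getLast?_append, List.getLast?_singleton, Option.some_or, Option.mem_def,
      Option.some.injEq, forall_eq', List.head?_cons, List.isChain_singleton, true_and, ne_eq, h2]
    tauto

open Classical in
/-- The walk `w`, followed by the edge `d` and reduced. -/
noncomputable def walkStep (v₀ : α) (w : List G.OrientedEdge) (d : G.OrientedEdge) :
    List G.OrientedEdge :=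
  if w.getLast? = some d.reverse then w.dropLast
  else if walkEnd v₀ w = d.fst then w ++ [d] else w

theorem walkStep_append_reverse (v₀ : α) (w : List G.OrientedEdge) (d : G.OrientedEdge) :
    walkStep v₀ (w ++ [d.reverse]) d = w := by
  simp [walkStep]

theorem walkStep_of_ne {v₀ : α} {w : List G.OrientedEdge} {d : G.OrientedEdge}
    (hd : walkEnd v₀ w = d.fst) (h : w.getLast? ≠ some d.reverse) :
    walkStep v₀ w d = w ++ [d] := by
  simp [walkStep, hd, h]

theorem walkStep_cases {v₀ : α} {w : List G.OrientedEdge} {d : G.OrientedEdge}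
    (hd : walkEnd v₀ w = d.fst) :
    (w.getLast? ≠ some d.reverse ∧ walkStep v₀ w d = w ++ [d]) ∨
      w = walkStep v₀ w d ++ [d.reverse] := by
  by_cases h : w.getLast? = some d.reverse
  · right
    rw [walkStep, if_pos h]
    exact (List.dropLast_append_getLast? _ h).symm
  · exact Or.inl ⟨h, walkStep_of_ne hd h⟩

theorem IsNonBacktrackingFrom.walkStep {v₀ : α} {w : List G.OrientedEdge}
    (hw : G.IsNonBacktrackingFrom v₀ w) (d : G.OrientedEdge) :
    G.IsNonBacktrackingFrom v₀ (walkStep v₀ w d) := by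
  by_cases hd : walkEnd v₀ w = d.fst
  · rcases walkStep_cases hd with ⟨h1, h2⟩ | h
    · rw [h2]
      exact isNonBacktrackingFrom_append_singleton.2 ⟨hw, hd, h1⟩
    · rw [h] at hw
      exact (isNonBacktrackingFrom_append_singleton.1 hw).1
  · unfold Graph.walkStep
    rw [if_neg hd]
    split_ifs with h
    · have h' := (List.dropLast_append_getLast? _ h).symm
      rw [h'] at hw
      exact (isNonBacktrackingFrom_append_singleton.1 hw).1
    · exact hw

theorem walkEnd_walkStep {v₀ : α} {w : List G.OrientedEdge} (hw : G.IsNonBacktrackingFrom v₀ w)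
    {d : G.OrientedEdge} (hd : walkEnd v₀ w = d.fst) : walkEnd v₀ (walkStep v₀ w d) = d.snd := by
  rcases walkStep_cases hd with ⟨h1, h2⟩ | h
  · rw [h2, walkEnd_append_singleton]
  · rw [h] at hw
    exact (isNonBacktrackingFrom_append_singleton.1 hw).2.1

theorem walkStep_walkStep_reverse {v₀ : α} {w : List G.OrientedEdge}
    (hw : G.IsNonBacktrackingFrom v₀ w) {d : G.OrientedEdge} (hd : walkEnd v₀ w = d.fst) :
    walkStep v₀ (walkStep v₀ w d) d.reverse = w := by
  rcases walkStep_cases hd with ⟨h1, h2⟩ | h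
  · rw [h2]
    exact walkStep_append_reverse v₀ w d.reverse
  · have hw' := hw
    rw [h] at hw'
    obtain ⟨-, h1, h2⟩ := isNonBacktrackingFrom_append_singleton.1 hw'
    conv_rhs => rw [h]
    exact walkStep_of_ne h1 h2

theorem walkStep_injOn (v₀ : α) (w : List G.OrientedEdge) :
    Set.InjOn (walkStep v₀ w) {d | d.fst = walkEnd v₀ w} := by
  intro d hd d' hd' h
  rcases walkStep_cases (Eq.symm hd) with ⟨h1, h2⟩ | h1 <;>
    rcases walkStep_cases (Eq.symm hd') with ⟨h3, h4⟩ | h3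
  · rw [h2, h4] at h
    simpa using h
  · rw [h2] at h
    rw [← h] at h3
    have := congrArg List.length h3
    simp at this
  · rw [h4] at h
    rw [h] at h1
    have := congrArg List.length h1
    simp at this
  · rw [← h] at h3
    have := h1.symm.trans h3
    have h5 : d.reverse = d'.reverse := by simpa using this
    exact congrArg OrientedEdge.reverse h5

theorem IsConnected.exists_walk (hG : G.IsConnected) (v₀ : V(G)) {v : α} (hv : v ∈ V(G)) :
    ∃ w, G.IsNonBacktrackingFrom v₀ w ∧ walkEnd (v₀ : α) w = v := by
  have h := hG.2 v₀ v₀.2 v hv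
  clear hv
  induction h with
  | refl => exact ⟨[], by simp [IsNonBacktrackingFrom], rfl⟩
  | tail _ hadj ih =>
    obtain ⟨w, hw, hwe⟩ := ih
    obtain ⟨e, he⟩ := hadj
    exact ⟨walkStep v₀ w ⟨e, _, _, he⟩, hw.walkStep _,
      walkEnd_walkStep (d := ⟨e, _, _, he⟩) hw hwe⟩

/-- Vertices of the universal cover. -/
abbrev CoverVertex (G : Graph α β) (v₀ : α) : Type _ :=
  {w : List G.OrientedEdge // G.IsNonBacktrackingFrom v₀ w}

/-- The neighbour of a vertex of the universal cover in the direction of an edge. -/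
noncomputable def coverStep {v₀ : α} (w : G.CoverVertex v₀) (d : G.OrientedEdge) :
    G.CoverVertex v₀ :=
  ⟨walkStep v₀ w.1 d, w.2.walkStep d⟩

theorem universalCover_adj_coverStep (v₀ : V(G)) (w : G.CoverVertex v₀) {d : G.OrientedEdge}
    (hd : walkEnd (v₀ : α) w.1 = d.fst) : (G.universalCover v₀).Adj w (coverStep w d) := by
  rcases walkStep_cases hd with ⟨-, h⟩ | h
  · exact ⟨d, Or.inl h⟩
  · exact ⟨d.reverse, Or.inr h⟩

/-- Different oriented edges at the end of a walk lead to different neighbours in the tree. As `g`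
is nonnegative, an inequality is enough. -/
theorem sum_coverStep_le [Finite V(G)] [Finite E(G)] [Fintype G.OrientedEdge] [DecidableEq α]
    (v₀ : V(G)) {g : G.CoverVertex v₀ → ℝ} (hg : ∀ w, 0 ≤ g w) (w : G.CoverVertex v₀) :
    ∑ d with d.fst = walkEnd (v₀ : α) w.1, g (coverStep w d)
      ≤ ∑ᶠ u ∈ (G.universalCover v₀).neighborSet w, g u := by
  classical
  have hinj : Set.InjOn (coverStep w)
      ((Finset.univ.filter fun d : G.OrientedEdge => d.fst = walkEnd (v₀ : α) w.1 : Finset _) :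
        Set _) := by
    intro d hd d' hd' h
    exact walkStep_injOn (v₀ : α) w.1 (by simpa using hd) (by simpa using hd')
      (congrArg Subtype.val h)
  rw [finsum_mem_eq_finite_toFinset_sum _ ((G.universalCover_hasBoundedDegree v₀).finite w),
    ← Finset.sum_image hinj]
  refine Finset.sum_le_sum_of_subset_of_nonneg (fun u hu => ?_) fun u _ _ => hg u
  obtain ⟨d, hd, rfl⟩ := Finset.mem_image.1 hu
  rw [Set.Finite.mem_toFinset]
  exact universalCover_adj_coverStep v₀ w (Finset.mem_filter.1 hd).2.symm

/-- Take a positive superharmonic `g` on the tree and let `h d` be the infimum of `g w' / g w` over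
all lifts `w → w'` of `d`. Superharmonicity bounds the sum of all ratios at a vertex of the tree. At
`w'` one of these ratios is `g w / g w'`, belonging to the reversed edge, and it bounds the inverse
of `h d`. Taking infima makes the weights depend only on the edges of `G`. -/
theorem exists_edge_weights [Finite V(G)] [Finite E(G)] [Fintype G.OrientedEdge] [DecidableEq α]
    [DecidableEq G.OrientedEdge] (hG : G.IsConnected) (v₀ : V(G)) {x : ℝ}
    (hx : G.coverSpectralRadius v₀ < x) : ∃ h : G.OrientedEdge → ℝ, (∀ d, 0 < h d) ∧
      (∀ d, (h d)⁻¹ + ∑ d' with d'.fst = d.snd ∧ d' ≠ d.reverse, h d' ≤ x) ∧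
      ∀ v ∈ V(G), ∑ d with d.fst = v, h d < x := by
  -- The room between `y` and `x` makes the inequality at the vertices strict.
  obtain ⟨y, hy, hyx⟩ := exists_between hx
  have hy0 : 0 < y := (SimpleGraph.adjSpectralRadius_nonneg _ _).trans_lt hy
  obtain ⟨g, hg0, hgo, hg⟩ := (G.universalCover v₀).exists_superharmonic
    (G.universalCover_hasBoundedDegree v₀) ⟨[], by simp [IsNonBacktrackingFrom]⟩ hy
  have hsum : ∀ w : G.CoverVertex v₀,
      ∑ d with d.fst = walkEnd (v₀ : α) w.1, g (coverStep w d) ≤ y * g w :=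
    fun w => (sum_coverStep_le v₀ hg0 w).trans (hg w)
  have hle : ∀ (w : G.CoverVertex v₀) (d : G.OrientedEdge), walkEnd (v₀ : α) w.1 = d.fst →
      g (coverStep w d) ≤ y * g w := by
    intro w d hd
    refine le_trans ?_ (hsum w)
    exact Finset.single_le_sum (f := fun d => g (coverStep w d)) (fun d _ => hg0 _)
      (Finset.mem_filter.2 ⟨Finset.mem_univ d, hd.symm⟩)
  -- Every walk has the walk without its last step as a neighbour, so positivity spreads from the
  -- root.
  have hpos : ∀ w : G.CoverVertex v₀, 0 < g w := by
    rintro ⟨w, hw⟩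
    induction w using List.reverseRecOn with
    | nil => exact hgo
    | append_singleton w d ih =>
      have h := hle ⟨w ++ [d], hw⟩ d.reverse (walkEnd_append_singleton _ _ _)
      have e : coverStep ⟨w ++ [d], hw⟩ d.reverse
          = ⟨w, (isNonBacktrackingFrom_append_singleton.1 hw).1⟩ :=
        Subtype.ext (walkStep_append_reverse _ w d.reverse)
      rw [e] at h
      exact pos_of_mul_pos_right ((ih _).trans_le h) hy0.le
  have hback : ∀ (w : G.CoverVertex v₀) (d : G.OrientedEdge), walkEnd (v₀ : α) w.1 = d.fst →
      coverStep (coverStep w d) d.reverse = w :=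
    fun w d hd => Subtype.ext (walkStep_walkStep_reverse w.2 hd)
  have hend : ∀ (w : G.CoverVertex v₀) (d : G.OrientedEdge), walkEnd (v₀ : α) w.1 = d.fst →
      walkEnd (v₀ : α) (coverStep w d).1 = d.snd := fun w d hd => walkEnd_walkStep w.2 hd
  let h : G.OrientedEdge → ℝ := fun d =>
    ⨅ w : {w : G.CoverVertex v₀ // walkEnd (v₀ : α) w.1 = d.fst}, g (coverStep w.1 d) / g w.1
  have hne : ∀ d : G.OrientedEdge,
      Nonempty {w : G.CoverVertex v₀ // walkEnd (v₀ : α) w.1 = d.fst} := by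
    intro d
    obtain ⟨w, hw, hwe⟩ := hG.exists_walk v₀ d.isLink.left_mem
    exact ⟨⟨⟨w, hw⟩, hwe⟩⟩
  have hbdd : ∀ d : G.OrientedEdge, BddBelow (Set.range
      fun w : {w : G.CoverVertex v₀ // walkEnd (v₀ : α) w.1 = d.fst} =>
        g (coverStep w.1 d) / g w.1) := by
    intro d
    refine ⟨0, ?_⟩
    rintro _ ⟨w, rfl⟩
    exact div_nonneg (hg0 _) (hg0 _)
  have hh : ∀ (w : G.CoverVertex v₀) (d : G.OrientedEdge), walkEnd (v₀ : α) w.1 = d.fst →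
      h d ≤ g (coverStep w d) / g w := fun w d hd => ciInf_le (hbdd d) ⟨w, hd⟩
  have hhpos : ∀ d, 0 < h d := by
    intro d
    have := hne d
    refine (inv_pos.2 hy0).trans_le (le_ciInf fun w => ?_)
    rw [le_div_iff₀ (hpos _), inv_mul_le_iff₀ hy0]
    have := hle (coverStep w.1 d) d.reverse (hend w.1 d w.2)
    rwa [hback w.1 d w.2] at this
  have hhsum : ∀ (w : G.CoverVertex v₀) (s : Finset G.OrientedEdge),
      (∀ d ∈ s, d.fst = walkEnd (v₀ : α) w.1) → ∑ d ∈ s, h d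
        ≤ (∑ d ∈ s, g (coverStep w d)) / g w := by
    intro w s hs
    rw [Finset.sum_div]
    exact Finset.sum_le_sum fun d hd => hh w d (hs d hd).symm
  refine ⟨h, hhpos, fun d => ?_, fun v hv => ?_⟩
  · let c := y - ∑ d' with d'.fst = d.snd ∧ d' ≠ d.reverse, h d'
    have hc : ∀ w : G.CoverVertex v₀, walkEnd (v₀ : α) w.1 = d.fst →
        g w / g (coverStep w d) ≤ c := by
      intro w hw
      have h1 := hhsum (coverStep w d) (Finset.univ.filter fun d' =>
        d'.fst = d.snd ∧ d' ≠ d.reverse) (fun d' hd' => by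
          rw [hend w d hw]
          exact (Finset.mem_filter.1 hd').2.1)
      have h2 := hsum (coverStep w d)
      have hmem : d.reverse ∈ Finset.univ.filter fun d' : G.OrientedEdge => d'.fst = d.snd :=
        Finset.mem_filter.2 ⟨Finset.mem_univ _, rfl⟩
      rw [hend w d hw, ← Finset.add_sum_erase _ _ hmem, hback w d hw] at h2
      have h3 : (Finset.univ.filter fun d' : G.OrientedEdge => d'.fst = d.snd).erase d.reverse
          = Finset.univ.filter fun d' : G.OrientedEdge => d'.fst = d.snd ∧ d' ≠ d.reverse := by
        ext d'
        simp [and_comm]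
      rw [h3] at h2
      have hp := hpos (coverStep w d)
      rw [le_div_iff₀ hp] at h1
      rw [div_le_iff₀ hp]
      simp only [c, sub_mul]
      linarith
    obtain ⟨w₀⟩ := hne d
    have hc0 : 0 < c := (div_pos (hpos _) (hpos _)).trans_le (hc w₀.1 w₀.2)
    have h1 : c⁻¹ ≤ h d := by
      have := hne d
      refine le_ciInf fun w => ?_
      rw [inv_le_comm₀ hc0 (div_pos (hpos _) (hpos _)), inv_div]
      exact hc w.1 w.2
    have h2 : (h d)⁻¹ ≤ c := inv_le_of_inv_le₀ hc0 h1
    simp only [c] at h2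
    linarith
  · obtain ⟨w, hw, rfl⟩ := hG.exists_walk v₀ hv
    refine lt_of_le_of_lt ((hhsum ⟨w, hw⟩ _ fun d hd => (Finset.mem_filter.1 hd).2).trans ?_) hyx
    rw [div_le_iff₀ (hpos _)]
    exact hsum ⟨w, hw⟩

end Graph

end UniversalCover

/-! ### Translation from multigraphs to families of edges -/

section Coverings

open Finset Equiv

namespace Graph

variable {α β : Type*} {G : Graph α β}

/-- A choice of an orientation of each edge. -/
noncomputable def orient (G : Graph α β) (e : E(G)) : G.OrientedEdge :=
  ⟨e, _, _, (G.exists_isLink_of_mem_edgeSet e.2).choose_spec.choose_spec⟩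

/-- The first vertex of an edge in the chosen orientation. -/
noncomputable def orientFst (G : Graph α β) (e : E(G)) : V(G) :=
  ⟨(G.orient e).fst, (G.orient e).isLink.left_mem⟩

/-- The second vertex of an edge in the chosen orientation. -/
noncomputable def orientSnd (G : Graph α β) (e : E(G)) : V(G) :=
  ⟨(G.orient e).snd, (G.orient e).isLink.right_mem⟩

theorem isLink_orient (e : E(G)) : G.IsLink e (G.orientFst e) (G.orientSnd e) :=
  (G.orient e).isLink

theorem orientFst_ne_orientSnd [G.Loopless] (e : E(G)) : G.orientFst e ≠ G.orientSnd e :=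
  fun h => (isLink_orient e).ne (congrArg Subtype.val h)

/-- Oriented edges are edges with one of two orientations. -/
noncomputable def orientedEdgeEquiv (G : Graph α β) [G.Loopless] :
    E(G) × Bool ≃ G.OrientedEdge :=
  Equiv.ofBijective (fun δ => bif δ.2 then G.orient δ.1 else (G.orient δ.1).reverse) (by
    constructor
    · rintro ⟨e, b⟩ ⟨e', b'⟩ h
      have he : e = e' := by
        apply Subtype.ext
        have := congrArg OrientedEdge.edge h
        cases b <;> cases b' <;> exact this
      subst he
      have hne := (G.orient e).isLink.ne
      cases b <;> cases b'
      · rfl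
      · exact absurd (congrArg OrientedEdge.snd h) hne
      · exact absurd (congrArg OrientedEdge.fst h) hne
      · rfl
    · rintro ⟨e, x, y, h⟩
      rcases (isLink_orient ⟨e, h.edge_mem⟩).eq_and_eq_or_eq_and_eq h with ⟨h1, h2⟩ | ⟨h1, h2⟩
      · exact ⟨(⟨e, h.edge_mem⟩, true), OrientedEdge.ext rfl h1 h2⟩
      · exact ⟨(⟨e, h.edge_mem⟩, false), OrientedEdge.ext rfl h2 h1⟩)

theorem orientedEdgeEquiv_not [G.Loopless] (δ : E(G) × Bool) :
    G.orientedEdgeEquiv (δ.1, !δ.2) = (G.orientedEdgeEquiv δ).reverse := by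
  rcases δ with ⟨e, - | -⟩ <;> rfl

theorem orientedEdgeEquiv_fst [G.Loopless] (δ : E(G) × Bool) :
    (G.orientedEdgeEquiv δ).fst = dartStart G.orientFst G.orientSnd δ := by
  rcases δ with ⟨e, - | -⟩ <;> rfl

theorem orientedEdgeEquiv_snd [G.Loopless] (δ : E(G) × Bool) :
    (G.orientedEdgeEquiv δ).snd = dartEnd G.orientFst G.orientSnd δ := by
  rcases δ with ⟨e, - | -⟩ <;> rfl

/-- The labeling with given permutations at the chosen orientations. -/
noncomputable def labelingOfPerms (G : Graph α β) [G.Loopless] {r : ℕ} (σ : E(G) → Perm (Fin r)) :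
    G.PermLabeling r where
  perm d := bif (G.orientedEdgeEquiv.symm d).2 then σ (G.orientedEdgeEquiv.symm d).1
    else (σ (G.orientedEdgeEquiv.symm d).1)⁻¹
  perm_reverse d := by
    obtain ⟨δ, rfl⟩ := G.orientedEdgeEquiv.surjective d
    rw [← orientedEdgeEquiv_not, symm_apply_apply, symm_apply_apply]
    rcases δ with ⟨e, - | -⟩ <;> simp

theorem labelingOfPerms_orient [G.Loopless] {r : ℕ} (σ : E(G) → Perm (Fin r)) (e : E(G)) :
    (G.labelingOfPerms σ).perm (G.orient e) = σ e := by
  have h : G.orientedEdgeEquiv.symm (G.orient e) = (e, true) :=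
    (symm_apply_eq _).2 rfl
  simp [labelingOfPerms, h]

theorem ncard_setOf_edge [Fintype E(G)] (P : β → Prop) [DecidablePred P]
    (hP : ∀ e, P e → e ∈ E(G)) : ({e | P e}.ncard : ℝ) = ∑ e : E(G), if P e then 1 else 0 := by
  have h : {e | P e}
      = Subtype.val '' ((univ.filter fun e : E(G) => P e : Finset E(G)) : Set E(G)) := by
    ext e
    simp only [Set.mem_ofPred_eq, coe_filter, mem_univ, true_and, Set.mem_image, Subtype.exists,
      exists_and_left, exists_prop, exists_eq_right_right]
    exact ⟨fun h => ⟨h, hP e h⟩, fun h => h.1⟩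
  rw [h, Set.ncard_image_of_injective _ Subtype.val_injective, Set.ncard_coe_finset, sum_boole]

theorem adjMatrix_eq_sum [Fintype E(G)] [DecidableEq V(G)] [G.Loopless] :
    G.adjMatrix = ∑ e, linkBlock (G.orientFst e) (G.orientSnd e) := by
  classical
  ext x y
  rw [adjMatrix, Matrix.of_apply, ncard_setOf_edge _ fun e he => IsLink.edge_mem he,
    Matrix.sum_apply]
  refine Finset.sum_congr rfl fun e _ => ?_
  have hl := (isLink_orient e).isLink_iff (x' := (x : α)) (y' := y)
  have hne := orientFst_ne_orientSnd e
  simp only [← Subtype.ext_iff] at hl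
  simp only [hl, linkBlock, Matrix.of_apply]
  by_cases h1 : G.orientFst e = x
  · have h2 : x ≠ G.orientSnd e := h1 ▸ hne
    simp [h1, h2, h2.symm, eq_comm]
  · simp [h1, Ne.symm h1, eq_comm, and_comm]

/-- The second component of the name of an edge is determined by its ends, so the edges between two
given vertices of the covering are counted by the underlying edges of `G`. -/
theorem covering_adjMatrix_apply [Fintype E(G)] [DecidableEq V(G)] [G.Loopless] {r : ℕ}
    (σ : E(G) → Perm (Fin r)) (p q : V(G.covering (G.labelingOfPerms σ))) :
    (G.covering (G.labelingOfPerms σ)).adjMatrix p q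
      = (∑ e, liftBlock (G.orientFst e) (G.orientSnd e) (σ e))
        (⟨p.1.1, p.2⟩, p.1.2) (⟨q.1.1, q.2⟩, q.1.2) := by
  classical
  have h : {a | (G.covering (G.labelingOfPerms σ)).IsLink a p q}
      = (fun e => (e, s(p.1, q.1))) '' {e | ∃ h : G.IsLink e p.1.1 q.1.1,
        (G.labelingOfPerms σ).perm ⟨e, p.1.1, q.1.1, h⟩ p.1.2 = q.1.2} := by
    ext ⟨e, a⟩
    constructor
    · rintro ⟨h1, h2⟩
      exact ⟨e, h2, Prod.ext rfl h1.symm⟩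
    · rintro ⟨e', h2, h1⟩
      obtain ⟨rfl, rfl⟩ := Prod.mk.inj h1
      exact ⟨rfl, h2⟩
  rw [adjMatrix, Matrix.of_apply, h, Set.ncard_image_of_injective _ fun e e' he =>
    congrArg Prod.fst he, ncard_setOf_edge _ fun e he => he.1.edge_mem, Matrix.sum_apply]
  refine Finset.sum_congr rfl fun e _ => ?_
  obtain ⟨⟨x, i⟩, hx⟩ := p
  obtain ⟨⟨y, j⟩, hy⟩ := q
  have hne := orientFst_ne_orientSnd e
  have hl := isLink_orient e
  have hperm := labelingOfPerms_orient σ e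
  simp only [liftBlock, Matrix.of_apply]
  by_cases hL : G.IsLink e x y
  · rcases hl.eq_and_eq_or_eq_and_eq hL with ⟨h1, h2⟩ | ⟨h1, h2⟩
    · subst h1; subst h2
      have e1 : ∀ h, (⟨e, G.orientFst e, G.orientSnd e, h⟩ : G.OrientedEdge) = G.orient e :=
        fun _ => rfl
      simp [e1, hL, hperm, hne]
    · subst h1; subst h2
      have e1 : ∀ h, (⟨e, G.orientSnd e, G.orientFst e, h⟩ : G.OrientedEdge)
        = (G.orient e).reverse := fun _ => rfl
      simp [e1, hL, PermLabeling.perm_reverse, hperm, hne.symm, Equiv.symm_apply_eq]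
      exact if_congr eq_comm rfl rfl
  · have h1 : ¬ ((⟨x, hx⟩ : V(G)) = G.orientFst e ∧ (⟨y, hy⟩ : V(G)) = G.orientSnd e) := by
      rintro ⟨h1, h2⟩
      refine hL ?_
      rw [← h1, ← h2] at hl
      exact hl
    have h2 : ¬ ((⟨x, hx⟩ : V(G)) = G.orientSnd e ∧ (⟨y, hy⟩ : V(G)) = G.orientFst e) := by
      rintro ⟨h1, h2⟩
      refine hL ?_
      rw [← h1, ← h2] at hl
      exact hl.symm
    rw [if_neg fun h => hL h.1, if_neg fun h => h1 ⟨h.1, h.2.1⟩, if_neg fun h => h2 ⟨h.1, h.2.1⟩,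
      add_zero]

theorem eigenvalues_eq_roots [Finite V(G)] {n : Type*} [Fintype n] [DecidableEq n] (φ : V(G) ≃ n)
    (M : Matrix n n ℝ) (h : ∀ x y, G.adjMatrix x y = M (φ x) (φ y)) :
    G.eigenvalues = M.charpoly.roots := by
  classical
  let _ := Fintype.ofFinite V(G)
  have e : M = Matrix.reindex φ φ G.adjMatrix := by
    ext i j
    simp [h]
  rw [e, Matrix.charpoly_reindex]
  unfold eigenvalues
  congr!

/-- The factorization of the characteristic polynomial turns the difference of multisets of roots
into the roots of the second factor. -/
theorem newEigenvalues_labelingOfPerms [Fintype V(G)] [DecidableEq V(G)] [Fintype E(G)]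
    [G.Loopless] {d : ℕ} (σ : E(G) → Perm (Fin (d + 1))) :
    G.newEigenvalues (G.labelingOfPerms σ)
      = (∑ e, edgeBlock (G.orientFst e) (G.orientSnd e) (permVectors (σ e))).charpoly.roots := by
  let φ : V(G.covering (G.labelingOfPerms σ)) ≃ V(G) × Fin (d + 1) :=
    { toFun := fun p => (⟨p.1.1, p.2⟩, p.1.2)
      invFun := fun p => ⟨(p.1.1, p.2), p.1.2⟩
      left_inv := fun _ => rfl
      right_inv := fun _ => rfl }
  rw [newEigenvalues, eigenvalues_eq_roots φ _ (covering_adjMatrix_apply σ),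
    eigenvalues_eq_roots (Equiv.refl V(G)) G.adjMatrix fun _ _ => rfl, charpoly_sum_liftBlock,
    ← adjMatrix_eq_sum, Polynomial.roots_mul, add_tsub_cancel_left]
  exact mul_ne_zero (Matrix.charpoly_monic _).ne_zero (Matrix.charpoly_monic _).ne_zero

end Graph

end Coverings

/-! ### The main theorem -/

theorem mainTheorem1 {α β : Type*} (G : Graph α β) [Finite V(G)] [Finite E(G)]
    [G.Loopless] (hconn : G.IsConnected) (v₀ : V(G)) (r : ℕ) (hr : 1 ≤ r) :
    ∃ σ : G.PermLabeling r, G.IsOneSidedRamanujan v₀ σ := by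
  classical
  let _ := Fintype.ofFinite V(G)
  let _ := Fintype.ofFinite E(G)
  let _ := Fintype.ofFinite G.OrientedEdge
  -- Each vertex contributes `d = r - 1` dimensions to the new part; for `r = 1` it is empty.
  obtain ⟨d, rfl⟩ : ∃ d, r = d + 1 := ⟨r - 1, by omega⟩
  obtain ⟨σ, hσ⟩ := exists_perm_eval_charpoly_pos (d := d) (s := G.orientFst) (t := G.orientSnd)
    (fun e => Graph.orientFst_ne_orientSnd e) (ρ := G.coverSpectralRadius v₀) fun x hx => by
      obtain ⟨h, h1, h2, h3⟩ := Graph.exists_edge_weights hconn v₀ hx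
      -- The weights live on oriented edges of `G`; sums over them become sums over edges with a
      -- Boolean orientation.
      have hsum : ∀ (P : G.OrientedEdge → Prop) (Q : E(G) × Bool → Prop)
          [DecidablePred P] [DecidablePred Q],
          (∀ δ, P (G.orientedEdgeEquiv δ) ↔ Q δ) →
          ∑ δ with Q δ, h (G.orientedEdgeEquiv δ) = ∑ d with P d, h d := by
        intro P Q _ _ hPQ
        rw [Finset.sum_filter, Finset.sum_filter, ← Equiv.sum_comp G.orientedEdgeEquiv]
        simp only [hPQ]
      refine average_det_pos _ _ (fun e => Graph.orientFst_ne_orientSnd e) x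
        (fun δ => h (G.orientedEdgeEquiv δ)) (fun δ => h1 _) (fun δ => ?_) fun p => ?_
      · refine le_of_eq_of_le ?_ (h2 (G.orientedEdgeEquiv δ))
        congr 1
        refine hsum _ _ fun δ' => ?_
        rw [Graph.orientedEdgeEquiv_fst, Graph.orientedEdgeEquiv_snd, ← Graph.orientedEdgeEquiv_not,
          Ne, G.orientedEdgeEquiv.injective.eq_iff, Subtype.val_inj]
      · refine lt_of_eq_of_lt ?_ (h3 p p.2)
        refine hsum _ _ fun δ' => ?_
        rw [Graph.orientedEdgeEquiv_fst, Subtype.val_inj]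
  refine ⟨G.labelingOfPerms σ, fun μ hμ => ?_⟩
  rw [Graph.newEigenvalues_labelingOfPerms] at hμ
  by_contra! hlt
  exact (hσ μ hlt).ne' (Polynomial.isRoot_of_mem_roots hμ)
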